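/- **Setting.** Let $G=\widetilde{SL}_2$ be the universal covering group of $SL(2,\mathbb R)\cong SU(1,1)$, with Lie algebra identified with $\mathfrak{su}(1,1)$, and let $$e_1=\tfrac12\begin{pmatrix}0&1\\1&0\end{pmatrix},\quad e_2=\tfrac12\begin{pmatrix}0&i\\-i&0\end{pmatrix},\quad e_3=\tfrac14\begin{pmatrix}i&0\\0&-i\end{pmatrix}.$$ Give $G$ the left invariant metric for which $e_1,e_2,e_3$ is orthonormal (and positively oriented), with Levi-Civita connection $\nabla$. Let $D\subset\mathbb C$ be open, $z=x+iy$, $\partial=\frac12(\partial_x-i\partial_y)$, $\bar\partial=\frac12(\partial_x+i\partial_y)$; a subscript $z$ or $\bar z$ denotes $\partial$ or $\bar\partial$. A surface is a smooth immersion $f:D\to G$ with induced metric $e^{2\alpha}dz\,d\bar z$. Let $N$ be its unit normal (the direction of $f_x\times f_y$), $H$ its mean curvature (half the trace of the second fundamental form $\langle\nabla df,N\rangle$), $A\,dz^2$ with $A=\langle\nabla_{f_z}f_z,N\rangle$ its Hopf differential, and $f^{-1}\partial f=\sum_k Z_ke_k$. A generating spinor of $f$ is a smooth $\psi=(\psi_1,\psi_2):D\to\mathbb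 C^2$ with $$Z_1=\tfrac i2(\bar\psi_2^2+\psi_1^2),\quad Z_2=\tfrac12(\bar\psi_2^2-\psi_1^2),\quad Z_3=\psi_1\bar\psi_2 .$$ The Dirac equation with a real function $H$ is $$\partial\psi_2+U\psi_1=0,\qquad -\bar\partial\psi_1+V\psi_2=0, \tag{1}$$ $$U=\tfrac H2(|\psi_1|^2+|\psi_2|^2)+i\left(\tfrac12|\psi_1|^2-\tfrac34|\psi_2|^2\right),\quad V=\tfrac H2(|\psi_1|^2+|\psi_2|^2)+i\left(\tfrac34|\psi_1|^2-\tfrac12|\psi_2|^2\right).$$ **Theorem.** (a) Let $f:D\to G$ be a surface. If $D$ is simply connected, $f$ has a generating spinor, unique up to sign. The functions $\alpha,H,A$ are smooth, and every generating spinor $\psi$ of $f$ is nowhere zero, satisfies $e^{\alpha}=|\psi_1|^2+|\psi_2|^2$, and satisfies the Dirac equation (1), where $H$ is the mean curvature. The Weingarten equations are (1) together with $$\partial\psi_1=\alpha_z\psi_1+Ae^{-\alpha}\psi_2+\tfrac{5i}4\psi_1^2\bar\psi_2,\qquad \bar\partial\psi_2=-\bar Ae^{-\alpha}\psi_1+\alpha_{\bar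 z}\psi_2+\tfrac{5i}4\bar\psi_1\psi_2^2 ,$$ the Hopf differential is given by $$A=(\bar\psi_2\partial\psi_1-\psi_1\partial\bar\psi_2)-\tfrac{5i}2\psi_1^2\bar\psi_2^2 ,$$ and the Codazzi equations are $$\alpha_{z\bar z}-e^{-2\alpha}|A|^2+\tfrac14e^{2\alpha}H^2=e^{2\alpha}-5|Z_3|^2,$$ $$\bar\partial\left(A+\frac{5Z_3^2}{2(H-i)}\right)=\tfrac12H_ze^{2\alpha}+\bar\partial\left(\frac5{2(H-i)}\right)Z_3^2 ;$$ all these equations hold on $D$. (b) Conversely, let $D$ be simply connected, let $H:D\to\mathbb R$ be a function and $\psi:D\to\mathbb C^2$ a smooth nowhere vanishing solution of (1). Then for all $p\in D$ and $g\in G$ there is exactly one surface $f:D\to G$ with $f(p)=g$ that has $\psi$ as a generating spinor, and the mean curvature of $f$ is $H$. -/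

import Mathlib

open scoped ContDiff Manifold Matrix

/-- The universal covering group of `SL(2, ℝ)`, in global coordinates `(b, t) : ℂ × ℝ`.

`SL(2, ℝ)` is identified with the group `SU(1,1)` of complex matrices `[[a, b], [conj b, conj a]]`
with `|a|² - |b|² = 1` (they act on the unit disc), and a point of the universal cover is such a
matrix together with a real number `t` with `a = |a| exp (i t)`.  Since `|a| = √(1 + |b|²)`,
the pair `(b, t)` determines the point and is unrestricted. The group law, the Lie group structure,
simple connectedness and the covering homomorphism onto `SL(2, ℝ)` are established below. -/
def SL2Tilde : Type := ℂ × ℝ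

namespace SL2Tilde
noncomputable section

instance : TopologicalSpace SL2Tilde := inferInstanceAs (TopologicalSpace (ℂ × ℝ))
instance : ChartedSpace (ℂ × ℝ) SL2Tilde := inferInstanceAs (ChartedSpace (ℂ × ℝ) (ℂ × ℝ))

/-- The entry `b` of the matrix under the point `p`. -/
def entryB (p : SL2Tilde) : ℂ := p.1
/-- The chosen argument `t` of the entry `a` of the matrix under the point `p`. -/
def angle (p : SL2Tilde) : ℝ := p.2
/-- The entry `a` of the matrix under the point `p`. -/
def entryA (p : SL2Tilde) : ℂ :=
  (Real.sqrt (1 + Complex.normSq p.entryB) : ℝ) * Complex.exp (p.angle * Complex.I)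

@[ext] lemma ext {p q : SL2Tilde} (h1 : p.entryB = q.entryB) (h2 : p.angle = q.angle) : p = q :=
  Prod.ext h1 h2

/-- The upper left entry of the product matrix is `a a' + b (conj b') = a a' (1 + ratio)`,
and `|ratio| < 1`. -/
def ratio (p q : SL2Tilde) : ℂ :=
  p.entryB * (starRingEnd ℂ) q.entryB / (p.entryA * q.entryA)

/-- The lift of the matrix multiplication: the angles add up, corrected by the principal
argument of `1 + ratio`, which lies in `(-π/2, π/2)`. -/
instance : Mul SL2Tilde where
  mul p q := (p.entryA * q.entryB + p.entryB * (starRingEnd ℂ) q.entryA,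
    p.angle + q.angle + Complex.arg (1 + ratio p q))
instance : One SL2Tilde where
  one := ((0 : ℂ), (0 : ℝ))
instance : Inv SL2Tilde where
  inv p := (-p.entryB, -p.angle)

lemma mul_entryB (p q : SL2Tilde) :
    (p * q).entryB = p.entryA * q.entryB + p.entryB * (starRingEnd ℂ) q.entryA := rfl
lemma mul_angle (p q : SL2Tilde) :
    (p * q).angle = p.angle + q.angle + Complex.arg (1 + ratio p q) := rfl
lemma one_entryB : (1 : SL2Tilde).entryB = 0 := rfl
lemma one_angle : (1 : SL2Tilde).angle = 0 := rfl
lemma inv_entryB (p : SL2Tilde) : (p⁻¹).entryB = -p.entryB := rfl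
lemma inv_angle (p : SL2Tilde) : (p⁻¹).angle = -p.angle := rfl
lemma one_entryA : (1 : SL2Tilde).entryA = 1 := by simp [entryA, one_entryB, one_angle]

lemma normSq_entryA (p : SL2Tilde) :
    Complex.normSq p.entryA = 1 + Complex.normSq p.entryB := by
  have h : (0 : ℝ) ≤ 1 + Complex.normSq p.entryB := by
    have := Complex.normSq_nonneg p.entryB; positivity
  rw [entryA, Complex.normSq_mul, Complex.normSq_ofReal, Real.mul_self_sqrt h,
    Complex.normSq_eq_norm_sq (Complex.exp _), Complex.norm_exp_ofReal_mul_I]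
  simp

lemma entryA_ne_zero (p : SL2Tilde) : p.entryA ≠ 0 := by
  intro h
  have := normSq_entryA p
  rw [h] at this
  have := Complex.normSq_nonneg p.entryB
  simp at *
  linarith

lemma norm_entryB_lt (p : SL2Tilde) : ‖p.entryB‖ < ‖p.entryA‖ := by
  have := normSq_entryA p
  rw [Complex.normSq_eq_norm_sq, Complex.normSq_eq_norm_sq] at this
  nlinarith [norm_nonneg p.entryA, norm_nonneg p.entryB]

lemma norm_ratio_lt (p q : SL2Tilde) : ‖ratio p q‖ < 1 := by
  rw [ratio, norm_div, norm_mul, norm_mul, RCLike.norm_conj, div_lt_one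
    (by have := p.entryA_ne_zero; have := q.entryA_ne_zero; positivity)]
  exact mul_lt_mul'' (norm_entryB_lt p) (norm_entryB_lt q) (norm_nonneg _) (norm_nonneg _)

lemma re_pos (p q : SL2Tilde) : 0 < (1 + ratio p q).re := by
  have h := norm_ratio_lt p q
  have := (abs_le.1 (Complex.abs_re_le_norm (ratio p q))).1
  simp; linarith

lemma entryA_eq (p : SL2Tilde) :
    p.entryA = ‖p.entryA‖ * Complex.exp (p.angle * Complex.I) := by
  have h : ‖p.entryA‖ = Real.sqrt (1 + Complex.normSq p.entryB) := by
    rw [← normSq_entryA, Complex.normSq_eq_norm_sq, Real.sqrt_sq (norm_nonneg _)]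
  rw [h, entryA]

lemma conj_mul (z : ℂ) : (starRingEnd ℂ) z * z = Complex.normSq z :=
  Complex.normSq_eq_conj_mul_self.symm

lemma mul_entryA (p q : SL2Tilde) :
    (p * q).entryA = p.entryA * q.entryA + p.entryB * (starRingEnd ℂ) q.entryB := by
  have hp := p.entryA_ne_zero
  have hq := q.entryA_ne_zero
  set c : ℂ := p.entryA * q.entryA + p.entryB * (starRingEnd ℂ) q.entryB with hc
  have hfac : c = p.entryA * q.entryA * (1 + ratio p q) := by
    rw [hc, ratio]; field_simp
  have hnorm : Complex.normSq c = 1 + Complex.normSq (p * q).entryB := by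
    have h1 := congrArg (fun x : ℝ => (x : ℂ)) (normSq_entryA p)
    have h2 := congrArg (fun x : ℝ => (x : ℂ)) (normSq_entryA q)
    apply Complex.ofReal_injective
    push_cast at h1 h2 ⊢
    simp only [← conj_mul] at h1 h2 ⊢
    rw [mul_entryB, hc]
    simp only [map_add, map_mul, Complex.conj_conj]
    linear_combination ((starRingEnd ℂ) q.entryA * q.entryA
      - (starRingEnd ℂ) q.entryB * q.entryB) * h1 + h2
  have hsq : Real.sqrt (1 + Complex.normSq (p * q).entryB) = ‖c‖ := by
    rw [← hnorm, Complex.normSq_eq_norm_sq, Real.sqrt_sq (norm_nonneg _)]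
  rw [entryA, hsq, mul_angle]
  have hr := Complex.norm_mul_exp_arg_mul_I (1 + ratio p q)
  rw [hfac, norm_mul, norm_mul]
  conv_rhs => rw [← hr, entryA_eq p, entryA_eq q]
  push_cast
  rw [add_mul, add_mul, Complex.exp_add, Complex.exp_add]
  ring

lemma inv_entryA (p : SL2Tilde) : (p⁻¹).entryA = (starRingEnd ℂ) p.entryA := by
  rw [entryA, entryA, inv_entryB, inv_angle, map_mul, Complex.conj_ofReal, ← Complex.exp_conj]
  simp

lemma angle_eq_of {x y x' y' : ℂ} {s : ℝ} (hx : 0 < x.re) (hy : 0 < y.re) (hx' : 0 < x'.re)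
    (hy' : 0 < y'.re)
    (h : Complex.exp (((s + x.arg + y.arg : ℝ) : ℂ) * Complex.I)
      = Complex.exp (((s + x'.arg + y'.arg : ℝ) : ℂ) * Complex.I)) :
    x.arg + y.arg = x'.arg + y'.arg := by
  have b := fun {z : ℂ} (hz : 0 < z.re) => abs_lt.1 (Complex.abs_arg_lt_pi_div_two_iff.2 (Or.inl hz))
  obtain ⟨n, hn⟩ := Complex.exp_eq_exp_iff_exists_int.1 h
  have hn' : s + x.arg + y.arg = s + x'.arg + y'.arg + n * (2 * Real.pi) := by
    have := congrArg Complex.im hn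
    simpa using this
  have h1 := b hx
  have h2 := b hy
  have h3 := b hx'
  have h4 := b hy'
  have hpi := Real.pi_pos
  have hn0 : n = 0 := by
    have hlt : (n : ℝ) < 1 := by nlinarith
    have hgt : (-1 : ℝ) < n := by nlinarith
    have h5 : n < 1 := by exact_mod_cast hlt
    have h6 : -1 < n := by exact_mod_cast hgt
    omega
  rw [hn0] at hn'
  simp at hn'
  linarith

lemma exp_angle (p : SL2Tilde) :
    Complex.exp (p.angle * Complex.I) = p.entryA / ‖p.entryA‖ := by
  have h : (‖p.entryA‖ : ℂ) ≠ 0 := by simpa using p.entryA_ne_zero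
  rw [eq_div_iff h, mul_comm, ← entryA_eq]

protected lemma mul_assoc' (p q r : SL2Tilde) : p * q * r = p * (q * r) := by
  have hA : (p * q * r).entryA = (p * (q * r)).entryA := by
    simp only [mul_entryA, mul_entryB, map_add, map_mul, Complex.conj_conj]; ring
  apply ext
  · simp only [mul_entryA, mul_entryB, map_add, map_mul, Complex.conj_conj]; ring
  · have h : Complex.exp ((p * q * r).angle * Complex.I)
        = Complex.exp ((p * (q * r)).angle * Complex.I) := by
      rw [exp_angle, exp_angle, hA]
    have e1 : (p * q * r).angle = (p.angle + q.angle + r.angle) + (1 + ratio p q).arg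
        + (1 + ratio (p * q) r).arg := by simp only [mul_angle]; ring
    have e2 : (p * (q * r)).angle = (p.angle + q.angle + r.angle) + (1 + ratio q r).arg
        + (1 + ratio p (q * r)).arg := by simp only [mul_angle]; ring
    rw [e1, e2] at h
    have := angle_eq_of (re_pos _ _) (re_pos _ _) (re_pos _ _) (re_pos _ _) h
    rw [e1, e2]; linarith

instance : Group SL2Tilde := Group.ofLeftAxioms SL2Tilde.mul_assoc'
  (fun p => by
    apply ext
    · rw [mul_entryB, one_entryA, one_entryB]; simp
    · rw [mul_angle, ratio, one_entryB, one_angle]; simp)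
  (fun p => by
    apply ext
    · rw [mul_entryB, inv_entryA, inv_entryB, one_entryB]; ring
    · rw [mul_angle, ratio, inv_entryA, inv_entryB, inv_angle, one_angle]
      have h : (1 : ℂ) + -p.entryB * (starRingEnd ℂ) p.entryB / ((starRingEnd ℂ) p.entryA * p.entryA)
          = ((1 - Complex.normSq p.entryB / Complex.normSq p.entryA : ℝ) : ℂ) := by
        push_cast
        rw [← conj_mul, ← conj_mul]; ring
      rw [h, Complex.arg_ofReal_of_nonneg]
      · ring
      · have h0 := normSq_entryA p
        have h1 := Complex.normSq_nonneg p.entryB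
        rw [sub_nonneg, div_le_one (by linarith)]
        linarith)

/-- The covering homomorphism onto `SU(1,1)`, viewed as complex `2 × 2` matrices. -/
def toMatrix : SL2Tilde →* Matrix (Fin 2) (Fin 2) ℂ where
  toFun p := !![p.entryA, p.entryB; (starRingEnd ℂ) p.entryB, (starRingEnd ℂ) p.entryA]
  map_one' := by simp [one_entryA, one_entryB, Matrix.one_fin_two]
  map_mul' p q := by
    rw [mul_entryA, mul_entryB]
    ext i j
    fin_cases i <;> fin_cases j <;> simp [Matrix.mul_apply, Fin.sum_univ_two] <;> ring

/-- The real matrix of the map `v ↦ a v + b (conj v)` of `ℂ = ℝ²`. -/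
def toSLFun (p : SL2Tilde) : Matrix.SpecialLinearGroup (Fin 2) ℝ :=
  ⟨!![p.entryA.re + p.entryB.re, p.entryB.im - p.entryA.im;
      p.entryA.im + p.entryB.im, p.entryA.re - p.entryB.re], by
    have := normSq_entryA p
    rw [Complex.normSq_apply, Complex.normSq_apply] at this
    rw [Matrix.det_fin_two_of]; linarith⟩

lemma coe_toSLFun (p : SL2Tilde) : (toSLFun p : Matrix (Fin 2) (Fin 2) ℝ) =
    !![p.entryA.re + p.entryB.re, p.entryB.im - p.entryA.im;
      p.entryA.im + p.entryB.im, p.entryA.re - p.entryB.re] := rfl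

/-- The covering homomorphism onto `SL(2, ℝ)`. -/
def toSL : SL2Tilde →* Matrix.SpecialLinearGroup (Fin 2) ℝ where
  toFun := toSLFun
  map_one' := by
    apply Subtype.ext
    rw [coe_toSLFun, Matrix.SpecialLinearGroup.coe_one, Matrix.one_fin_two]
    simp [one_entryA, one_entryB]
  map_mul' p q := by
    apply Subtype.ext
    rw [Matrix.SpecialLinearGroup.coe_mul, coe_toSLFun, coe_toSLFun, coe_toSLFun]
    ext i j
    fin_cases i <;> fin_cases j <;> simp [mul_entryA, mul_entryB] <;> ring

instance : SimplyConnectedSpace SL2Tilde :=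
  have : ContractibleSpace SL2Tilde := inferInstanceAs (ContractibleSpace (ℂ × ℝ))
  inferInstance

instance : IsManifold 𝓘(ℝ, ℂ × ℝ) ∞ SL2Tilde :=
  inferInstanceAs (IsManifold 𝓘(ℝ, ℂ × ℝ) ∞ (ℂ × ℝ))

lemma contDiff_entryB : ContDiff ℝ ∞ (fun p : ℂ × ℝ => entryB p) := contDiff_fst
lemma contDiff_angle : ContDiff ℝ ∞ (fun p : ℂ × ℝ => angle p) := contDiff_snd

lemma contDiff_conj : ContDiff ℝ ∞ (fun z : ℂ => (starRingEnd ℂ) z) :=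
  Complex.conjCLE.contDiff

lemma contDiff_entryA : ContDiff ℝ ∞ (fun p : ℂ × ℝ => entryA p) := by
  have h1 : ContDiff ℝ ∞ (fun p : ℂ × ℝ => Real.sqrt (1 + Complex.normSq (entryB p))) := by
    apply ContDiff.sqrt
    · simp only [Complex.normSq_apply]
      have hr : ContDiff ℝ ∞ (fun p : ℂ × ℝ => (entryB p).re) := Complex.reCLM.contDiff.comp contDiff_entryB
      have hi : ContDiff ℝ ∞ (fun p : ℂ × ℝ => (entryB p).im) := Complex.imCLM.contDiff.comp contDiff_entryB
      exact contDiff_const.add ((hr.mul hr).add (hi.mul hi))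
    · intro p
      have := Complex.normSq_nonneg (entryB p)
      positivity
  have h2 : ContDiff ℝ ∞ (fun p : ℂ × ℝ => ((angle p : ℝ) : ℂ)) :=
    Complex.ofRealCLM.contDiff.comp contDiff_angle
  exact (Complex.ofRealCLM.contDiff.comp h1).mul (h2.mul contDiff_const).cexp

instance : LieGroup 𝓘(ℝ, ℂ × ℝ) ∞ SL2Tilde where
  contMDiff_mul := by
    have hB1 := contDiff_entryB.comp (contDiff_fst (𝕜 := ℝ) (E := ℂ × ℝ) (F := ℂ × ℝ))
    have hB2 := contDiff_entryB.comp (contDiff_snd (𝕜 := ℝ) (E := ℂ × ℝ) (F := ℂ × ℝ))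
    have hA1 := contDiff_entryA.comp (contDiff_fst (𝕜 := ℝ) (E := ℂ × ℝ) (F := ℂ × ℝ))
    have hA2 := contDiff_entryA.comp (contDiff_snd (𝕜 := ℝ) (E := ℂ × ℝ) (F := ℂ × ℝ))
    have ht1 := contDiff_angle.comp (contDiff_fst (𝕜 := ℝ) (E := ℂ × ℝ) (F := ℂ × ℝ))
    have ht2 := contDiff_angle.comp (contDiff_snd (𝕜 := ℝ) (E := ℂ × ℝ) (F := ℂ × ℝ))
    have hr : ContDiff ℝ ∞ (fun x : (ℂ × ℝ) × (ℂ × ℝ) => 1 + ratio x.1 x.2) :=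
      contDiff_const.add ((hB1.mul (contDiff_conj.comp hB2)).mul ((hA1.mul hA2).inv
        fun x => mul_ne_zero (entryA_ne_zero x.1) (entryA_ne_zero x.2)))
    have harg : ContDiff ℝ ∞ (fun x : (ℂ × ℝ) × (ℂ × ℝ) => Complex.arg (1 + ratio x.1 x.2)) := by
      simp only [← Complex.log_im]
      have hlog : ContDiff ℝ ∞ (fun x : (ℂ × ℝ) × (ℂ × ℝ) => Complex.log (1 + ratio x.1 x.2)) :=
        contDiff_iff_contDiffAt.2 fun x =>
          ContDiffAt.comp (g := Complex.log) x
            ((Complex.contDiffAt_log (Or.inl (re_pos x.1 x.2))).restrict_scalars ℝ) hr.contDiffAt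
      exact Complex.imCLM.contDiff.comp hlog
    have key : ContDiff ℝ ∞ (fun x : (ℂ × ℝ) × (ℂ × ℝ) =>
        ((entryA x.1 * entryB x.2 + entryB x.1 * (starRingEnd ℂ) (entryA x.2),
          angle x.1 + angle x.2 + Complex.arg (1 + ratio x.1 x.2)) : ℂ × ℝ)) :=
      ((hA1.mul hB2).add (hB1.mul (contDiff_conj.comp hA2))).prodMk ((ht1.add ht2).add harg)
    have h := key.contMDiff
    rw [modelWithCornersSelf_prod, ← chartedSpaceSelf_prod] at h
    exact h
  contMDiff_inv := by
    have key : ContDiff ℝ ∞ (fun p : ℂ × ℝ => ((-entryB p, -angle p) : ℂ × ℝ)) :=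
      contDiff_entryB.neg.prodMk contDiff_angle.neg
    exact key.contMDiff

instance : IsTopologicalGroup SL2Tilde :=
  topologicalGroup_of_lieGroup 𝓘(ℝ, ℂ × ℝ) ∞

lemma sqrt_sq' (b : ℂ) : Real.sqrt (1 + Complex.normSq b) ^ 2 = 1 + b.re * b.re + b.im * b.im := by
  have h2 := Complex.normSq_nonneg b
  rw [Real.sq_sqrt (by linarith), Complex.normSq_apply]; ring

/-- The element of `SL(2, ℝ)` with given `b` and given `a / |a|`. -/
def ofDisc (x : ℂ × Circle) : Matrix.SpecialLinearGroup (Fin 2) ℝ :=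
  ⟨!![Real.sqrt (1 + Complex.normSq x.1) * (x.2 : ℂ).re + x.1.re,
      x.1.im - Real.sqrt (1 + Complex.normSq x.1) * (x.2 : ℂ).im;
      Real.sqrt (1 + Complex.normSq x.1) * (x.2 : ℂ).im + x.1.im,
      Real.sqrt (1 + Complex.normSq x.1) * (x.2 : ℂ).re - x.1.re], by
    have h1 := Circle.normSq_coe x.2
    rw [Complex.normSq_apply] at h1
    rw [Matrix.det_fin_two_of]
    linear_combination (Real.sqrt (1 + Complex.normSq x.1)) ^ 2 * h1 + sqrt_sq' x.1⟩

/-- The entry `b` of the matrix in `SU(1,1)` that corresponds to `A`. -/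
def slB (A : Matrix.SpecialLinearGroup (Fin 2) ℝ) : ℂ :=
  ⟨(A.1 0 0 - A.1 1 1) / 2, (A.1 0 1 + A.1 1 0) / 2⟩
/-- The entry `a` of the matrix in `SU(1,1)` that corresponds to `A`. -/
def slA (A : Matrix.SpecialLinearGroup (Fin 2) ℝ) : ℂ :=
  ⟨(A.1 0 0 + A.1 1 1) / 2, (A.1 1 0 - A.1 0 1) / 2⟩

lemma normSq_slA (A : Matrix.SpecialLinearGroup (Fin 2) ℝ) :
    1 + Complex.normSq (slB A) = Complex.normSq (slA A) := by
  have h := A.2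
  rw [Matrix.det_fin_two] at h
  rw [slA, slB, Complex.normSq_mk, Complex.normSq_mk]
  linear_combination -h

lemma slA_ne_zero (A : Matrix.SpecialLinearGroup (Fin 2) ℝ) : slA A ≠ 0 := by
  intro h
  have h1 := normSq_slA A
  have h2 := Complex.normSq_nonneg (slB A)
  rw [h, map_zero] at h1
  linarith

lemma sqrt_slB (A : Matrix.SpecialLinearGroup (Fin 2) ℝ) :
    Real.sqrt (1 + Complex.normSq (slB A)) = ‖slA A‖ := by
  rw [normSq_slA, Complex.normSq_eq_norm_sq, Real.sqrt_sq (norm_nonneg _)]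

/-- The unit complex number `a / |a|`. -/
def slU (A : Matrix.SpecialLinearGroup (Fin 2) ℝ) : Circle :=
  ⟨slA A / ‖slA A‖, by
    have := slA_ne_zero A
    simp [Submonoid.unitSphere, this]⟩

lemma slB_ofDisc (x : ℂ × Circle) : slB (ofDisc x) = x.1 := by
  apply Complex.ext
  · simp [slB, ofDisc]
  · simp [slB, ofDisc]; ring

lemma slA_ofDisc (x : ℂ × Circle) :
    slA (ofDisc x) = (Real.sqrt (1 + Complex.normSq x.1) : ℝ) * (x.2 : ℂ) := by
  apply Complex.ext <;> simp [slA, ofDisc] <;> ring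

lemma norm_mul_slU (A : Matrix.SpecialLinearGroup (Fin 2) ℝ) : (‖slA A‖ : ℂ) * (slU A : ℂ) = slA A := by
  have := slA_ne_zero A
  have h : (‖slA A‖ : ℂ) ≠ 0 := by simpa using this
  change (‖slA A‖ : ℂ) * (slA A / ‖slA A‖) = slA A
  field_simp

/-- `SL(2, ℝ)` is homeomorphic to `ℂ × Circle`. -/
def slHomeo : ℂ × Circle ≃ₜ Matrix.SpecialLinearGroup (Fin 2) ℝ where
  toFun := ofDisc
  invFun A := (slB A, slU A)
  left_inv x := by
    apply Prod.ext
    · exact slB_ofDisc x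
    · apply Circle.ext
      have h := norm_mul_slU (ofDisc x)
      have h0 := slA_ne_zero (ofDisc x)
      rw [← sqrt_slB, slB_ofDisc, slA_ofDisc] at h
      rw [slA_ofDisc] at h0
      exact mul_left_cancel₀ (left_ne_zero_of_mul h0) h
  right_inv A := by
    have h := norm_mul_slU A
    have h1 := congrArg Complex.re h
    have h2 := congrArg Complex.im h
    rw [Complex.re_ofReal_mul, ← sqrt_slB] at h1
    rw [Complex.im_ofReal_mul, ← sqrt_slB] at h2
    apply Subtype.ext
    ext i j
    fin_cases i <;> fin_cases j <;> (simp [ofDisc, h1, h2]; simp [slA, slB]; ring)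
  continuous_toFun := by
    refine Continuous.subtype_mk ?_ _
    have h1 : Continuous fun x : ℂ × Circle => (x.2 : ℂ) := by fun_prop
    refine continuous_matrix fun i j => ?_
    fin_cases i <;> fin_cases j <;> simp <;> simp only [Complex.normSq_apply] <;> fun_prop
  continuous_invFun := by
    have hc : ∀ i j, Continuous fun A : Matrix.SpecialLinearGroup (Fin 2) ℝ => A.1 i j :=
      fun i j => (continuous_subtype_val.matrix_elem i j)
    have c : ∀ u v : Matrix.SpecialLinearGroup (Fin 2) ℝ → ℝ, Continuous u → Continuous v →
        Continuous fun A => (⟨u A, v A⟩ : ℂ) := fun u v hu hv =>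
      Complex.equivRealProdCLM.symm.continuous.comp (hu.prodMk hv)
    have hB : Continuous slB := c _ _ (((hc 0 0).sub (hc 1 1)).div_const 2)
      (((hc 0 1).add (hc 1 0)).div_const 2)
    have hA : Continuous slA := c _ _ (((hc 0 0).add (hc 1 1)).div_const 2)
      (((hc 1 0).sub (hc 0 1)).div_const 2)
    refine hB.prodMk (Continuous.subtype_mk (hA.div (Complex.continuous_ofReal.comp hA.norm) ?_) _)
    intro A
    simpa using slA_ne_zero A

/-- Being simply connected, `SL2Tilde` is the universal covering group of `SL(2, ℝ)`. -/
theorem isCoveringMap_toSL : IsCoveringMap toSL := by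
  have hq : Topology.IsQuotientMap toSL := by
    have h : (toSL : SL2Tilde → _) = slHomeo ∘ (Prod.map id Circle.exp : ℂ × ℝ → ℂ × Circle) := by
      funext p
      apply Subtype.ext
      change (toSLFun p).1 = (ofDisc (p.entryB, Circle.exp p.angle)).1
      ext i j
      have hr : (Complex.exp (p.angle * Complex.I)).re = Real.cos p.angle :=
        Complex.exp_ofReal_mul_I_re _
      have hi : (Complex.exp (p.angle * Complex.I)).im = Real.sin p.angle :=
        Complex.exp_ofReal_mul_I_im _
      fin_cases i <;> fin_cases j <;> simp [toSLFun, ofDisc, entryA, hr, hi]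
    rw [h]
    exact slHomeo.isQuotientMap.comp (IsOpenQuotientMap.id.prodMap
      Circle.isAddQuotientCoveringMap_exp.isOpenQuotientMap).isQuotientMap
  refine (hq.isQuotientCoveringMap_of_isDiscrete_ker_monoidHom ?_).isCoveringMap
  have hker : ∀ p : SL2Tilde, p ∈ toSL.ker →
      p.entryB = 0 ∧ Complex.exp (p.angle * Complex.I) = 1 := by
    intro p hp
    have h : toSLFun p = 1 := hp
    have h' := congrArg Subtype.val h
    rw [coe_toSLFun, Matrix.SpecialLinearGroup.coe_one, Matrix.one_fin_two] at h'
    have h00 := congrFun (congrFun h' 0) 0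
    have h01 := congrFun (congrFun h' 0) 1
    have h10 := congrFun (congrFun h' 1) 0
    have h11 := congrFun (congrFun h' 1) 1
    simp at h00 h01 h10 h11
    have hB : p.entryB = 0 := Complex.ext (by simp; linarith) (by simp; linarith)
    have hA : p.entryA = 1 := Complex.ext (by simp; linarith) (by simp; linarith)
    exact ⟨hB, by rw [exp_angle, hA]; simp⟩
  apply IsDiscrete.of_nhdsWithin
  intro x hx
  rw [Filter.le_pure_iff, mem_nhdsWithin]
  refine ⟨{y | |y.angle - x.angle| < 1}, ?_, by simp, ?_⟩
  · have : Continuous angle := contDiff_angle.continuous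
    exact isOpen_lt ((this.sub continuous_const).abs) continuous_const
  · rintro y ⟨hy, hyk⟩
    obtain ⟨hb, he⟩ := hker y hyk
    obtain ⟨hb', he'⟩ := hker x hx
    obtain ⟨n, hn⟩ := Complex.exp_eq_exp_iff_exists_int.1 (he.trans he'.symm)
    have hn' : y.angle = x.angle + n * (2 * Real.pi) := by
      have := congrArg Complex.im hn
      simpa using this
    have hpi := Real.pi_gt_three
    have h1 : |(n : ℝ)| < 1 := by
      have hy' : |y.angle - x.angle| < 1 := hy
      rw [hn', add_sub_cancel_left, abs_mul, abs_of_pos (by linarith : 0 < 2 * Real.pi)] at hy'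
      nlinarith [abs_nonneg (n : ℝ)]
    have h2 : n = 0 := by
      have : |n| < 1 := by exact_mod_cast h1
      exact Int.abs_lt_one_iff.1 this
    rw [h2] at hn'
    exact ext (hb.trans hb'.symm) (by simpa using hn')

end
end SL2Tilde

namespace SLSurface
noncomputable section

/-- The orthonormal basis `e₁, e₂, e₃` of the Lie algebra `su(1,1)`: `e_j = f_j / 2` with
`f₁ = [[0, 1], [1, 0]]`, `f₂ = [[0, i], [-i, 0]]`, `f₃ = [[i/2, 0], [0, -i/2]]`. -/
def lieBasis : Fin 3 → Matrix (Fin 2) (Fin 2) ℂ :=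
  ![!![0, 1 / 2; 1 / 2, 0],
    !![0, Complex.I / 2; -Complex.I / 2, 0],
    !![Complex.I / 4, 0; 0, -Complex.I / 4]]

/-- The coordinates of an element of `su(1,1)` in the basis `e₁, e₂, e₃`. -/
def lieCoord (M : Matrix (Fin 2) (Fin 2) ℂ) : Fin 3 → ℝ :=
  ![2 * (M 0 1).re, 2 * (M 0 1).im, 4 * (M 0 0).im]

lemma lieCoord_sum (x : Fin 3 → ℝ) : lieCoord (∑ k, (x k : ℂ) • lieBasis k) = x := by
  ext k
  fin_cases k <;> simp [lieCoord, lieBasis, Fin.sum_univ_three] <;> ring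

/-- `[e_i, e_j]`. -/
def lieBracket (i j : Fin 3) : Matrix (Fin 2) (Fin 2) ℂ :=
  lieBasis i * lieBasis j - lieBasis j * lieBasis i

/-- The structure constants `⟨[e_i, e_j], e_k⟩`. -/
def structConst (i j k : Fin 3) : ℝ := lieCoord (lieBracket i j) k

lemma lieBracket_eq (i j : Fin 3) :
    lieBracket i j = ∑ k, (structConst i j k : ℂ) • lieBasis k := by
  ext a b
  fin_cases i <;> fin_cases j <;> fin_cases a <;> fin_cases b <;>
    simp [lieBracket, structConst, lieCoord, lieBasis, Fin.sum_univ_three] <;> ring_nf <;>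
    simp <;> ring

/-- The Levi-Civita connection of the left invariant metric for which the left invariant fields
`e₁, e₂, e₃` are orthonormal: `leviCivita i j k` is the component of `∇_{e_i} e_j` along `e_k`. -/
def leviCivita (i j k : Fin 3) : ℝ :=
  (structConst i j k + structConst k i j + structConst k j i) / 2

lemma structConst_swap (i j k : Fin 3) : structConst i j k = -structConst j i k := by
  fin_cases k <;> simp [structConst, lieBracket, lieCoord] <;> ring

/-- The connection has no torsion. -/
lemma leviCivita_torsion (i j k : Fin 3) :
    leviCivita i j k - leviCivita j i k = structConst i j k := by
  rw [leviCivita, leviCivita, structConst_swap j i k]; ring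

/-- The connection is compatible with the metric. -/
lemma leviCivita_metric (i j k : Fin 3) : leviCivita i j k + leviCivita i k j = 0 := by
  rw [leviCivita, leviCivita, structConst_swap i j k, structConst_swap i k j,
    structConst_swap k j i]; ring

/-- `∂ = (∂_x - i ∂_y) / 2`. -/
def dz (h : ℂ → ℂ) (z : ℂ) : ℂ := (fderiv ℝ h z 1 - Complex.I * fderiv ℝ h z Complex.I) / 2

/-- `∂̄ = (∂_x + i ∂_y) / 2`. -/
def dzbar (h : ℂ → ℂ) (z : ℂ) : ℂ := (fderiv ℝ h z 1 + Complex.I * fderiv ℝ h z Complex.I) / 2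

/-- The left translate `f⁻¹ df(v)` to the Lie algebra, in the basis `e₁, e₂, e₃`. The Lie algebra
of `SL2Tilde` is identified with `su(1,1)` by the differential of the covering homomorphism. -/
def leftForm (f : ℂ → SL2Tilde) (z v : ℂ) : Fin 3 → ℝ :=
  lieCoord ((f z)⁻¹.toMatrix *
    Matrix.of fun i j => fderiv ℝ (fun w => (f w).toMatrix i j) z v)

/-- The first fundamental form (the induced metric). -/
def firstForm (f : ℂ → SL2Tilde) (z v w : ℂ) : ℝ := leftForm f z v ⬝ᵥ leftForm f z w

/-- A smooth immersion of `D` for which the coordinate `z = x + i y` is a conformal parameter. -/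
def IsConformalImmersion (D : Set ℂ) (f : ℂ → SL2Tilde) : Prop :=
  ContMDiffOn 𝓘(ℝ, ℂ) 𝓘(ℝ, ℂ × ℝ) ∞ f D ∧
    ∀ z ∈ D, 0 < firstForm f z 1 1 ∧ firstForm f z Complex.I Complex.I = firstForm f z 1 1 ∧
      firstForm f z 1 Complex.I = 0

/-- The function `α` for which the induced metric is `e^{2α} dz dz̄`. -/
def confExp (f : ℂ → SL2Tilde) (z : ℂ) : ℝ := Real.log (firstForm f z 1 1) / 2

/-- The left translate `f⁻¹(N)` of the unit normal, with `e₁, e₂, e₃` positively oriented. -/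
def unitNormal (f : ℂ → SL2Tilde) (z : ℂ) : Fin 3 → ℝ :=
  let n := crossProduct (leftForm f z 1) (leftForm f z Complex.I)
  (Real.sqrt (n ⬝ᵥ n))⁻¹ • n

/-- The covariant derivative in the direction `v` of a vector field along `f`, given by its
components `X` in the left invariant frame. -/
def covDeriv (f : ℂ → SL2Tilde) (X : ℂ → Fin 3 → ℝ) (z v : ℂ) : Fin 3 → ℝ := fun k =>
  fderiv ℝ (fun w => X w k) z v + ∑ i, ∑ j, leftForm f z v i * X z j * leviCivita i j k

/-- The second fundamental form `⟨∇_v (df(w)), N⟩` on constant vectors `v, w`. -/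
def secondForm (f : ℂ → SL2Tilde) (z v w : ℂ) : ℝ :=
  covDeriv f (fun u => leftForm f u w) z v ⬝ᵥ unitNormal f z

/-- The mean curvature: half the trace of the second fundamental form with respect to the first. -/
def meanCurvature (f : ℂ → SL2Tilde) (z : ℂ) : ℝ :=
  (secondForm f z 1 1 * firstForm f z Complex.I Complex.I
      - 2 * secondForm f z 1 Complex.I * firstForm f z 1 Complex.I
      + secondForm f z Complex.I Complex.I * firstForm f z 1 1)
    / (2 * (firstForm f z 1 1 * firstForm f z Complex.I Complex.I
      - firstForm f z 1 Complex.I ^ 2))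

/-- The components `Z_k` of `Ψ = f⁻¹ ∂f` in the basis `e₁, e₂, e₃`. -/
def zComp (f : ℂ → SL2Tilde) (z : ℂ) (k : Fin 3) : ℂ :=
  ((leftForm f z 1 k : ℂ) - Complex.I * (leftForm f z Complex.I k : ℂ)) / 2

/-- The coefficient `A = ⟨∇_{f_z} f_z, N⟩` of the Hopf differential `A dz²`, where the metric and
the connection are extended complex bilinearly. -/
def hopf (f : ℂ → SL2Tilde) (z : ℂ) : ℂ :=
  ∑ k, (dz (fun w => zComp f w k) z
    + ∑ i, ∑ j, zComp f z i * zComp f z j * (leviCivita i j k : ℂ)) * (unitNormal f z k : ℂ)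

/-- `ψ = (ψ₁, ψ₂) = (ψ · 0, ψ · 1)` is a (smooth) generating spinor of the surface `f`. -/
def IsGeneratingSpinor (D : Set ℂ) (f : ℂ → SL2Tilde) (ψ : ℂ → Fin 2 → ℂ) : Prop :=
  ContDiffOn ℝ ∞ ψ D ∧ ∀ z ∈ D,
    zComp f z 0 = Complex.I / 2 * ((starRingEnd ℂ) (ψ z 1) ^ 2 + ψ z 0 ^ 2) ∧
    zComp f z 1 = 1 / 2 * ((starRingEnd ℂ) (ψ z 1) ^ 2 - ψ z 0 ^ 2) ∧
    zComp f z 2 = ψ z 0 * (starRingEnd ℂ) (ψ z 1)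

/-- The Dirac operator with potentials `U` and `V`. -/
def diracOp (U V : ℂ → ℂ) (ψ : ℂ → Fin 2 → ℂ) (z : ℂ) : Fin 2 → ℂ :=
  ![dz (fun w => ψ w 1) z + U z * ψ z 0, -dzbar (fun w => ψ w 0) z + V z * ψ z 1]

/-- `U = (H/2) (|ψ₁|² + |ψ₂|²) + i (|ψ₁|²/2 - 3|ψ₂|²/4)`. -/
def potentialU (H : ℂ → ℝ) (ψ : ℂ → Fin 2 → ℂ) (z : ℂ) : ℂ :=
  (H z : ℂ) / 2 * ((‖ψ z 0‖ : ℂ) ^ 2 + (‖ψ z 1‖ : ℂ) ^ 2)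
    + Complex.I * (1 / 2 * (‖ψ z 0‖ : ℂ) ^ 2 - 3 / 4 * (‖ψ z 1‖ : ℂ) ^ 2)

/-- `V = (H/2) (|ψ₁|² + |ψ₂|²) + i (3|ψ₁|²/4 - |ψ₂|²/2)`. -/
def potentialV (H : ℂ → ℝ) (ψ : ℂ → Fin 2 → ℂ) (z : ℂ) : ℂ :=
  (H z : ℂ) / 2 * ((‖ψ z 0‖ : ℂ) ^ 2 + (‖ψ z 1‖ : ℂ) ^ 2)
    + Complex.I * (3 / 4 * (‖ψ z 0‖ : ℂ) ^ 2 - 1 / 2 * (‖ψ z 1‖ : ℂ) ^ 2)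

/-- The Dirac equation for surfaces in the universal cover of `SL(2, ℝ)`, on `D`. -/
def DiracEquation (D : Set ℂ) (H : ℂ → ℝ) (ψ : ℂ → Fin 2 → ℂ) : Prop :=
  ∀ z ∈ D, diracOp (potentialU H ψ) (potentialV H ψ) ψ z = 0

/-- The second half of the Weingarten equations, with `a = α` and Hopf coefficient `A`. -/
def WeingartenEquations (D : Set ℂ) (a : ℂ → ℝ) (A : ℂ → ℂ) (ψ : ℂ → Fin 2 → ℂ) : Prop :=
  ∀ z ∈ D,
    dz (fun w => ψ w 0) z = dz (fun w => (a w : ℂ)) z * ψ z 0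
      + A z * (Real.exp (-a z) : ℂ) * ψ z 1
      + 5 * Complex.I / 4 * ψ z 0 ^ 2 * (starRingEnd ℂ) (ψ z 1) ∧
    dzbar (fun w => ψ w 1) z = -(starRingEnd ℂ) (A z) * (Real.exp (-a z) : ℂ) * ψ z 0
      + dzbar (fun w => (a w : ℂ)) z * ψ z 1
      + 5 * Complex.I / 4 * (starRingEnd ℂ) (ψ z 0) * ψ z 1 ^ 2

/-- The expression of the Hopf coefficient `A` through `ψ`. -/
def HopfFormula (D : Set ℂ) (A : ℂ → ℂ) (ψ : ℂ → Fin 2 → ℂ) : Prop :=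
  ∀ z ∈ D,
    A z = ((starRingEnd ℂ) (ψ z 1) * dz (fun w => ψ w 0) z
        - ψ z 0 * dz (fun w => (starRingEnd ℂ) (ψ w 1)) z)
      - 5 * Complex.I / 2 * ψ z 0 ^ 2 * (starRingEnd ℂ) (ψ z 1) ^ 2

/-- The Codazzi equations, with `a = α`, mean curvature `H`, Hopf coefficient `A`, and the third
component `Z = Z₃` of `f⁻¹ ∂f`. -/
def CodazziEquations (D : Set ℂ) (a H : ℂ → ℝ) (A Z : ℂ → ℂ) : Prop :=
  ∀ z ∈ D,
    dzbar (dz fun w => (a w : ℂ)) z - (Real.exp (-2 * a z) : ℂ) * (‖A z‖ : ℂ) ^ 2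
        + 1 / 4 * (Real.exp (2 * a z) : ℂ) * (H z : ℂ) ^ 2
      = (Real.exp (2 * a z) : ℂ) - 5 * (‖Z z‖ : ℂ) ^ 2 ∧
    dzbar (fun w => A w + 5 * Z w ^ 2 / (2 * ((H w : ℂ) - Complex.I))) z
      = 1 / 2 * dz (fun w => (H w : ℂ)) z * (Real.exp (2 * a z) : ℂ)
        + dzbar (fun w => 5 / (2 * ((H w : ℂ) - Complex.I))) z * Z z ^ 2

end
end SLSurface

open SLSurface

/-! On a simply connected domain a conformal immersion is, up to left translation, a flat real
`su(1,1)`-valued one form whose (1,0) part has a null and nowhere zero component vector Z. Nonzero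
vectors of ℂ² parametrize the nonzero null vectors of ℂ³ two to one: ψ₁² and ψ̄₂² are -iZ₁ - Z₂ and
-iZ₁ + Z₂, and nullity says that their product is Z₃². Locally ψ is thus a smooth square root. The
signs by which local choices differ form a locally constant cocycle, which is trivial over a simply
connected domain (`exists_coboundary_of_cocycle`, `exists_global_section`).

Written in ψ, flatness of f⁻¹df is one complex and one real linear equation for ∂̄ψ₁ and ∂ψ₂
(`spinor_flat`). The mean curvature supplies the missing real equation
(`meanCurvature_of_spinorRel`). The resulting 2 × 2 system has determinant |ψ₁|² + |ψ₂|² and its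
solution is the Dirac equation (`dirac_of_spinorRel`). The other two derivatives, ∂ψ₁ and ∂̄ψ₂,
solve a system with the same determinant up to sign, given by the derivative of e^α = |ψ₁|² + |ψ₂|²
and by the Hopf differential. Equality of the mixed second derivatives of ψ₁ and ψ₂ then gives the
Gauss and Codazzi equations; they separate because the Gauss expression is real
(`eq_zero_of_quaternionic`).

Conversely, the Dirac equation makes the form built from ψ flat. The Frobenius theorem
(`exists_hasFDerivAt_of_flat`) yields local maps with this logarithmic derivative. Two of them
differ by a locally constant left translation (`eventually_mul_inv_eq`), so the same gluing theorem,
now with the group itself as coefficients, gives a global map, and the initial value makes it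
unique. Its mean curvature is H because the Dirac equation determines H pointwise where ψ ≠ 0. -/

section

open Filter Topology

/-! ### Locally constant cocycles on simply connected spaces -/

/-- A locally constant Čech `1`-cocycle on a simply connected space is a coboundary. -/
theorem exists_coboundary_of_cocycle {X Γ ι : Type*} [TopologicalSpace X]
    [SimplyConnectedSpace X] [LocallyPathConnectedSpace X] [Group Γ] (U : ι → Set X)
    (hU : ∀ i, IsOpen (U i)) (hcov : ∀ x, ∃ i, x ∈ U i) (c : ι → ι → X → Γ)
    (hc : ∀ i j, ∀ x ∈ U i ∩ U j, ∀ᶠ y in 𝓝 x, c i j y = c i j x)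
    (hcomp : ∀ i j k x, x ∈ U i → x ∈ U j → x ∈ U k → c i j x * c j k x = c i k x) :
    ∃ h : ι → X → Γ, (∀ i, ∀ x ∈ U i, ∀ᶠ y in 𝓝 x, h i y = h i x) ∧
      ∀ i j x, x ∈ U i → x ∈ U j → h i x * c i j x = h j x := by
  -- With Γ discrete, locally constant means continuous, and a bundle with fibre Γ is a covering.
  -- The cocycle acts by multiplication on the right.
  let _ : TopologicalSpace Γ := ⊥
  have : DiscreteTopology Γ := ⟨rfl⟩
  choose ind hind using hcov
  let Z : FiberBundleCore ι X Γ :=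
    { baseSet := U
      isOpen_baseSet := hU
      indexAt := ind
      mem_baseSet_at := hind
      coordChange := fun i j x v => v * c i j x
      coordChange_self := fun i x hx v => by
        have := hcomp i i i x hx hx hx
        rw [mul_eq_left] at this
        rw [this, mul_one]
      continuousOn_coordChange := fun i j => by
        rintro ⟨x, v⟩ ⟨hx, -⟩
        refine ContinuousAt.continuousWithinAt (tendsto_nhds_of_eventually_eq ?_)
        rw [nhds_prod_eq]
        have hv : ∀ᶠ w in 𝓝 v, w = v := by rw [nhds_discrete]; simp
        filter_upwards [(hc i j x hx).prod_mk hv] with p hp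
        rw [hp.1, hp.2]
      coordChange_comp := fun i j k x hx v => by
        rw [mul_assoc, hcomp i j k x hx.1.1 hx.1.2 hx.2] }
  have cov : IsCoveringMap (Bundle.TotalSpace.proj : Z.TotalSpace → X) :=
    FiberBundle.isCoveringMap (F := Γ) (E := Z.Fiber)
  obtain ⟨x₀⟩ : Nonempty X := inferInstance
  -- A lift of the identity is a global section of the covering. Its coordinate in the i-th chart is
  -- the required `h i`; the starting value 1 is arbitrary.
  obtain ⟨F, ⟨-, hF⟩, -⟩ := cov.existsUnique_continuousMap_lifts (ContinuousMap.id X) x₀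
    (⟨x₀, (1 : Γ)⟩ : Z.TotalSpace) rfl
  have hF' : ∀ x, (F x).proj = x := fun x => congrFun hF x
  refine ⟨fun i x => (Z.localTriv i (F x)).2, fun i x hx => ?_, fun i j x hi hj => ?_⟩
  · have h1 : ContinuousAt (fun y => (Z.localTriv i (F y)).2) x := by
      refine ContinuousAt.comp (g := Prod.snd) continuous_snd.continuousAt ?_
      refine ContinuousAt.comp (g := Z.localTriv i) ?_ F.continuous.continuousAt
      apply (Z.localTriv i).continuousAt
      rw [Z.mem_localTriv_source, hF']
      exact hx
    have h2 := h1.tendsto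
    rw [nhds_discrete Γ, tendsto_pure] at h2
    exact h2
  · have hx : (F x).proj ∈ U (ind x) := by rw [hF']; exact hind x
    have e := hF' x
    simp only [FiberBundleCore.localTriv_apply]
    change _ * c (ind (F x).proj) i (F x).proj * c i j x = _ * c (ind (F x).proj) j (F x).proj
    have key : ∀ v : Γ, v * c (ind x) i x * c i j x = v * c (ind x) j x := fun v => by
      rw [mul_assoc, hcomp _ i j x (hind x) hi hj]
    rw [e]
    exact key _

end

/-! ### The Frobenius theorem by radial transport -/

section Pfaff
open Filter Topology Set
set_option maxSynthPendingDepth 3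
variable {V E : Type*} [NormedAddCommGroup V] [NormedSpace ℝ V] [NormedAddCommGroup E]
  [NormedSpace ℝ E]

/-- A linear equation with small coefficients is solvable on the unit interval. -/
lemma exists_linearODE_solution [CompleteSpace E] (A : ℝ → E →L[ℝ] E)
    (hA : ContinuousOn A (Icc 0 1)) (hb : ∀ t ∈ Icc (0 : ℝ) 1, ‖A t‖ ≤ 1 / 2) (y₀ : E) :
    ∃ m : ℝ → E, m 0 = y₀ ∧ ∀ t ∈ Icc (0 : ℝ) 1, HasDerivWithinAt m (A t (m t)) (Icc 0 1) t := by
  -- Points of the ball of radius ‖y₀‖ about y₀ have norm at most 2‖y₀‖, so the bound 1/2 on the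
  -- coefficients limits the speed to ‖y₀‖. A solution therefore stays in this ball throughout unit
  -- time.
  have hpl : IsPicardLindelof (fun t y => A t y) (tmin := 0) (tmax := 1)
      (⟨0, by simp⟩ : Icc (0 : ℝ) 1) y₀ ‖y₀‖₊ 0 ‖y₀‖₊ (1 / 2) := by
    refine ⟨fun t ht => ?_, fun x _ => hA.clm_apply continuousOn_const, fun t ht x hx => ?_, ?_⟩
    · exact ((A t).lipschitz.weaken (by exact_mod_cast hb t ht)).lipschitzOnWith
    · have h1 : ‖x‖ ≤ ‖y₀‖ + ‖y₀‖ := by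
        rw [mem_closedBall_iff_norm] at hx
        have := norm_sub_norm_le x y₀
        simp only [coe_nnnorm] at hx
        linarith
      calc ‖A t x‖ ≤ ‖A t‖ * ‖x‖ := (A t).le_opNorm x
        _ ≤ 1 / 2 * (‖y₀‖ + ‖y₀‖) := by gcongr; exact hb t ht
        _ = _ := by simp; ring
    · simp
  exact hpl.exists_eq_forall_mem_Icc_hasDerivWithinAt₀

/-- A second order Taylor estimate that needs only a Lipschitz derivative: on the segment from x to
y the derivative stays within K‖y - x‖ of its value at x, so the mean value inequality applies to f
minus its linear part. -/
lemma norm_sub_sub_fderiv_le {F G : Type*} [NormedAddCommGroup F] [NormedSpace ℝ F]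
    [NormedAddCommGroup G] [NormedSpace ℝ G] {f : F → G} {s : Set F} (hs : Convex ℝ s) {K : ℝ}
    (hd : ∀ x ∈ s, DifferentiableAt ℝ f x)
    (hl : ∀ x ∈ s, ∀ y ∈ s, ‖fderiv ℝ f x - fderiv ℝ f y‖ ≤ K * ‖x - y‖) (hK : 0 ≤ K)
    {x y : F} (hx : x ∈ s) (hy : y ∈ s) :
    ‖f y - f x - fderiv ℝ f x (y - x)‖ ≤ K * ‖y - x‖ ^ 2 := by
  have hseg := hs.segment_subset hx hy
  have := (convex_segment x y).norm_image_sub_le_of_norm_hasFDerivWithin_le' (f := f)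
    (f' := fderiv ℝ f) (φ := fderiv ℝ f x) (C := K * ‖y - x‖)
    (fun w hw => (hd w (hseg hw)).hasFDerivAt.hasFDerivWithinAt)
    (fun w hw => (hl w (hseg hw) x hx).trans (by
      gcongr
      have := norm_sub_le_of_mem_segment hw
      rw [norm_sub_rev] at this
      simpa [norm_sub_rev] using this))
    (left_mem_segment ℝ x y) (right_mem_segment ℝ x y)
  linarith [this, show K * ‖y - x‖ * ‖y - x‖ = K * ‖y - x‖ ^ 2 by ring]

variable {Ω : V → V →L[ℝ] E →L[ℝ] E}

/-- Pointwise form of the estimate that compares two neighbouring radial transports. -/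
lemma norm_transport_defect_le {K : ℝ} (hK : 0 ≤ K) {p q u h : V} {t c : ℝ} (ht : t ∈ Icc (0 : ℝ) 1)
    (hΩ : ‖Ω p‖ ≤ K) (hd : ‖fderiv ℝ Ω p‖ ≤ K) (hlip : ‖Ω q - Ω p‖ ≤ K * ‖t • h‖)
    (hT : ‖Ω q - Ω p - fderiv ℝ Ω p (t • h)‖ ≤ K * ‖t • h‖ ^ 2)
    (hflat : ∀ v w, fderiv ℝ Ω p v w + (Ω p w).comp (Ω p v)
      = fderiv ℝ Ω p w v + (Ω p v).comp (Ω p w))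
    (huh : ‖u + h‖ ≤ 1) {m : E} (hm : ‖m‖ ≤ c) :
    ‖(Ω p u m + ((fderiv ℝ Ω p u (t • h) + Ω p h) m + Ω p (t • h) (Ω p u m)))
      - Ω q (u + h) (m + Ω p (t • h) m)‖ ≤ (2 * K + 2 * K ^ 2) * c * ‖h‖ ^ 2 := by
  have hc : 0 ≤ c := (norm_nonneg m).trans hm
  have hth : ‖t • h‖ ≤ ‖h‖ := by
    rw [norm_smul, Real.norm_of_nonneg ht.1]
    exact mul_le_of_le_one_left (norm_nonneg h) ht.2
  -- Flatness for the pair u, t • h trades the derivative of Ω along the ray for its derivative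
  -- across the ray, with the order of the two factors exchanged. All zeroth and first order terms
  -- then cancel; each of the three that remain is quadratic in h.
  have e : (Ω p u m + ((fderiv ℝ Ω p u (t • h) + Ω p h) m + Ω p (t • h) (Ω p u m)))
      - Ω q (u + h) (m + Ω p (t • h) m)
      = -((Ω q - Ω p - fderiv ℝ Ω p (t • h)) (u + h) m + fderiv ℝ Ω p (t • h) h m
        + ((Ω q - Ω p) (u + h) + Ω p h) (Ω p (t • h) m)) := by
    have := congrArg (fun L : E →L[ℝ] E => L m) (hflat u (t • h))
    simp only [add_apply, ContinuousLinearMap.comp_apply] at this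
    simp only [add_apply, sub_apply, map_add]
    linear_combination (norm := module) this
  have b1 : ‖(Ω q - Ω p - fderiv ℝ Ω p (t • h)) (u + h) m‖ ≤ K * ‖h‖ ^ 2 * c := by
    refine (ContinuousLinearMap.le_opNorm₂ _ _ _).trans ?_
    calc _ ≤ (K * ‖t • h‖ ^ 2) * 1 * c := by gcongr
      _ ≤ (K * ‖h‖ ^ 2) * 1 * c := by gcongr
      _ = _ := by ring
  have b2 : ‖fderiv ℝ Ω p (t • h) h m‖ ≤ K * ‖h‖ ^ 2 * c := by
    refine (ContinuousLinearMap.le_opNorm₂ _ _ _).trans ?_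
    calc _ ≤ (K * ‖t • h‖) * ‖h‖ * c := by
            gcongr
            exact (ContinuousLinearMap.le_opNorm _ _).trans (by gcongr)
      _ ≤ (K * ‖h‖) * ‖h‖ * c := by gcongr
      _ = _ := by ring
  have b3 : ‖((Ω q - Ω p) (u + h) + Ω p h) (Ω p (t • h) m)‖ ≤ 2 * K ^ 2 * ‖h‖ ^ 2 * c := by
    refine (ContinuousLinearMap.le_opNorm _ _).trans ?_
    have e1 : ‖(Ω q - Ω p) (u + h) + Ω p h‖ ≤ 2 * K * ‖h‖ := by
      calc _ ≤ ‖(Ω q - Ω p) (u + h)‖ + ‖Ω p h‖ := norm_add_le _ _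
        _ ≤ (K * ‖h‖) * 1 + K * ‖h‖ := by
            gcongr
            · refine (ContinuousLinearMap.le_opNorm _ _).trans ?_
              gcongr
              exact hlip.trans (by gcongr)
            · exact (ContinuousLinearMap.le_opNorm _ _).trans (by gcongr)
        _ = _ := by ring
    have e2 : ‖Ω p (t • h) m‖ ≤ K * ‖h‖ * c :=
      (ContinuousLinearMap.le_opNorm₂ _ _ _).trans (by gcongr)
    calc _ ≤ (2 * K * ‖h‖) * (K * ‖h‖ * c) := by gcongr
      _ = _ := by ring
  rw [e, norm_neg]
  calc _ ≤ K * ‖h‖ ^ 2 * c + K * ‖h‖ ^ 2 * c + 2 * K ^ 2 * ‖h‖ ^ 2 * c :=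
        (norm_add_le _ _).trans (add_le_add ((norm_add_le _ _).trans (add_le_add b1 b2)) b3)
    _ = _ := by ring

/-- **Frobenius theorem** for linear Pfaffian systems `dy = Ω y` with flat `Ω`. -/
theorem exists_hasFDerivAt_of_flat [CompleteSpace E] {z₀ : V} (hΩ : ContDiffAt ℝ 2 Ω z₀)
    (hflat : ∀ᶠ z in 𝓝 z₀, ∀ v w, fderiv ℝ Ω z v w + (Ω z w).comp (Ω z v)
      = fderiv ℝ Ω z w v + (Ω z v).comp (Ω z w)) (y₀ : E) :
    ∃ y : V → E, y z₀ = y₀ ∧ ∀ᶠ z in 𝓝 z₀, HasFDerivAt y ((Ω z).flip (y z)) z := by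
  have hdΩ : ContDiffAt ℝ 1 (fderiv ℝ Ω) z₀ := hΩ.fderiv_right (by norm_num)
  obtain ⟨K₂, s₂, hs₂, hl₂⟩ := hdΩ.exists_lipschitzOnWith
  obtain ⟨K₁, s₁, hs₁, hl₁⟩ := (hΩ.of_le (by norm_num : (1 : WithTop ℕ∞) ≤ 2)).exists_lipschitzOnWith
  have hdiff : ∀ᶠ z in 𝓝 z₀, DifferentiableAt ℝ Ω z :=
    (hΩ.eventually (by simp)).mono fun z hz => hz.differentiableAt (by norm_num)
  have hbΩ : ∀ᶠ z in 𝓝 z₀, ‖Ω z‖ < ‖Ω z₀‖ + 1 :=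
    hΩ.continuousAt.norm.eventually_lt continuousAt_const (by simp)
  have hbd : ∀ᶠ z in 𝓝 z₀, ‖fderiv ℝ Ω z‖ < ‖fderiv ℝ Ω z₀‖ + 1 :=
    hdΩ.continuousAt.norm.eventually_lt continuousAt_const (by simp)
  obtain ⟨r, hr, hball⟩ := Metric.eventually_nhds_iff_ball.1
    (hflat.and (hdiff.and (hbΩ.and (hbd.and
      ((eventually_mem_set.2 hs₁).and (eventually_mem_set.2 hs₂))))))
  -- One constant bounds Ω, its derivative and both Lipschitz constants. With ρ ≤ 1/(2K), chosen
  -- below, the radial equations have coefficients of norm at most 1/2, and 1 ≤ K gives ρ ≤ 1/2, so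
  -- that ‖z + h - z₀‖ ≤ 1.
  obtain ⟨K, hK1, hKΩ, hKd, hKl, hKl'⟩ : ∃ K : ℝ, 1 ≤ K ∧ ‖Ω z₀‖ + 1 ≤ K ∧
      ‖fderiv ℝ Ω z₀‖ + 1 ≤ K ∧ (K₁ : ℝ) ≤ K ∧ (K₂ : ℝ) ≤ K :=
    ⟨1 + (‖Ω z₀‖ + 1) + (‖fderiv ℝ Ω z₀‖ + 1) + K₁ + K₂, by
      have := norm_nonneg (Ω z₀)
      have := norm_nonneg (fderiv ℝ Ω z₀)
      have := K₁.2
      have := K₂.2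
      refine ⟨?_, ?_, ?_, ?_, ?_⟩ <;> simp only [NNReal.val_eq_coe] at * <;> linarith⟩
  have hK0 : 0 ≤ K := by linarith
  set ρ := min r (1 / (2 * K)) with hρ
  have hρ0 : 0 < ρ := lt_min hr (by positivity)
  have hρr : Metric.ball z₀ ρ ⊆ Metric.ball z₀ r := Metric.ball_subset_ball (min_le_left _ _)
  have hKρ : K * ρ ≤ 1 / 2 := by
    calc K * ρ ≤ K * (1 / (2 * K)) := by gcongr; exact min_le_right _ _
      _ = 1 / 2 := by field_simp
  have hpath : ∀ z ∈ Metric.ball z₀ ρ, ∀ t ∈ Icc (0 : ℝ) 1,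
      z₀ + t • (z - z₀) ∈ Metric.ball z₀ ρ := by
    intro z hz t ht
    rw [mem_ball_iff_norm] at hz ⊢
    rw [add_sub_cancel_left, norm_smul, Real.norm_of_nonneg ht.1]
    exact (mul_le_of_le_one_left (norm_nonneg _) ht.2).trans_lt hz
  have hline : ∀ (z : V) (t : ℝ), HasDerivAt (fun t : ℝ => z₀ + t • (z - z₀)) (z - z₀) t := by
    intro z t
    simpa using ((hasDerivAt_id t).smul_const (z - z₀)).const_add z₀
  have hcA : ∀ z ∈ Metric.ball z₀ ρ,
      ContinuousOn (fun t : ℝ => Ω (z₀ + t • (z - z₀)) (z - z₀)) (Icc 0 1) := by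
    intro z hz t ht
    have h1 := (hball _ (hρr (hpath z hz t ht))).2.1.continuousAt
    exact ((ContinuousAt.comp (g := Ω) (f := fun t : ℝ => z₀ + t • (z - z₀)) h1
      (hline z t).continuousAt).clm_apply
      continuousAt_const).continuousWithinAt
  have hbA : ∀ p ∈ Metric.ball z₀ ρ, ∀ z ∈ Metric.ball z₀ ρ, ‖Ω p (z - z₀)‖ ≤ 1 / 2 := by
    intro p hp z hz
    have h1 := (hball _ (hρr hp)).2.2.1
    rw [mem_ball_iff_norm] at hz
    calc _ ≤ ‖Ω p‖ * ‖z - z₀‖ := ContinuousLinearMap.le_opNorm _ _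
      _ ≤ K * ρ := by gcongr; linarith
      _ ≤ _ := hKρ
  -- `m z` transports y₀ along the segment from z₀ to z. The solution is its endpoint, and flatness
  -- must show that it solves the equation in all directions, not only radially.
  have hex := fun z : V => fun hz : z ∈ Metric.ball z₀ ρ => exists_linearODE_solution _ (hcA z hz)
    (fun t ht => hbA _ (hpath z hz t ht) z hz) y₀
  choose! m hm0 hm using hex
  refine ⟨fun z => m z 1, ?_, ?_⟩
  -- The ray from z₀ to itself has velocity 0, so the transport along it is constant.
  · have hz := Metric.mem_ball_self (x := z₀) hρ0
    rw [← hm0 z₀ hz]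
    refine constant_of_has_deriv_right_zero
      (fun t ht => (hm z₀ hz t ht).continuousWithinAt) (fun t ht => ?_) 1 (by simp)
    have := hm z₀ hz t (Ico_subset_Icc_self ht)
    simp only [sub_self, map_zero, zero_apply] at this
    exact this.mono_of_mem_nhdsWithin (Icc_mem_nhdsGE_of_mem ht)
  refine Metric.eventually_nhds_iff_ball.2 ⟨ρ, hρ0, fun z hz => ?_⟩
  have hmc : ∀ z ∈ Metric.ball z₀ ρ, ContinuousOn (m z) (Icc 0 1) :=
    fun z hz t ht => (hm z hz t ht).continuousWithinAt
  obtain ⟨c, hc⟩ := isCompact_Icc.exists_bound_of_continuousOn (hmc z hz)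
  rw [hasFDerivAt_iff_isLittleO_nhds_zero]
  refine Asymptotics.IsBigO.trans_isLittleO (g := fun h : V => ‖h‖ ^ 2) ?_
    (Asymptotics.isLittleO_norm_pow_id one_lt_two)
  have hnear : ∀ᶠ h in 𝓝 (0 : V), z + h ∈ Metric.ball z₀ ρ := by
    have : ContinuousAt (fun h : V => z + h) 0 := by fun_prop
    exact this.eventually_mem (by simpa using Metric.isOpen_ball.mem_nhds hz)
  -- The Grönwall constant for unit time, Lipschitz constant 1/2 and the defect bounded in
  -- `norm_transport_defect_le`.
  refine Asymptotics.IsBigO.of_bound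
    ((2 * K + 2 * K ^ 2) * c / (1 / 2) * (Real.exp (1 / 2 * (1 - 0)) - 1)) ?_
  filter_upwards [hnear] with h hh
  have hgd : ∀ t ∈ Ico (0 : ℝ) 1, HasDerivWithinAt
      (fun t => m z t + Ω (z₀ + t • (z - z₀)) (t • h) (m z t))
      (Ω (z₀ + t • (z - z₀)) (z - z₀) (m z t)
        + ((fderiv ℝ Ω (z₀ + t • (z - z₀)) (z - z₀) (t • h) + Ω (z₀ + t • (z - z₀)) h) (m z t)
          + Ω (z₀ + t • (z - z₀)) (t • h) (Ω (z₀ + t • (z - z₀)) (z - z₀) (m z t)))) (Ici t) t := by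
    intro t ht
    have ht' := Ico_subset_Icc_self ht
    have h1 := (hm z hz t ht').mono_of_mem_nhdsWithin (Icc_mem_nhdsGE_of_mem ht)
    have h2 := ((hball _ (hρr (hpath z hz t ht'))).2.1.hasFDerivAt.comp_hasDerivAt t
      (hline z t)).hasDerivWithinAt (s := Ici t)
    have h3 : HasDerivWithinAt (fun t : ℝ => t • h) h (Ici t) t := by
      simpa using ((hasDerivAt_id t).smul_const h).hasDerivWithinAt
    exact h1.add ((h2.clm_apply h3).clm_apply h1)
  -- Along the neighbouring ray, `m (z + h)` is an exact trajectory and the first order prediction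
  -- `m z t + Ω (t • h) (m z t)` an approximate one, with defect O(‖h‖²) and the same initial value.
  -- At time 1 their distance is the remainder in the definition of the derivative.
  have key := dist_le_of_approx_trajectories_ODE_of_mem (a := 0) (b := 1) (K := 1 / 2)
    (v := fun t y => Ω (z₀ + t • (z + h - z₀)) (z + h - z₀) y) (s := fun _ => univ)
    (f := m (z + h)) (f' := fun t => Ω (z₀ + t • (z + h - z₀)) (z + h - z₀) (m (z + h) t))
    (g := fun t => m z t + Ω (z₀ + t • (z - z₀)) (t • h) (m z t)) (δ := 0) (εf := 0)
    (εg := (2 * K + 2 * K ^ 2) * c * ‖h‖ ^ 2)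
    (fun t ht => ((ContinuousLinearMap.lipschitz _).weaken (by
      exact_mod_cast hbA _ (hpath _ hh t (Ico_subset_Icc_self ht)) _ hh)).lipschitzOnWith)
    (hmc _ hh)
    (fun t ht => (hm _ hh t (Ico_subset_Icc_self ht)).mono_of_mem_nhdsWithin
      (Icc_mem_nhdsGE_of_mem ht))
    (fun t ht => by simp) (fun t ht => mem_univ _) ?_ hgd ?_ (fun t ht => mem_univ _)
    (by simp [hm0 z hz, hm0 _ hh]) 1 (by simp)
  · rw [gronwallBound_of_K_ne_0 (by norm_num)] at key
    simp only [one_smul, add_sub_cancel, dist_eq_norm, zero_mul, zero_add] at key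
    rw [norm_pow, norm_norm, ContinuousLinearMap.flip_apply, sub_sub]
    refine key.trans (le_of_eq ?_)
    push_cast
    ring
  · intro t ht
    have ht' := Icc_subset_Icc_right le_rfl ht
    refine ContinuousWithinAt.add (hmc z hz t ht) ?_
    have h1 := (hball _ (hρr (hpath z hz t ht))).2.1.continuousAt
    have h2 : ContinuousAt (fun t : ℝ => Ω (z₀ + t • (z - z₀))) t :=
      ContinuousAt.comp (g := Ω) h1 (hline z t).continuousAt
    have h3 : ContinuousAt (fun t : ℝ => t • h) t := by fun_prop
    exact (h2.clm_apply h3).continuousWithinAt.clm_apply (hmc z hz t ht)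
  · intro t ht
    have ht' := Ico_subset_Icc_self ht
    obtain ⟨f1, f2, f3, f4, f5, f6⟩ := hball _ (hρr (hpath z hz t ht'))
    obtain ⟨g1, g2, g3, g4, g5, g6⟩ := hball _ (hρr (hpath _ hh t ht'))
    have eq : z₀ + t • (z + h - z₀) = z₀ + t • (z - z₀) + t • h := by
      rw [add_assoc, ← smul_add]; congr 2; abel
    have eu : z + h - z₀ = (z - z₀) + h := by abel
    have hdd : z₀ + t • (z + h - z₀) - (z₀ + t • (z - z₀)) = t • h := by rw [eq]; abel
    rw [dist_eq_norm]
    have hL := hl₁.norm_sub_le g5 f5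
    rw [hdd] at hL
    have hT := norm_sub_sub_fderiv_le (f := Ω) (convex_ball z₀ r) (fun x hx => (hball x hx).2.1)
      (K := K) (fun x hx y hy => (hl₂.norm_sub_le (hball x hx).2.2.2.2.2
        (hball y hy).2.2.2.2.2).trans (by gcongr)) hK0
      (hρr (hpath z hz t ht')) (hρr (hpath _ hh t ht'))
    rw [hdd] at hT
    have huh : ‖(z - z₀) + h‖ ≤ 1 := by
      rw [← eu]
      rw [mem_ball_iff_norm] at hh
      have : ρ ≤ K * ρ := le_mul_of_one_le_left hρ0.le hK1
      linarith
    have := norm_transport_defect_le (Ω := Ω) (c := c) hK0 ht' (f3.le.trans hKΩ)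
      (f4.le.trans hKd)
      (hL.trans (by gcongr)) hT f1 huh (hc t ht')
    rw [eu] at this ⊢
    exact this

end Pfaff

/-! ### Calculus of Wirtinger derivatives -/

namespace SLSurface
open scoped Topology
open Filter
noncomputable section

/-- `h` is differentiable at `z`, with Wirtinger derivatives `∂h = p` and `∂̄h = q`. -/
def HasDz (h : ℂ → ℂ) (p q z : ℂ) : Prop :=
  DifferentiableAt ℝ h z ∧ dz h z = p ∧ dzbar h z = q

lemma fderiv_one_eq (h : ℂ → ℂ) (z : ℂ) : fderiv ℝ h z 1 = dz h z + dzbar h z := by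
  rw [dz, dzbar]; ring

lemma fderiv_I_eq (h : ℂ → ℂ) (z : ℂ) :
    fderiv ℝ h z Complex.I = Complex.I * (dz h z - dzbar h z) := by
  rw [dz, dzbar]; linear_combination fderiv ℝ h z Complex.I * Complex.I_sq

lemma _root_.DifferentiableAt.hasDz {h : ℂ → ℂ} {z : ℂ} (hd : DifferentiableAt ℝ h z) :
    HasDz h (dz h z) (dzbar h z) z := ⟨hd, rfl, rfl⟩

lemma hasDz_const (c z : ℂ) : HasDz (fun _ => c) 0 0 z := by
  refine ⟨differentiableAt_const c, ?_, ?_⟩ <;> simp [dz, dzbar]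

namespace HasDz
variable {h g : ℂ → ℂ} {p q p' q' z : ℂ}

lemma congr_of_eventuallyEq (hh : HasDz h p q z) (e : g =ᶠ[𝓝 z] h) : HasDz g p q z := by
  refine ⟨hh.1.congr_of_eventuallyEq e, ?_, ?_⟩
  · rw [← hh.2.1, dz, dz, e.fderiv_eq]
  · rw [← hh.2.2, dzbar, dzbar, e.fderiv_eq]

lemma unique (hh : HasDz h p q z) (hg : HasDz h p' q' z) : p = p' ∧ q = q' :=
  ⟨hh.2.1.symm.trans hg.2.1, hh.2.2.symm.trans hg.2.2⟩

lemma congr_val (hh : HasDz h p q z) (e1 : p = p') (e2 : q = q') : HasDz h p' q' z :=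
  e1 ▸ e2 ▸ hh

lemma add (hh : HasDz h p q z) (hg : HasDz g p' q' z) :
    HasDz (fun w => h w + g w) (p + p') (q + q') z := by
  obtain ⟨hd, rfl, rfl⟩ := hh
  obtain ⟨gd, rfl, rfl⟩ := hg
  refine ⟨hd.add gd, ?_, ?_⟩ <;> simp only [dz, dzbar, fderiv_fun_add hd gd] <;> simp <;> ring

lemma neg (hh : HasDz h p q z) : HasDz (fun w => -h w) (-p) (-q) z := by
  obtain ⟨hd, rfl, rfl⟩ := hh
  refine ⟨hd.neg, ?_, ?_⟩ <;> simp only [dz, dzbar, fderiv_fun_neg] <;> simp <;> ring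

lemma sub (hh : HasDz h p q z) (hg : HasDz g p' q' z) :
    HasDz (fun w => h w - g w) (p - p') (q - q') z := by
  simpa only [sub_eq_add_neg] using hh.add hg.neg

lemma mul (hh : HasDz h p q z) (hg : HasDz g p' q' z) :
    HasDz (fun w => h w * g w) (p * g z + h z * p') (q * g z + h z * q') z := by
  obtain ⟨hd, rfl, rfl⟩ := hh
  obtain ⟨gd, rfl, rfl⟩ := hg
  refine ⟨hd.mul gd, ?_, ?_⟩ <;> simp only [dz, dzbar, fderiv_fun_mul hd gd] <;> simp <;> ring

lemma const_mul (c : ℂ) (hh : HasDz h p q z) : HasDz (fun w => c * h w) (c * p) (c * q) z :=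
  ((hasDz_const c z).mul hh).congr_val (by ring) (by ring)

lemma pow_two (hh : HasDz h p q z) :
    HasDz (fun w => h w ^ 2) (2 * h z * p) (2 * h z * q) z := by
  have := (hh.mul hh).congr_val (p' := 2 * h z * p) (q' := 2 * h z * q) (by ring) (by ring)
  exact this.congr_of_eventuallyEq (.of_forall fun w => sq (h w))

lemma conj (hh : HasDz h p q z) :
    HasDz (fun w => (starRingEnd ℂ) (h w)) ((starRingEnd ℂ) q) ((starRingEnd ℂ) p) z := by
  obtain ⟨hd, rfl, rfl⟩ := hh
  have hf : HasFDerivAt (fun w => (starRingEnd ℂ) (h w))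
      ((Complex.conjCLE : ℂ →L[ℝ] ℂ).comp (fderiv ℝ h z)) z :=
    (Complex.conjCLE : ℂ →L[ℝ] ℂ).hasFDerivAt.comp z hd.hasFDerivAt
  refine ⟨hf.differentiableAt, ?_, ?_⟩ <;> simp only [dz, dzbar, hf.fderiv] <;> simp [sub_eq_add_neg, map_ofNat]

lemma inv (hh : HasDz h p q z) (h0 : h z ≠ 0) :
    HasDz (fun w => (h w)⁻¹) (-p / h z ^ 2) (-q / h z ^ 2) z := by
  obtain ⟨hd, rfl, rfl⟩ := hh
  have hi : HasFDerivAt (fun w => (h w)⁻¹) ((-(h z ^ 2)⁻¹) • fderiv ℝ h z) z := by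
    have := (hasDerivAt_inv h0).hasFDerivAt.restrictScalars ℝ |>.comp z hd.hasFDerivAt
    refine this.congr_fderiv ?_
    ext v; simp [mul_comm]
  refine ⟨hi.differentiableAt, ?_, ?_⟩ <;> simp only [dz, dzbar, hi.fderiv] <;> simp <;> ring

lemma cexp (hh : HasDz h p q z) :
    HasDz (fun w => Complex.exp (h w)) (Complex.exp (h z) * p) (Complex.exp (h z) * q) z := by
  obtain ⟨hd, rfl, rfl⟩ := hh
  have hi : HasFDerivAt (fun w => Complex.exp (h w)) (Complex.exp (h z) • fderiv ℝ h z) z := by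
    exact hd.hasFDerivAt.cexp
  refine ⟨hi.differentiableAt, ?_, ?_⟩ <;> simp only [dz, dzbar, hi.fderiv] <;> simp <;> ring

end HasDz

/-- A real valued function satisfies `∂̄h = conj (∂h)`. -/
lemma dzbar_ofReal {h : ℂ → ℝ} {z : ℂ} (hd : DifferentiableAt ℝ (fun w => (h w : ℂ)) z) :
    dzbar (fun w => (h w : ℂ)) z = (starRingEnd ℂ) (dz (fun w => (h w : ℂ)) z) := by
  have h1 := hd.hasDz.conj
  simp only [Complex.conj_ofReal] at h1
  exact h1.2.2

lemma _root_.ContDiffAt.fderiv_apply_infty {E F : Type*} [NormedAddCommGroup E] [NormedSpace ℝ E]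
    [NormedAddCommGroup F] [NormedSpace ℝ F] {h : E → F} {z : E} (hd : ContDiffAt ℝ ∞ h z)
    (v : E) : ContDiffAt ℝ ∞ (fun w => fderiv ℝ h w v) z :=
  (hd.fderiv_right (m := ∞) (by simp)).clm_apply contDiffAt_const

lemma _root_.ContDiffAt.dz {h : ℂ → ℂ} {z : ℂ} (hd : ContDiffAt ℝ ∞ h z) :
    ContDiffAt ℝ ∞ (dz h) z :=
  ((hd.fderiv_apply_infty 1).sub (contDiffAt_const.mul (hd.fderiv_apply_infty Complex.I))).div_const 2

lemma _root_.ContDiffAt.dzbar {h : ℂ → ℂ} {z : ℂ} (hd : ContDiffAt ℝ ∞ h z) :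
    ContDiffAt ℝ ∞ (dzbar h) z :=
  ((hd.fderiv_apply_infty 1).add (contDiffAt_const.mul (hd.fderiv_apply_infty Complex.I))).div_const 2

lemma _root_.ContDiffAt.differentiableAt_infty {E F : Type*} [NormedAddCommGroup E]
    [NormedSpace ℝ E] [NormedAddCommGroup F] [NormedSpace ℝ F] {h : E → F} {z : E}
    (hd : ContDiffAt ℝ ∞ h z) : DifferentiableAt ℝ h z :=
  hd.differentiableAt (by simp)

/-- Symmetry of the second real derivative. Every integrability condition below is an instance of
it: the structure equations for the matrix entries of f, and the Gauss and Codazzi equations for ψ.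
-/
lemma dzbar_dz {h : ℂ → ℂ} {z : ℂ} (hd : ContDiffAt ℝ ∞ h z) :
    dzbar (dz h) z = dz (dzbar h) z := by
  have hs : IsSymmSndFDerivAt ℝ h z := hd.isSymmSndFDerivAt
    (by rw [minSmoothness_of_isRCLikeNormedField]; exact WithTop.coe_le_coe.2 (le_top (a := (2 : ℕ∞))))
  have hf : DifferentiableAt ℝ (fderiv ℝ h) z :=
    (hd.fderiv_right (m := ∞) (by simp)).differentiableAt_infty
  have hv : ∀ v u, fderiv ℝ (fun w => fderiv ℝ h w v) z u = fderiv ℝ (fderiv ℝ h) z u v := by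
    intro v u
    rw [fderiv_clm_apply hf (differentiableAt_const v)]
    simp
  have dv : ∀ v, DifferentiableAt ℝ (fun w => fderiv ℝ h w v) z := fun v =>
    (hd.fderiv_apply_infty v).differentiableAt_infty
  have e1 : fderiv ℝ (dz h) z = (2 : ℂ)⁻¹ • (fderiv ℝ (fun w => fderiv ℝ h w 1) z
      - Complex.I • fderiv ℝ (fun w => fderiv ℝ h w Complex.I) z) := by
    have := (((dv 1).hasFDerivAt.sub ((dv Complex.I).hasFDerivAt.const_mul Complex.I)).mul_const
      (2 : ℂ)⁻¹)
    exact (this.congr_of_eventuallyEq (.of_forall fun w => by simp [dz, div_eq_mul_inv])).fderiv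
  have e2 : fderiv ℝ (dzbar h) z = (2 : ℂ)⁻¹ • (fderiv ℝ (fun w => fderiv ℝ h w 1) z
      + Complex.I • fderiv ℝ (fun w => fderiv ℝ h w Complex.I) z) := by
    have := (((dv 1).hasFDerivAt.add ((dv Complex.I).hasFDerivAt.const_mul Complex.I)).mul_const
      (2 : ℂ)⁻¹)
    exact (this.congr_of_eventuallyEq (.of_forall fun w => by simp [dzbar, div_eq_mul_inv])).fderiv
  rw [dzbar, dz, e1, e2]
  simp [hv]
  have := hs 1 Complex.I
  rw [this]
  ring

/-! ### The logarithmic derivative of a map to the group -/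

/-- Smoothness at a point of a map to `SL2Tilde`, in the global coordinates. -/
def SmoothAt (f : ℂ → SL2Tilde) (z : ℂ) : Prop :=
  ContDiffAt ℝ ∞ (fun w => (f w).entryB) z ∧ ContDiffAt ℝ ∞ (fun w => (f w).angle) z

lemma contMDiffOn_iff_smoothAt {D : Set ℂ} (hD : IsOpen D) {f : ℂ → SL2Tilde} :
    ContMDiffOn 𝓘(ℝ, ℂ) 𝓘(ℝ, ℂ × ℝ) ∞ f D ↔ ∀ z ∈ D, SmoothAt f z := by
  have h1 : ContMDiffOn 𝓘(ℝ, ℂ) 𝓘(ℝ, ℂ × ℝ) ∞ f D ↔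
      ContDiffOn ℝ ∞ (fun w => (((f w).entryB, (f w).angle) : ℂ × ℝ)) D :=
    contMDiffOn_iff_contDiffOn (f := fun w => (((f w).entryB, (f w).angle) : ℂ × ℝ))
  rw [h1]
  constructor
  · intro h z hz
    have h2 := h.contDiffAt (hD.mem_nhds hz)
    exact ⟨contDiff_fst.contDiffAt.comp z h2, contDiff_snd.contDiffAt.comp z h2⟩
  · exact fun h z hz => ((h z hz).1.prodMk (h z hz).2).contDiffWithinAt

lemma SmoothAt.entryB {f : ℂ → SL2Tilde} {z : ℂ} (h : SmoothAt f z) :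
    ContDiffAt ℝ ∞ (fun w => (f w).entryB) z := h.1

lemma SmoothAt.entryA {f : ℂ → SL2Tilde} {z : ℂ} (h : SmoothAt f z) :
    ContDiffAt ℝ ∞ (fun w => (f w).entryA) z :=
  SL2Tilde.contDiff_entryA.contDiffAt.comp z (h.1.prodMk h.2)

lemma mul_conj_entryA (p : SL2Tilde) : p.entryA * (starRingEnd ℂ) p.entryA
    - p.entryB * (starRingEnd ℂ) p.entryB = 1 := by
  have h := congrArg (fun x : ℝ => (x : ℂ)) (SL2Tilde.normSq_entryA p)
  push_cast at h
  rw [Complex.mul_conj, Complex.mul_conj]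
  linear_combination h

lemma fderiv_conj {h : ℂ → ℂ} {z : ℂ} (hd : DifferentiableAt ℝ h z) (v : ℂ) :
    fderiv ℝ (fun w => (starRingEnd ℂ) (h w)) z v = (starRingEnd ℂ) (fderiv ℝ h z v) := by
  have hf : HasFDerivAt (fun w => (starRingEnd ℂ) (h w))
      ((Complex.conjCLE : ℂ →L[ℝ] ℂ).comp (fderiv ℝ h z)) z :=
    (Complex.conjCLE : ℂ →L[ℝ] ℂ).hasFDerivAt.comp z hd.hasFDerivAt
  rw [hf.fderiv]
  simp

lemma leftForm_eq {f : ℂ → SL2Tilde} {z : ℂ} (hA : DifferentiableAt ℝ (fun w => (f w).entryA) z)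
    (v : ℂ) : leftForm f z v =
      ![2 * ((starRingEnd ℂ) (f z).entryA * fderiv ℝ (fun w => (f w).entryB) z v
          - (f z).entryB * (starRingEnd ℂ) (fderiv ℝ (fun w => (f w).entryA) z v)).re,
        2 * ((starRingEnd ℂ) (f z).entryA * fderiv ℝ (fun w => (f w).entryB) z v
          - (f z).entryB * (starRingEnd ℂ) (fderiv ℝ (fun w => (f w).entryA) z v)).im,
        4 * ((starRingEnd ℂ) (f z).entryA * fderiv ℝ (fun w => (f w).entryA) z v
          - (f z).entryB * fderiv ℝ (fun w => (starRingEnd ℂ) (f w).entryB) z v).im] := by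
  rw [← fderiv_conj hA]
  simp only [leftForm, lieCoord, SL2Tilde.toMatrix, Matrix.mul_apply, Fin.sum_univ_two]
  simp only [MonoidHom.coe_mk, OneHom.coe_mk, SL2Tilde.inv_entryA, SL2Tilde.inv_entryB]
  simp [sub_eq_add_neg]

lemma leftForm_one (f : ℂ → SL2Tilde) (z : ℂ) (k : Fin 3) :
    leftForm f z 1 k = 2 * (zComp f z k).re := by
  simp [zComp]; ring

lemma leftForm_I (f : ℂ → SL2Tilde) (z : ℂ) (k : Fin 3) :
    leftForm f z Complex.I k = -2 * (zComp f z k).im := by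
  simp [zComp]; ring

/-- The components of `f⁻¹ ∂f` through the Wirtinger derivatives of the matrix entries. -/
lemma zComp_eq {f : ℂ → SL2Tilde} {z a₁ a₂ b₁ b₂ : ℂ}
    (hA : HasDz (fun w => (f w).entryA) a₁ a₂ z) (hB : HasDz (fun w => (f w).entryB) b₁ b₂ z) :
    zComp f z 0 = ((starRingEnd ℂ) (f z).entryA * b₁ - (f z).entryB * (starRingEnd ℂ) a₂)
        + (starRingEnd ℂ) ((starRingEnd ℂ) (f z).entryA * b₂ - (f z).entryB * (starRingEnd ℂ) a₁) ∧
    zComp f z 1 = -Complex.I *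
        (((starRingEnd ℂ) (f z).entryA * b₁ - (f z).entryB * (starRingEnd ℂ) a₂)
        - (starRingEnd ℂ) ((starRingEnd ℂ) (f z).entryA * b₂
          - (f z).entryB * (starRingEnd ℂ) a₁)) ∧
    zComp f z 2 = -2 * Complex.I *
        (((starRingEnd ℂ) (f z).entryA * a₁ - (f z).entryB * (starRingEnd ℂ) b₂)
        - (starRingEnd ℂ) ((starRingEnd ℂ) (f z).entryA * a₂
          - (f z).entryB * (starRingEnd ℂ) b₁)) := by
  simp only [zComp, leftForm_eq hA.1, fderiv_conj hB.1, fderiv_one_eq, fderiv_I_eq, hA.2.1, hA.2.2,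
    hB.2.1, hB.2.2]
  refine ⟨?_, ?_, ?_⟩ <;> apply Complex.ext <;> simp <;> ring

/-- `df = f · Ψ`, on the first row of the matrix, for the form `Ψ` with components `Z`. -/
def RowEquation (f : ℂ → SL2Tilde) (Z : Fin 3 → ℂ) (z : ℂ) : Prop :=
  HasDz (fun w => (f w).entryA)
    (Complex.I / 4 * (f z).entryA * Z 2 + (f z).entryB * (Z 0 - Complex.I * Z 1) / 2)
    (Complex.I / 4 * (f z).entryA * (starRingEnd ℂ) (Z 2)
      + (f z).entryB * (starRingEnd ℂ) (Z 0 + Complex.I * Z 1) / 2) z ∧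
  HasDz (fun w => (f w).entryB)
    ((f z).entryA * (Z 0 + Complex.I * Z 1) / 2 - Complex.I / 4 * (f z).entryB * Z 2)
    ((f z).entryA * (starRingEnd ℂ) (Z 0 - Complex.I * Z 1) / 2
      - Complex.I / 4 * (f z).entryB * (starRingEnd ℂ) (Z 2)) z

/-- The second row of a matrix in SU(1,1) consists of the conjugates of the first, so the equation
for the first row already determines the whole form f⁻¹df. -/
lemma RowEquation.zComp_eq {f : ℂ → SL2Tilde} {Z : Fin 3 → ℂ} {z : ℂ} (h : RowEquation f Z z) :
    zComp f z = Z := by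
  obtain ⟨e0, e1, e2⟩ := SLSurface.zComp_eq h.1 h.2
  have h1 := mul_conj_entryA (f z)
  have hI := Complex.I_sq
  simp only [map_add, map_sub, map_mul, map_neg, neg_neg, Complex.conj_conj, Complex.conj_I,
    map_div₀, map_ofNat] at e0 e1 e2
  funext k
  fin_cases k
  · simp only [Fin.zero_eta, e0]
    linear_combination (Z 0) * h1
  · simp only [Fin.mk_one, e1]
    linear_combination (Z 1) * h1 - ((f z).entryA * (starRingEnd ℂ) (f z).entryA
      - (f z).entryB * (starRingEnd ℂ) (f z).entryB) * (Z 1) * hI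
  · simp only [Fin.reduceFinMk, e2]
    linear_combination (Z 2) * h1 - ((f z).entryA * (starRingEnd ℂ) (f z).entryA
      - (f z).entryB * (starRingEnd ℂ) (f z).entryB) * (Z 2) * hI

lemma rowEquation {f : ℂ → SL2Tilde} {z : ℂ} (hA : DifferentiableAt ℝ (fun w => (f w).entryA) z)
    (hB : DifferentiableAt ℝ (fun w => (f w).entryB) z) : RowEquation f (zComp f z) z := by
  have hA := hA.hasDz
  have hB := hB.hasDz
  obtain ⟨e0, e1, e2⟩ := SLSurface.zComp_eq hA hB
  have h1 := mul_conj_entryA (f z)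
  have hc : (fun w => (f w).entryA * (starRingEnd ℂ) (f w).entryA
    - (f w).entryB * (starRingEnd ℂ) (f w).entryB) = fun _ => 1 :=
    funext fun w => mul_conj_entryA (f w)
  have h2 := (hA.mul hA.conj).sub (hB.mul hB.conj)
  rw [hc] at h2
  -- Z₃ is built from the imaginary part of the diagonal entry of f⁻¹df only. The derivative of |a|²
  -- - |b|² = 1 shows that the real part is zero, which is needed to recover the entry from Z₃.
  obtain ⟨c1, c2⟩ := h2.unique (hasDz_const 1 z)
  set a₁ := dz (fun w => (f w).entryA) z
  set a₂ := dzbar (fun w => (f w).entryA) z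
  set b₁ := dz (fun w => (f w).entryB) z
  set b₂ := dzbar (fun w => (f w).entryB) z
  set A := (f z).entryA
  set B := (f z).entryB
  have hI := Complex.I_sq
  have f0 : (zComp f z 0 + Complex.I * zComp f z 1) / 2
      = (starRingEnd ℂ) A * b₁ - B * (starRingEnd ℂ) a₂ := by
    rw [e0, e1]
    simp only [map_sub, map_mul, Complex.conj_conj]
    ring_nf; rw [hI]; ring
  have f1 : (zComp f z 0 - Complex.I * zComp f z 1) / 2
      = A * (starRingEnd ℂ) b₂ - (starRingEnd ℂ) B * a₁ := by
    rw [e0, e1]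
    simp only [map_sub, map_mul, Complex.conj_conj]
    ring_nf; rw [hI]; ring
  have f2 : Complex.I / 4 * zComp f z 2 = (starRingEnd ℂ) A * a₁ - B * (starRingEnd ℂ) b₂ := by
    rw [e2]
    simp only [map_sub, map_mul, Complex.conj_conj]
    linear_combination (-(1 / 2) * (((starRingEnd ℂ) A * a₁ - B * (starRingEnd ℂ) b₂)
        - (A * (starRingEnd ℂ) a₂ - (starRingEnd ℂ) B * b₁))) * hI - 1 / 2 * c1
  have g0 := congrArg (starRingEnd ℂ) f0
  have g1 := congrArg (starRingEnd ℂ) f1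
  have g2 := congrArg (starRingEnd ℂ) f2
  simp only [map_sub, map_add, map_mul, map_div₀, Complex.conj_conj, Complex.conj_I, map_ofNat]
    at g0 g1 g2
  refine ⟨hA.congr_val ?_ ?_, hB.congr_val ?_ ?_⟩
  · linear_combination (-A) * f2 - B * f1 - a₁ * h1
  · simp only [map_add, map_mul, Complex.conj_I]
    linear_combination A * g2 - B * g0 - a₂ * h1 + A * c2
  · linear_combination B * f2 - A * f0 - b₁ * h1 + B * c1
  · simp only [map_sub, map_mul, Complex.conj_I]
    linear_combination (-B) * g2 - A * g1 - b₂ * h1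

lemma SmoothAt.rowEquation {f : ℂ → SL2Tilde} {z : ℂ} (h : SmoothAt f z) :
    RowEquation f (zComp f z) z :=
  SLSurface.rowEquation h.entryA.differentiableAt_infty h.entryB.differentiableAt_infty

lemma SmoothAt.eventually {f : ℂ → SL2Tilde} {z : ℂ} (h : SmoothAt f z) :
    ∀ᶠ w in 𝓝 z, ContDiffAt ℝ 1 (fun w => (f w).entryA) w ∧
      ContDiffAt ℝ 1 (fun w => (f w).entryB) w :=
  ((h.entryA.of_le (by simp)).eventually (by simp)).and
    ((h.entryB.of_le (by simp)).eventually (by simp))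

lemma contDiffAt_conj {h : ℂ → ℂ} {z : ℂ} (hd : ContDiffAt ℝ ∞ h z) :
    ContDiffAt ℝ ∞ (fun w => (starRingEnd ℂ) (h w)) z :=
  SL2Tilde.contDiff_conj.contDiffAt.comp z hd

lemma contDiffAt_ofReal {h : ℂ → ℝ} {z : ℂ} (hd : ContDiffAt ℝ ∞ h z) :
    ContDiffAt ℝ ∞ (fun w => (h w : ℂ)) z :=
  Complex.ofRealCLM.contDiff.contDiffAt.comp z hd

lemma contDiffAt_re {h : ℂ → ℂ} {z : ℂ} (hd : ContDiffAt ℝ ∞ h z) :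
    ContDiffAt ℝ ∞ (fun w => (h w).re) z :=
  Complex.reCLM.contDiff.contDiffAt.comp z hd

lemma contDiffAt_im {h : ℂ → ℂ} {z : ℂ} (hd : ContDiffAt ℝ ∞ h z) :
    ContDiffAt ℝ ∞ (fun w => (h w).im) z :=
  Complex.imCLM.contDiff.contDiffAt.comp z hd

lemma SmoothAt.contDiffAt_leftForm {f : ℂ → SL2Tilde} {z : ℂ} (h : SmoothAt f z) (v : ℂ) (k : Fin 3) :
    ContDiffAt ℝ ∞ (fun w => leftForm f w v k) z := by
  have hA := h.entryA
  have hB := h.entryB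
  have cA := contDiffAt_conj hA
  have dA := hA.fderiv_apply_infty v
  have dB := hB.fderiv_apply_infty v
  have cdA := contDiffAt_conj dA
  have cdB := (contDiffAt_conj hB).fderiv_apply_infty v
  have e1 := (cA.mul dB).sub (hB.mul cdA)
  have e2 := (cA.mul dA).sub (hB.mul cdB)
  have hev : ∀ᶠ w in 𝓝 z, _ = _ := h.eventually.mono fun w hw =>
    leftForm_eq (hw.1.differentiableAt (by simp)) v
  fin_cases k
  · exact (contDiffAt_const.mul (contDiffAt_re e1)).congr_of_eventuallyEq
      (hev.mono fun w hw => congrFun hw 0)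
  · exact (contDiffAt_const.mul (contDiffAt_im e1)).congr_of_eventuallyEq
      (hev.mono fun w hw => congrFun hw 1)
  · exact (contDiffAt_const.mul (contDiffAt_im e2)).congr_of_eventuallyEq
      (hev.mono fun w hw => congrFun hw 2)

lemma SmoothAt.contDiffAt_zComp {f : ℂ → SL2Tilde} {z : ℂ} (h : SmoothAt f z) (k : Fin 3) :
    ContDiffAt ℝ ∞ (fun w => zComp f w k) z :=
  ((contDiffAt_ofReal (h.contDiffAt_leftForm 1 k)).sub
    (contDiffAt_const.mul (contDiffAt_ofReal (h.contDiffAt_leftForm Complex.I k)))).div_const 2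

/-- The structure equations of `f⁻¹ df`. -/
lemma SmoothAt.flat {f : ℂ → SL2Tilde} {z t₁ t₂ u₁ u₂ m₁ m₂ : ℂ} (h : SmoothAt f z)
    (hT : HasDz (fun w => zComp f w 2) t₁ t₂ z)
    (hP : HasDz (fun w => zComp f w 0 + Complex.I * zComp f w 1) u₁ u₂ z)
    (hM : HasDz (fun w => zComp f w 0 - Complex.I * zComp f w 1) m₁ m₂ z) :
    Complex.I * (t₂ - (starRingEnd ℂ) t₂)
      = (zComp f z 0 + Complex.I * zComp f z 1)
          * (starRingEnd ℂ) (zComp f z 0 + Complex.I * zComp f z 1)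
        - (zComp f z 0 - Complex.I * zComp f z 1)
          * (starRingEnd ℂ) (zComp f z 0 - Complex.I * zComp f z 1) ∧
    2 * (m₂ - (starRingEnd ℂ) u₂)
      + Complex.I * ((starRingEnd ℂ) (zComp f z 0 + Complex.I * zComp f z 1) * zComp f z 2
        - (zComp f z 0 - Complex.I * zComp f z 1) * (starRingEnd ℂ) (zComp f z 2)) = 0 := by
  have hrow : ∀ᶠ w in 𝓝 z, RowEquation f (zComp f w) w := h.eventually.mono fun w hw =>
    SLSurface.rowEquation (hw.1.differentiableAt (by simp)) (hw.2.differentiableAt (by simp))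
  obtain ⟨hA, hB⟩ := h.rowEquation
  set P := fun w => zComp f w 0 + Complex.I * zComp f w 1 with hPd
  set M := fun w => zComp f w 0 - Complex.I * zComp f w 1 with hMd
  set T := fun w => zComp f w 2 with hTd
  have eA : dz (fun w => (f w).entryA) =ᶠ[𝓝 z]
      fun w => Complex.I / 4 * ((f w).entryA * T w) + 1 / 2 * ((f w).entryB * M w) :=
    hrow.mono fun w hw => by rw [hw.1.2.1]; ring
  have eA' : dzbar (fun w => (f w).entryA) =ᶠ[𝓝 z]
      fun w => Complex.I / 4 * ((f w).entryA * (starRingEnd ℂ) (T w))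
        + 1 / 2 * ((f w).entryB * (starRingEnd ℂ) (P w)) :=
    hrow.mono fun w hw => by rw [hw.1.2.2]; ring
  have eB : dz (fun w => (f w).entryB) =ᶠ[𝓝 z]
      fun w => 1 / 2 * ((f w).entryA * P w) - Complex.I / 4 * ((f w).entryB * T w) :=
    hrow.mono fun w hw => by rw [hw.2.2.1]; ring
  have eB' : dzbar (fun w => (f w).entryB) =ᶠ[𝓝 z]
      fun w => 1 / 2 * ((f w).entryA * (starRingEnd ℂ) (M w))
        - Complex.I / 4 * ((f w).entryB * (starRingEnd ℂ) (T w)) :=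
    hrow.mono fun w hw => by rw [hw.2.2.2]; ring
  have dA := ((((hA.mul hT).const_mul (Complex.I / 4)).add
    ((hB.mul hM).const_mul (1 / 2))).congr_of_eventuallyEq eA).2.2
  have dA' := ((((hA.mul hT.conj).const_mul (Complex.I / 4)).add
    ((hB.mul hP.conj).const_mul (1 / 2))).congr_of_eventuallyEq eA').2.1
  have dB := ((((hA.mul hP).const_mul (1 / 2)).sub
    ((hB.mul hT).const_mul (Complex.I / 4))).congr_of_eventuallyEq eB).2.2
  have dB' := ((((hA.mul hM.conj).const_mul (1 / 2)).sub
    ((hB.mul hT.conj).const_mul (Complex.I / 4))).congr_of_eventuallyEq eB').2.1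
  -- Mixed second derivatives of the two entries commute; both sides are computed from df = f · Ψ.
  have EA := dA.symm.trans ((dzbar_dz h.entryA).trans dA')
  have EB := dB.symm.trans ((dzbar_dz h.entryB).trans dB')
  have h1 := mul_conj_entryA (f z)
  clear dA dA' dB dB' eA eA' eB eB' hrow hA hB hT hP hM
  have eP : zComp f z 0 + Complex.I * zComp f z 1 = P z := rfl
  have eM : zComp f z 0 - Complex.I * zComp f z 1 = M z := rfl
  have eT : zComp f z 2 = T z := rfl
  simp only [eP, eM, eT] at EA EB ⊢
  generalize P z = P at *
  generalize M z = M at *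
  generalize T z = T at *
  generalize (f z).entryA = A at *
  generalize (f z).entryB = B at *
  have cEB := congrArg (starRingEnd ℂ) EB
  simp only [map_add, map_sub, map_mul, map_div₀, map_one, map_ofNat, Complex.conj_conj,
    Complex.conj_I] at cEB
  constructor
  -- The relations for A and for conj B form a column f · (curvature of Ψ), up to the sign that
  -- conjugation causes by exchanging ∂ and ∂̄. Multiplication by the two rows of f⁻¹ strips off f
  -- and leaves a diagonal and an off-diagonal entry of the curvature.
  · linear_combination 4 * (starRingEnd ℂ) A * EA + 4 * B * cEB
      - (Complex.I * (t₂ - (starRingEnd ℂ) t₂) + M * (starRingEnd ℂ) M - P * (starRingEnd ℂ) P) * h1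
  · linear_combination (-4 * (starRingEnd ℂ) B) * EA - 4 * A * cEB
      - (2 * (m₂ - (starRingEnd ℂ) u₂) + Complex.I * ((starRingEnd ℂ) P * T
        - M * (starRingEnd ℂ) T)) * h1

/-! ### Normal, curvature and Hopf differential in terms of a spinor -/

/-- The symmetrized products are ∇_{e₁}e₃ + ∇_{e₃}e₁ = (5/2) e₂, ∇_{e₂}e₃ + ∇_{e₃}e₂ = -(5/2) e₁,
and zero for e₁, e₂. The constant 5/2 = 3/2 + 1 of the Hopf formula comes from here. -/
lemma leviCivita_eq : leviCivita = fun i j k =>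
    (![![![0, 0, 0], ![0, 0, -1], ![0, 1, 0]], ![![0, 0, 1], ![0, 0, 0], ![-1, 0, 0]],
      ![![0, 3 / 2, 0], ![-3 / 2, 0, 0], ![0, 0, 0]]] : Fin 3 → Fin 3 → Fin 3 → ℝ) i j k := by
  funext i j k
  fin_cases i <;> fin_cases j <;> fin_cases k <;>
    simp [leviCivita, structConst, lieBracket, lieCoord, lieBasis] <;> norm_num

/-- The pointwise relation between a generating spinor `(a, b)` and the components `Z`. -/
def SpinorRel (Z : Fin 3 → ℂ) (a b : ℂ) : Prop :=
  Z 0 = Complex.I / 2 * ((starRingEnd ℂ) b ^ 2 + a ^ 2) ∧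
    Z 1 = 1 / 2 * ((starRingEnd ℂ) b ^ 2 - a ^ 2) ∧ Z 2 = a * (starRingEnd ℂ) b

/-- The vector Z of a spinor satisfies Σ Z_k² = 0, whose real and imaginary parts are conformality,
and 2 Σ |Z_k|² = (|a|² + |b|²)², which is the conformal factor. -/
lemma firstForm_of_spinorRel {f : ℂ → SL2Tilde} {z a b : ℂ} (h : SpinorRel (zComp f z) a b) :
    firstForm f z 1 1 = (‖a‖ ^ 2 + ‖b‖ ^ 2) ^ 2 ∧
    firstForm f z Complex.I Complex.I = (‖a‖ ^ 2 + ‖b‖ ^ 2) ^ 2 ∧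
    firstForm f z 1 Complex.I = 0 := by
  obtain ⟨h0, h1, h2⟩ := h
  simp only [firstForm, dotProduct, Fin.sum_univ_three, leftForm_one, leftForm_I, h0, h1, h2,
    ← Complex.normSq_eq_norm_sq, Complex.normSq_apply]
  refine ⟨?_, ?_, ?_⟩ <;> simp [pow_two] <;> ring

lemma crossProduct_of_spinorRel {f : ℂ → SL2Tilde} {z a b : ℂ} (h : SpinorRel (zComp f z) a b) :
    crossProduct (leftForm f z 1) (leftForm f z Complex.I) = (‖a‖ ^ 2 + ‖b‖ ^ 2) •
      ![-2 * (a * b).im, -2 * (a * b).re, ‖b‖ ^ 2 - ‖a‖ ^ 2] := by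
  obtain ⟨h0, h1, h2⟩ := h
  rw [cross_apply]
  simp only [leftForm_one, leftForm_I, h0, h1, h2,
    ← Complex.normSq_eq_norm_sq, Complex.normSq_apply]
  ext k
  fin_cases k <;> simp [pow_two] <;> ring

lemma unitNormal_of_spinorRel {f : ℂ → SL2Tilde} {z a b : ℂ} (h : SpinorRel (zComp f z) a b) :
    unitNormal f z = (‖a‖ ^ 2 + ‖b‖ ^ 2)⁻¹ •
      ![-2 * (a * b).im, -2 * (a * b).re, ‖b‖ ^ 2 - ‖a‖ ^ 2] := by
  rw [unitNormal, crossProduct_of_spinorRel h]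
  have e : ((‖a‖ ^ 2 + ‖b‖ ^ 2) • ![-2 * (a * b).im, -2 * (a * b).re, ‖b‖ ^ 2 - ‖a‖ ^ 2])
      ⬝ᵥ ((‖a‖ ^ 2 + ‖b‖ ^ 2) • ![-2 * (a * b).im, -2 * (a * b).re, ‖b‖ ^ 2 - ‖a‖ ^ 2])
      = ((‖a‖ ^ 2 + ‖b‖ ^ 2) ^ 2) ^ 2 := by
    simp only [← Complex.normSq_eq_norm_sq, Complex.normSq_apply, dotProduct, Fin.sum_univ_three]
    simp
    ring
  simp only [e]
  rw [Real.sqrt_sq (by positivity), smul_smul]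
  congr 1
  -- For the zero spinor both factors are 0, because 0⁻¹ = 0.
  rcases eq_or_ne (‖a‖ ^ 2 + ‖b‖ ^ 2) 0 with h0 | h0
  · simp [h0]
  · field_simp

/-- Complex form of the normal, polynomial in a, b and their conjugates up to the denominator, so
that later identities can treat conjugates as independent variables. -/
lemma unitNormal_ofReal {f : ℂ → SL2Tilde} {z a b : ℂ} (h : SpinorRel (zComp f z) a b)
    (h0 : a * (starRingEnd ℂ) a + b * (starRingEnd ℂ) b ≠ 0) :
    (unitNormal f z 0 : ℂ) = Complex.I * (a * b - (starRingEnd ℂ) a * (starRingEnd ℂ) b)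
        / (a * (starRingEnd ℂ) a + b * (starRingEnd ℂ) b) ∧
    (unitNormal f z 1 : ℂ) = -(a * b + (starRingEnd ℂ) a * (starRingEnd ℂ) b)
        / (a * (starRingEnd ℂ) a + b * (starRingEnd ℂ) b) ∧
    (unitNormal f z 2 : ℂ) = (b * (starRingEnd ℂ) b - a * (starRingEnd ℂ) a)
        / (a * (starRingEnd ℂ) a + b * (starRingEnd ℂ) b) := by
  have hρ : ((‖a‖ ^ 2 + ‖b‖ ^ 2 : ℝ) : ℂ)
      = a * (starRingEnd ℂ) a + b * (starRingEnd ℂ) b := by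
    push_cast
    rw [Complex.mul_conj', Complex.mul_conj']
  have h0' : ((‖a‖ ^ 2 + ‖b‖ ^ 2 : ℝ) : ℂ) ≠ 0 := hρ ▸ h0
  rw [unitNormal_of_spinorRel h]
  simp only [Pi.smul_apply, smul_eq_mul, Complex.ofReal_mul, Complex.ofReal_inv, ← hρ]
  refine ⟨?_, ?_, ?_⟩ <;> rw [eq_div_iff h0', mul_comm, ← mul_assoc, mul_inv_cancel₀ h0', one_mul]
  · apply Complex.ext <;> simp
    ring
  · apply Complex.ext <;> simp <;> ring
  · simp [Complex.mul_conj']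

lemma fderiv_leftForm {f : ℂ → SL2Tilde} {z : ℂ} {k : Fin 3}
    (h : DifferentiableAt ℝ (fun w => zComp f w k) z) (v : ℂ) :
    fderiv ℝ (fun w => leftForm f w 1 k) z v = 2 * (fderiv ℝ (fun w => zComp f w k) z v).re ∧
    fderiv ℝ (fun w => leftForm f w Complex.I k) z v
      = -2 * (fderiv ℝ (fun w => zComp f w k) z v).im := by
  have h1 := (Complex.reCLM.hasFDerivAt.comp z h.hasFDerivAt).const_mul 2
  have h2 := (Complex.imCLM.hasFDerivAt.comp z h.hasFDerivAt).const_mul (-2)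
  simp only [leftForm_one, leftForm_I]
  exact ⟨by simpa using congrArg (fun L : ℂ →L[ℝ] ℝ => L v) h1.fderiv,
    by simpa using congrArg (fun L : ℂ →L[ℝ] ℝ => L v) h2.fderiv⟩

/-- The trace of the second fundamental form in a conformal parameter. -/
lemma secondForm_trace {f : ℂ → SL2Tilde} {z : ℂ}
    (h : ∀ k, DifferentiableAt ℝ (fun w => zComp f w k) z) :
    ((secondForm f z 1 1 + secondForm f z Complex.I Complex.I : ℝ) : ℂ)
      = ∑ k, (2 * (dzbar (fun w => zComp f w k) z
            + (starRingEnd ℂ) (dzbar (fun w => zComp f w k) z))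
          + 2 * ∑ i, ∑ j, (zComp f z i * (starRingEnd ℂ) (zComp f z j)
            + (starRingEnd ℂ) (zComp f z i) * zComp f z j) * (leviCivita i j k : ℂ))
          * (unitNormal f z k : ℂ) := by
  have key : ∀ k, ((covDeriv f (fun u => leftForm f u 1) z 1 k
      + covDeriv f (fun u => leftForm f u Complex.I) z Complex.I k : ℝ) : ℂ)
      = 2 * (dzbar (fun w => zComp f w k) z + (starRingEnd ℂ) (dzbar (fun w => zComp f w k) z))
        + 2 * ∑ i, ∑ j, (zComp f z i * (starRingEnd ℂ) (zComp f z j)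
            + (starRingEnd ℂ) (zComp f z i) * zComp f z j) * (leviCivita i j k : ℂ) := by
    intro k
    simp only [covDeriv]
    rw [(fderiv_leftForm (h k) _).1, (fderiv_leftForm (h k) _).2]
    simp only [fderiv_one_eq, fderiv_I_eq, leftForm_one, leftForm_I, Fin.sum_univ_three]
    generalize dz (fun w => zComp f w k) z = p
    generalize dzbar (fun w => zComp f w k) z = q
    apply Complex.ext <;> simp <;> ring
  simp only [secondForm, dotProduct, ← key]
  push_cast
  rw [← Finset.sum_add_distrib]
  exact Finset.sum_congr rfl fun k _ => by ring

section Spinor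
variable {f : ℂ → SL2Tilde} {a b : ℂ → ℂ} {z p q r s : ℂ}

lemma hasDz_zComp (ha : HasDz a p q z) (hb : HasDz b r s z)
    (h : ∀ᶠ w in 𝓝 z, SpinorRel (zComp f w) (a w) (b w)) :
    HasDz (fun w => zComp f w 0) (Complex.I * ((starRingEnd ℂ) (b z) * (starRingEnd ℂ) s + a z * p))
      (Complex.I * ((starRingEnd ℂ) (b z) * (starRingEnd ℂ) r + a z * q)) z ∧
    HasDz (fun w => zComp f w 1) ((starRingEnd ℂ) (b z) * (starRingEnd ℂ) s - a z * p)
      ((starRingEnd ℂ) (b z) * (starRingEnd ℂ) r - a z * q) z ∧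
    HasDz (fun w => zComp f w 2) (p * (starRingEnd ℂ) (b z) + a z * (starRingEnd ℂ) s)
      (q * (starRingEnd ℂ) (b z) + a z * (starRingEnd ℂ) r) z := by
  refine ⟨?_, ?_, ?_⟩
  · exact (((hb.conj.pow_two.add ha.pow_two).const_mul _).congr_of_eventuallyEq
      (h.mono fun w hw => hw.1)).congr_val (by ring) (by ring)
  · exact (((hb.conj.pow_two.sub ha.pow_two).const_mul _).congr_of_eventuallyEq
      (h.mono fun w hw => hw.2.1)).congr_val (by ring) (by ring)
  · exact (ha.mul hb.conj).congr_of_eventuallyEq (h.mono fun w hw => hw.2.2)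

/-- The structure equations after inserting Z₁ + iZ₂ = i b̄², Z₁ - iZ₂ = i a² and Z₃ = a b̄. The
first fixes only an imaginary part, so the two leave one real degree of freedom in the pair (q, r),
which the mean curvature will fill. -/
lemma spinor_flat (hf : SmoothAt f z) (ha : HasDz a p q z) (hb : HasDz b r s z)
    (h : ∀ᶠ w in 𝓝 z, SpinorRel (zComp f w) (a w) (b w)) :
    Complex.I * ((q * (starRingEnd ℂ) (b z) + a z * (starRingEnd ℂ) r)
        - ((starRingEnd ℂ) q * b z + (starRingEnd ℂ) (a z) * r))
      = (b z * (starRingEnd ℂ) (b z)) ^ 2 - (a z * (starRingEnd ℂ) (a z)) ^ 2 ∧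
    a z * q + b z * r = Complex.I / 4 * (a z * b z)
      * (a z * (starRingEnd ℂ) (a z) + b z * (starRingEnd ℂ) (b z)) := by
  obtain ⟨h0, h1, h2⟩ := hasDz_zComp ha hb h
  obtain ⟨e0, e1, e2⟩ := h.self_of_nhds
  obtain ⟨F1, F2⟩ := hf.flat h2 (h0.add (h1.const_mul Complex.I)) (h0.sub (h1.const_mul Complex.I))
  rw [e0, e1] at F1
  rw [e0, e1, e2] at F2
  simp only [map_add, map_sub, map_mul, map_div₀, map_pow, map_one, map_ofNat, Complex.conj_conj,
    Complex.conj_I] at F1 F2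
  have hI := Complex.I_sq
  generalize a z = A at *
  generalize b z = B at *
  set A' := (starRingEnd ℂ) A
  set B' := (starRingEnd ℂ) B
  constructor
  · linear_combination F1 - (B ^ 2 * B' ^ 2 - A ^ 2 * A' ^ 2) * hI
  · linear_combination (-Complex.I / 4) * F2 +
      (A * q + B * r - (Complex.I / 4) * (A * B) * (A * A' + B * B')) * hI

/-- The trace of the second fundamental form involves the connection only through the terms 2 Re(Z₁
Z̄₃) N₂ and 2 Re(Z₂ Z̄₃) N₁. For the normal of a spinor these are equal and enter with opposite
signs, so only derivatives of ψ survive. -/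
lemma meanCurvature_of_spinorRel (hf : SmoothAt f z) (ha : HasDz a p q z) (hb : HasDz b r s z)
    (h : ∀ᶠ w in 𝓝 z, SpinorRel (zComp f w) (a w) (b w))
    (h0 : a z * (starRingEnd ℂ) (a z) + b z * (starRingEnd ℂ) (b z) ≠ 0) :
    (meanCurvature f z : ℂ)
        * (a z * (starRingEnd ℂ) (a z) + b z * (starRingEnd ℂ) (b z)) ^ 2
      = (q * (starRingEnd ℂ) (b z) - a z * (starRingEnd ℂ) r)
        + ((starRingEnd ℂ) q * b z - (starRingEnd ℂ) (a z) * r) := by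
  have hz := h.self_of_nhds
  obtain ⟨n0, n1, n2⟩ := unitNormal_ofReal hz h0
  obtain ⟨g11, g22, g12⟩ := firstForm_of_spinorRel hz
  have hρ : ((‖a z‖ ^ 2 + ‖b z‖ ^ 2 : ℝ) : ℂ)
      = a z * (starRingEnd ℂ) (a z) + b z * (starRingEnd ℂ) (b z) := by
    push_cast
    rw [Complex.mul_conj', Complex.mul_conj']
  have hH : meanCurvature f z * (2 * (‖a z‖ ^ 2 + ‖b z‖ ^ 2) ^ 2)
      = secondForm f z 1 1 + secondForm f z Complex.I Complex.I := by
    have : (‖a z‖ ^ 2 + ‖b z‖ ^ 2) ≠ 0 := fun e => h0 (by rw [← hρ, e]; simp)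
    rw [meanCurvature, g11, g22, g12]
    field_simp
    ring
  have hH' := congrArg (fun x : ℝ => (x : ℂ)) hH
  simp only [secondForm_trace fun k => (hf.contDiffAt_zComp k).differentiableAt_infty] at hH'
  rw [Complex.ofReal_mul, Complex.ofReal_mul, Complex.ofReal_pow, hρ] at hH'
  obtain ⟨d0, d1, d2⟩ := hasDz_zComp ha hb h
  obtain ⟨e0, e1, e2⟩ := hz
  simp only [leviCivita_eq, Fin.sum_univ_three, d0.2.2, d1.2.2, d2.2.2, n0, n1, n2, e0, e1, e2] at hH'
  simp at hH'
  simp only [map_ofNat] at hH'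
  have hI := Complex.I_sq
  generalize a z = A at *
  generalize b z = B at *
  set A' := (starRingEnd ℂ) A
  set B' := (starRingEnd ℂ) B
  set q' := (starRingEnd ℂ) q
  set r' := (starRingEnd ℂ) r
  field_simp at hH' ⊢
  refine mul_right_cancel₀ h0 ?_
  linear_combination
    (norm := (ring_nf; simp only [Complex.I_sq]; ring_nf)) hH' / 4

/-- The derivatives of Z contribute b̄ p - a s̄. The connection contributes (5/2) Z₃ (Z₁ N₂ - Z₂
N₁), and Z₁ N₂ - Z₂ N₁ = -i a b̄. -/
lemma hopf_of_spinorRel (ha : HasDz a p q z) (hb : HasDz b r s z)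
    (h : ∀ᶠ w in 𝓝 z, SpinorRel (zComp f w) (a w) (b w))
    (h0 : a z * (starRingEnd ℂ) (a z) + b z * (starRingEnd ℂ) (b z) ≠ 0) :
    hopf f z = ((starRingEnd ℂ) (b z) * p - a z * (starRingEnd ℂ) s)
        - 5 * Complex.I / 2 * a z ^ 2 * (starRingEnd ℂ) (b z) ^ 2 := by
  have hz := h.self_of_nhds
  obtain ⟨n0, n1, n2⟩ := unitNormal_ofReal hz h0
  obtain ⟨d0, d1, d2⟩ := hasDz_zComp ha hb h
  obtain ⟨e0, e1, e2⟩ := hz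
  simp only [hopf, leviCivita_eq, Fin.sum_univ_three, d0.2.1, d1.2.1, d2.2.1, n0, n1, n2, e0, e1, e2]
  simp
  have hI := Complex.I_sq
  generalize a z = A at *
  generalize b z = B at *
  set A' := (starRingEnd ℂ) A
  set B' := (starRingEnd ℂ) B
  set s' := (starRingEnd ℂ) s
  generalize hR : A * A' + B * B' = R at *
  field_simp
  rw [← hR]
  linear_combination
    (norm := (ring_nf; simp only [Complex.I_sq]; ring_nf)) 0 * hI

/-- Solving the structure equations for `∂̄ψ₁` and `∂ψ₂`. -/
lemma dirac_of_spinorRel (hf : SmoothAt f z) (ha : HasDz a p q z) (hb : HasDz b r s z)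
    (h : ∀ᶠ w in 𝓝 z, SpinorRel (zComp f w) (a w) (b w))
    (h0 : a z * (starRingEnd ℂ) (a z) + b z * (starRingEnd ℂ) (b z) ≠ 0) :
    q = ((meanCurvature f z : ℂ) / 2 * (a z * (starRingEnd ℂ) (a z) + b z * (starRingEnd ℂ) (b z))
        + Complex.I * (3 / 4 * (a z * (starRingEnd ℂ) (a z))
          - 1 / 2 * (b z * (starRingEnd ℂ) (b z)))) * b z ∧
    r = -((meanCurvature f z : ℂ) / 2 * (a z * (starRingEnd ℂ) (a z) + b z * (starRingEnd ℂ) (b z))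
        + Complex.I * (1 / 2 * (a z * (starRingEnd ℂ) (a z))
          - 3 / 4 * (b z * (starRingEnd ℂ) (b z)))) * a z := by
  have hH := meanCurvature_of_spinorRel hf ha hb h h0
  obtain ⟨F1, F2⟩ := spinor_flat hf ha hb h
  have hI := Complex.I_sq
  generalize a z = A at *
  generalize b z = B at *
  generalize (meanCurvature f z : ℂ) = H at *
  set A' := (starRingEnd ℂ) A
  set B' := (starRingEnd ℂ) B
  set q' := (starRingEnd ℂ) q
  set r' := (starRingEnd ℂ) r
  -- The real part of this quantity is given by the mean curvature, the imaginary part by the first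
  -- structure equation.
  have c : q * B' - A' * r = H / 2 * (A * A' + B * B') ^ 2
      + Complex.I / 2 * (A * A' + B * B') * (A * A' - B * B') := by
    linear_combination (-Complex.I / 2) * F1 - 1 / 2 * hH
      + (q * B' + A * r' - q' * B - A' * r) / 2 * hI
  -- Together with the second structure equation this is a linear system for (q, r) with determinant
  -- |a|² + |b|²; both components follow by Cramer's rule.
  constructor
  · refine mul_right_cancel₀ h0 ?_
    linear_combination B * c + A' * F2
  · refine mul_right_cancel₀ h0 ?_
    linear_combination (-A) * c + B' * F2

end Spinor

/-! ### Smoothness of the geometric data -/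

lemma IsConformalImmersion.smoothAt {D : Set ℂ} {f : ℂ → SL2Tilde} (hD : IsOpen D)
    (h : IsConformalImmersion D f) {z : ℂ} (hz : z ∈ D) : SmoothAt f z :=
  (contMDiffOn_iff_smoothAt hD).1 h.1 z hz

lemma SmoothAt.contDiffAt_firstForm {f : ℂ → SL2Tilde} {z : ℂ} (h : SmoothAt f z) (v w : ℂ) :
    ContDiffAt ℝ ∞ (fun u => firstForm f u v w) z := by
  simp only [firstForm, dotProduct]
  exact ContDiffAt.sum fun k _ => (h.contDiffAt_leftForm v k).mul (h.contDiffAt_leftForm w k)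

lemma contDiffAt_confExp {D : Set ℂ} {f : ℂ → SL2Tilde} (hD : IsOpen D)
    (h : IsConformalImmersion D f) {z : ℂ} (hz : z ∈ D) : ContDiffAt ℝ ∞ (confExp f) z :=
  (((h.smoothAt hD hz).contDiffAt_firstForm 1 1).log (h.2 z hz).1.ne').div_const 2

lemma contDiffAt_unitNormal {D : Set ℂ} {f : ℂ → SL2Tilde} (hD : IsOpen D)
    (h : IsConformalImmersion D f) {z : ℂ} (hz : z ∈ D) (k : Fin 3) :
    ContDiffAt ℝ ∞ (fun w => unitNormal f w k) z := by
  have hl := fun v k => (h.smoothAt hD hz).contDiffAt_leftForm v k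
  have hn : ∀ k, ContDiffAt ℝ ∞
      (fun w => crossProduct (leftForm f w 1) (leftForm f w Complex.I) k) z := by
    intro k
    simp only [cross_apply]
    fin_cases k
    · exact ((hl 1 1).mul (hl Complex.I 2)).sub ((hl 1 2).mul (hl Complex.I 1))
    · exact ((hl 1 2).mul (hl Complex.I 0)).sub ((hl 1 0).mul (hl Complex.I 2))
    · exact ((hl 1 0).mul (hl Complex.I 1)).sub ((hl 1 1).mul (hl Complex.I 0))
  have hnn : ContDiffAt ℝ ∞ (fun w => crossProduct (leftForm f w 1) (leftForm f w Complex.I)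
      ⬝ᵥ crossProduct (leftForm f w 1) (leftForm f w Complex.I)) z := by
    simp only [dotProduct]
    exact ContDiffAt.sum fun k _ => (hn k).mul (hn k)
  have hpos : 0 < crossProduct (leftForm f z 1) (leftForm f z Complex.I)
      ⬝ᵥ crossProduct (leftForm f z 1) (leftForm f z Complex.I) := by
    obtain ⟨h1, h2, h3⟩ := h.2 z hz
    rw [cross_dot_cross, dotProduct_comm (leftForm f z Complex.I) (leftForm f z 1)]
    simp only [firstForm] at h1 h2 h3
    rw [h2, h3]
    simpa using mul_pos h1 h1
  exact ((hnn.sqrt hpos.ne').inv (Real.sqrt_pos.2 hpos).ne').mul (hn k)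

lemma contDiffAt_secondForm {D : Set ℂ} {f : ℂ → SL2Tilde} (hD : IsOpen D)
    (h : IsConformalImmersion D f) {z : ℂ} (hz : z ∈ D) (v w : ℂ) :
    ContDiffAt ℝ ∞ (fun u => secondForm f u v w) z := by
  have hl := fun v k => (h.smoothAt hD hz).contDiffAt_leftForm v k
  simp only [secondForm, dotProduct, covDeriv]
  exact ContDiffAt.sum fun k _ => (((hl w k).fderiv_apply_infty v).add
    (ContDiffAt.sum fun i _ => ContDiffAt.sum fun j _ =>
      ((hl v i).mul (hl w j)).mul contDiffAt_const)).mul (contDiffAt_unitNormal hD h hz k)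

lemma contDiffAt_meanCurvature {D : Set ℂ} {f : ℂ → SL2Tilde} (hD : IsOpen D)
    (h : IsConformalImmersion D f) {z : ℂ} (hz : z ∈ D) : ContDiffAt ℝ ∞ (meanCurvature f) z := by
  have hl := (h.smoothAt hD hz).contDiffAt_firstForm
  have hs := fun v w => contDiffAt_secondForm hD h hz v w
  obtain ⟨h1, h2, h3⟩ := h.2 z hz
  refine (((hs 1 1).mul (hl Complex.I Complex.I)).sub
    ((contDiffAt_const.mul (hs 1 Complex.I)).mul (hl 1 Complex.I)) |>.add
    ((hs Complex.I Complex.I).mul (hl 1 1))).div (contDiffAt_const.mul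
      (((hl 1 1).mul (hl Complex.I Complex.I)).sub ((hl 1 Complex.I).pow 2))) ?_
  rw [h2, h3]
  have := mul_pos h1 h1
  simpa using h1.ne'

lemma contDiffAt_hopf {D : Set ℂ} {f : ℂ → SL2Tilde} (hD : IsOpen D)
    (h : IsConformalImmersion D f) {z : ℂ} (hz : z ∈ D) : ContDiffAt ℝ ∞ (hopf f) z := by
  have hZ := (h.smoothAt hD hz).contDiffAt_zComp
  exact ContDiffAt.sum fun k _ => ((hZ k).dz.add
    (ContDiffAt.sum fun i _ => ContDiffAt.sum fun j _ =>
      ((hZ i).mul (hZ j)).mul contDiffAt_const)).mul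
    (contDiffAt_ofReal (contDiffAt_unitNormal hD h hz k))

lemma IsGeneratingSpinor.contDiffAt {D : Set ℂ} {f : ℂ → SL2Tilde} {ψ : ℂ → Fin 2 → ℂ}
    (hD : IsOpen D) (h : IsGeneratingSpinor D f ψ) {z : ℂ} (hz : z ∈ D) (i : Fin 2) :
    ContDiffAt ℝ ∞ (fun w => ψ w i) z :=
  contDiffAt_pi.1 (h.1.contDiffAt (hD.mem_nhds hz)) i

lemma IsGeneratingSpinor.eventually {D : Set ℂ} {f : ℂ → SL2Tilde} {ψ : ℂ → Fin 2 → ℂ}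
    (hD : IsOpen D) (h : IsGeneratingSpinor D f ψ) {z : ℂ} (hz : z ∈ D) :
    ∀ᶠ w in 𝓝 z, SpinorRel (zComp f w) (ψ w 0) (ψ w 1) :=
  (hD.eventually_mem hz).mono fun w hw => h.2 w hw

lemma normSq_add_ne_zero {v : Fin 2 → ℂ} (h : v ≠ 0) :
    v 0 * (starRingEnd ℂ) (v 0) + v 1 * (starRingEnd ℂ) (v 1) ≠ 0 := by
  intro h0
  rw [Complex.mul_conj, Complex.mul_conj] at h0
  have h1 : Complex.normSq (v 0) + Complex.normSq (v 1) = 0 := by exact_mod_cast h0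
  have h2 := Complex.normSq_nonneg (v 0)
  have h3 := Complex.normSq_nonneg (v 1)
  apply h
  exact funext (Fin.forall_fin_two.2 ⟨Complex.normSq_eq_zero.1 (by linarith),
    Complex.normSq_eq_zero.1 (by linarith)⟩)

/-! ### Dirac and Weingarten equations, Hopf formula -/

section
variable {D : Set ℂ} {f : ℂ → SL2Tilde} {ψ : ℂ → Fin 2 → ℂ}

lemma IsGeneratingSpinor.ne_zero (hf : IsConformalImmersion D f) (h : IsGeneratingSpinor D f ψ)
    {z : ℂ} (hz : z ∈ D) : ψ z ≠ 0 := by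
  intro h0
  have h1 := (firstForm_of_spinorRel (h.2 z hz)).1
  have h2 := (hf.2 z hz).1
  simp [h1, h0] at h2

lemma IsGeneratingSpinor.exp_confExp (hf : IsConformalImmersion D f)
    (h : IsGeneratingSpinor D f ψ) {z : ℂ} (hz : z ∈ D) :
    Real.exp (confExp f z) = ‖ψ z 0‖ ^ 2 + ‖ψ z 1‖ ^ 2 := by
  have h1 := (firstForm_of_spinorRel (h.2 z hz)).1
  have h2 := (hf.2 z hz).1
  rw [h1] at h2
  have h3 : 0 < ‖ψ z 0‖ ^ 2 + ‖ψ z 1‖ ^ 2 := by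
    rcases (show 0 ≤ ‖ψ z 0‖ ^ 2 + ‖ψ z 1‖ ^ 2 by positivity).eq_or_lt with h | h
    · rw [← h] at h2; simp at h2
    · exact h
  rw [confExp, h1, Real.log_pow]
  simp [Real.exp_log h3]

/-- The form used throughout: solved for ∂̄ψ₁ and ∂ψ₂, with squared norms replaced by products with
conjugates so that algebra with conjugation applies. -/
lemma diracEquation_iff (H : ℂ → ℝ) : DiracEquation D H ψ ↔ ∀ z ∈ D,
    dzbar (fun w => ψ w 0) z = ((H z : ℂ) / 2
        * (ψ z 0 * (starRingEnd ℂ) (ψ z 0) + ψ z 1 * (starRingEnd ℂ) (ψ z 1))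
        + Complex.I * (3 / 4 * (ψ z 0 * (starRingEnd ℂ) (ψ z 0))
          - 1 / 2 * (ψ z 1 * (starRingEnd ℂ) (ψ z 1)))) * ψ z 1 ∧
    dz (fun w => ψ w 1) z = -((H z : ℂ) / 2
        * (ψ z 0 * (starRingEnd ℂ) (ψ z 0) + ψ z 1 * (starRingEnd ℂ) (ψ z 1))
        + Complex.I * (1 / 2 * (ψ z 0 * (starRingEnd ℂ) (ψ z 0))
          - 3 / 4 * (ψ z 1 * (starRingEnd ℂ) (ψ z 1)))) * ψ z 0 := by
  refine forall₂_congr fun z hz => ?_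
  simp only [diracOp, potentialU, potentialV, Complex.mul_conj']
  constructor
  · intro h
    have h0 := congrFun h 0
    have h1 := congrFun h 1
    simp only [Matrix.cons_val_zero, Matrix.cons_val_one, Pi.zero_apply] at h0 h1
    exact ⟨by linear_combination -h1, by linear_combination h0⟩
  · rintro ⟨h0, h1⟩
    refine funext (Fin.forall_fin_two.2 ⟨?_, ?_⟩)
    · simp only [Matrix.cons_val_zero, Pi.zero_apply]
      linear_combination h1
    · simp only [Matrix.cons_val_one, Matrix.cons_val_fin_one, Pi.zero_apply]
      linear_combination -h0

lemma IsGeneratingSpinor.dirac (hD : IsOpen D) (hf : IsConformalImmersion D f)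
    (h : IsGeneratingSpinor D f ψ) : DiracEquation D (meanCurvature f) ψ :=
  (diracEquation_iff _).2 fun z hz => dirac_of_spinorRel (a := fun w => ψ w 0)
    (b := fun w => ψ w 1) (hf.smoothAt hD hz)
    (h.contDiffAt hD hz 0).differentiableAt_infty.hasDz
    (h.contDiffAt hD hz 1).differentiableAt_infty.hasDz (h.eventually hD hz)
    (normSq_add_ne_zero (v := ψ z) (h.ne_zero hf hz))

lemma IsGeneratingSpinor.hopfFormula (hD : IsOpen D) (hf : IsConformalImmersion D f)
    (h : IsGeneratingSpinor D f ψ) : HopfFormula D (hopf f) ψ := by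
  intro z hz
  have hb := (h.contDiffAt hD hz 1).differentiableAt_infty.hasDz
  rw [hb.conj.2.1]
  exact hopf_of_spinorRel (a := fun w => ψ w 0) (b := fun w => ψ w 1) (h.contDiffAt hD hz 0).differentiableAt_infty.hasDz hb
    (h.eventually hD hz) (normSq_add_ne_zero (h.ne_zero hf hz))

lemma IsGeneratingSpinor.cexp_confExp (hf : IsConformalImmersion D f)
    (h : IsGeneratingSpinor D f ψ) {z : ℂ} (hz : z ∈ D) :
    Complex.exp (confExp f z)
      = ψ z 0 * (starRingEnd ℂ) (ψ z 0) + ψ z 1 * (starRingEnd ℂ) (ψ z 1) := by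
  have := congrArg (fun x : ℝ => (x : ℂ)) (h.exp_confExp hf hz)
  rw [Complex.mul_conj', Complex.mul_conj']
  push_cast at this
  exact this

/-- Differentiating e^α = |ψ₁|² + |ψ₂|² gives ψ̄₁ ∂ψ₁ + ψ₂ ∂ψ̄₂ modulo terms known from the Dirac
equation, and the Hopf formula gives ψ̄₂ ∂ψ₁ - ψ₁ ∂ψ̄₂. The determinant of this system is -e^α. The
equation for ∂̄ψ₂ comes from the ∂̄ derivative and the conjugate Hopf formula. -/
lemma IsGeneratingSpinor.weingarten (hD : IsOpen D) (hf : IsConformalImmersion D f)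
    (h : IsGeneratingSpinor D f ψ) : WeingartenEquations D (confExp f) (hopf f) ψ := by
  intro z hz
  have ha := (h.contDiffAt hD hz 0).differentiableAt_infty.hasDz
  have hb := (h.contDiffAt hD hz 1).differentiableAt_infty.hasDz
  have hα := (contDiffAt_ofReal (contDiffAt_confExp hD hf hz)).differentiableAt_infty.hasDz
  have e : (fun w => Complex.exp (confExp f w)) =ᶠ[𝓝 z]
      fun w => ψ w 0 * (starRingEnd ℂ) (ψ w 0) + ψ w 1 * (starRingEnd ℂ) (ψ w 1) :=
    (hD.eventually_mem hz).mono fun w hw => h.cexp_confExp hf hw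
  obtain ⟨r1, r2⟩ := hα.cexp.unique
    (((ha.mul ha.conj).add (hb.mul hb.conj)).congr_of_eventuallyEq e)
  rw [h.cexp_confExp hf hz] at r1 r2
  obtain ⟨d0, d1⟩ := (diracEquation_iff _).1 (h.dirac hD hf) z hz
  have hA := h.hopfFormula hD hf z hz
  rw [hb.conj.2.1] at hA
  have h0 := normSq_add_ne_zero (h.ne_zero hf hz)
  have hE : (Real.exp (-confExp f z) : ℂ)
      = (ψ z 0 * (starRingEnd ℂ) (ψ z 0) + ψ z 1 * (starRingEnd ℂ) (ψ z 1))⁻¹ := by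
    rw [← h.cexp_confExp hf hz, ← Complex.exp_neg]; push_cast; rfl
  rw [hE]
  generalize dz (fun w => (confExp f w : ℂ)) z = α₁ at *
  generalize dzbar (fun w => (confExp f w : ℂ)) z = α₂ at *
  generalize hopf f z = A at *
  clear hE hα e ha hb
  rw [d0, d1] at r1 r2
  have hA' := congrArg (starRingEnd ℂ) hA
  have hI := Complex.I_sq
  simp only [map_add, map_sub, map_mul, map_neg, map_div₀, map_pow, map_one, map_ofNat,
    Complex.conj_conj, Complex.conj_I, Complex.conj_ofReal] at hA' r1 r2
  generalize (starRingEnd ℂ) A = A' at *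
  constructor
  · field_simp
    linear_combination (-4 * ψ z 0) * r1 - 4 * ψ z 1 * hA
  · field_simp
    linear_combination (-4 * ψ z 1) * r2 + 4 * ψ z 0 * hA'

end

/-! ### Gauss and Codazzi equations -/

/-- The compatibility conditions of the Weingarten equations. -/
lemma gauss_codazzi_algebra {a a' b b' H H₁ H₁' α₁ α₂ α₁₂ A A' A₂ A₂' E p p' q q' r r' s s' : ℂ}
    (hp : p = α₁ * a + A * E * b + 5 * Complex.I / 4 * a ^ 2 * b')
    (hp' : p' = α₂ * a' + A' * E * b' - 5 * Complex.I / 4 * a' ^ 2 * b)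
    (hs : s = -A' * E * a + α₂ * b + 5 * Complex.I / 4 * a' * b ^ 2)
    (hs' : s' = -A * E * a' + α₁ * b' - 5 * Complex.I / 4 * a * b' ^ 2)
    (hq : q = (H / 2 * (a * a' + b * b')
      + Complex.I * (3 / 4 * (a * a') - 1 / 2 * (b * b'))) * b)
    (hq' : q' = (H / 2 * (a * a' + b * b')
      - Complex.I * (3 / 4 * (a * a') - 1 / 2 * (b * b'))) * b')
    (hr : r = -(H / 2 * (a * a' + b * b')
      + Complex.I * (1 / 2 * (a * a') - 3 / 4 * (b * b'))) * a)
    (hr' : r' = -(H / 2 * (a * a' + b * b')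
      - Complex.I * (1 / 2 * (a * a') - 3 / 4 * (b * b'))) * a')
    (e₁ : α₁₂ * a + α₁ * q + (A₂ * E - A * E * α₂) * b + A * E * s
        + 5 * Complex.I / 4 * (2 * a * q * b' + a ^ 2 * r')
      = (H₁ / 2 * (a * a' + b * b') + H / 2 * (p * a' + a * q' + r * b' + b * s')
        + Complex.I * (3 / 4 * (p * a' + a * q') - 1 / 2 * (r * b' + b * s'))) * b
        + (H / 2 * (a * a' + b * b')
          + Complex.I * (3 / 4 * (a * a') - 1 / 2 * (b * b'))) * r)
    (e₂ : -(A₂' * E - A' * E * α₁) * a - A' * E * p + α₁₂ * b + α₂ * r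
        + 5 * Complex.I / 4 * (q' * b ^ 2 + 2 * a' * b * r)
      = -((H₁' / 2 * (a * a' + b * b') + H / 2 * (q * a' + a * p' + s * b' + b * r')
        + Complex.I * (1 / 2 * (q * a' + a * p') - 3 / 4 * (s * b' + b * r'))) * a
        + (H / 2 * (a * a' + b * b')
          + Complex.I * (1 / 2 * (a * a') - 3 / 4 * (b * b'))) * q)) :
    (α₁₂ - E ^ 2 * A * A' + (a * a' + b * b') ^ 2 * H ^ 2 / 4 - (a * a' + b * b') ^ 2
        + 5 * (a * a') * (b * b')) * a
      + (A₂ * E + 5 / 2 * (a * b') * (b * b' - a * a') - H₁ * (a * a' + b * b') / 2) * b = 0 ∧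
    (α₁₂ - E ^ 2 * A * A' + (a * a' + b * b') ^ 2 * H ^ 2 / 4 - (a * a' + b * b') ^ 2
        + 5 * (a * a') * (b * b')) * b
      - (A₂' * E + 5 / 2 * (a' * b) * (b * b' - a * a') - H₁' * (a * a' + b * b') / 2) * a = 0 := by
  -- With conjugates as independent variables, `e₁` and `e₂` become polynomial relations modulo i² =
  -- -1. They combine one Gauss expression with a Codazzi expression and its conjugate.
  subst hp hp' hs hs' hq hq' hr hr'
  constructor
  · linear_combination (norm := (ring_nf; simp only [Complex.I_sq]; ring_nf)) e₁
  · linear_combination (norm := (ring_nf; simp only [Complex.I_sq]; ring_nf)) e₂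

/-- Since G is real, conjugating the second relation gives G b̄ - C ā = 0. With the first this is a
linear system for (G, C) whose determinant is -(|a|² + |b|²). -/
lemma eq_zero_of_quaternionic {a b G C C' : ℂ} (h₁ : G * a + C * b = 0) (h₂ : G * b - C' * a = 0)
    (h₀ : a * (starRingEnd ℂ) a + b * (starRingEnd ℂ) b ≠ 0) (hG : (starRingEnd ℂ) G = G)
    (hC : C' = (starRingEnd ℂ) C) : G = 0 ∧ C = 0 := by
  subst hC
  have h₂' := congrArg (starRingEnd ℂ) h₂
  have h₁' := congrArg (starRingEnd ℂ) h₁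
  simp only [map_add, map_sub, map_mul, hG, Complex.conj_conj, map_zero] at h₁' h₂'
  have hC : C = 0 := by
    refine (mul_eq_zero.1 (?_ : C * _ = 0)).resolve_right h₀
    linear_combination (starRingEnd ℂ) b * h₁ - a * h₂'
  refine ⟨?_, hC⟩
  refine (mul_eq_zero.1 (?_ : G * _ = 0)).resolve_right h₀
  rw [hC] at h₁ h₂
  simp only [map_zero, zero_mul] at h₁ h₂
  linear_combination (starRingEnd ℂ) a * h₁ + (starRingEnd ℂ) b * h₂

section
variable {D : Set ℂ} {f : ℂ → SL2Tilde} {ψ : ℂ → Fin 2 → ℂ}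

/-- The equations ∂̄∂ψ₁ = ∂∂̄ψ₁ and ∂̄∂ψ₂ = ∂∂̄ψ₂, expanded by the Weingarten equations, mix Gauss
and Codazzi. They are separated pointwise by `eq_zero_of_quaternionic`. -/
lemma IsGeneratingSpinor.gauss_codazzi (hD : IsOpen D) (hf : IsConformalImmersion D f)
    (h : IsGeneratingSpinor D f ψ) {z : ℂ} (hz : z ∈ D) :
    dzbar (dz fun w => (confExp f w : ℂ)) z
        - Complex.exp (-(confExp f z : ℂ)) ^ 2 * hopf f z * (starRingEnd ℂ) (hopf f z)
        + (ψ z 0 * (starRingEnd ℂ) (ψ z 0) + ψ z 1 * (starRingEnd ℂ) (ψ z 1)) ^ 2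
          * (meanCurvature f z : ℂ) ^ 2 / 4
        - (ψ z 0 * (starRingEnd ℂ) (ψ z 0) + ψ z 1 * (starRingEnd ℂ) (ψ z 1)) ^ 2
        + 5 * (ψ z 0 * (starRingEnd ℂ) (ψ z 0)) * (ψ z 1 * (starRingEnd ℂ) (ψ z 1)) = 0 ∧
    dzbar (hopf f) z * Complex.exp (-(confExp f z : ℂ))
        + 5 / 2 * (ψ z 0 * (starRingEnd ℂ) (ψ z 1))
          * (ψ z 1 * (starRingEnd ℂ) (ψ z 1) - ψ z 0 * (starRingEnd ℂ) (ψ z 0))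
        - dz (fun w => (meanCurvature f w : ℂ)) z
          * (ψ z 0 * (starRingEnd ℂ) (ψ z 0) + ψ z 1 * (starRingEnd ℂ) (ψ z 1)) / 2 = 0 := by
  have sa := h.contDiffAt hD hz 0
  have sb := h.contDiffAt hD hz 1
  have sα := contDiffAt_ofReal (contDiffAt_confExp hD hf hz)
  have sH := contDiffAt_ofReal (contDiffAt_meanCurvature hD hf hz)
  have ha := sa.differentiableAt_infty.hasDz
  have hb := sb.differentiableAt_infty.hasDz
  have hα := sα.differentiableAt_infty.hasDz
  have hα₁ := sα.dz.differentiableAt_infty.hasDz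
  have hα₂ := sα.dzbar.differentiableAt_infty.hasDz
  have hH := sH.differentiableAt_infty.hasDz
  have hA := (contDiffAt_hopf hD hf hz).differentiableAt_infty.hasDz
  have hE := hα.neg.cexp
  have cα : dzbar (fun w => (confExp f w : ℂ)) z
      = (starRingEnd ℂ) (dz (fun w => (confExp f w : ℂ)) z) := dzbar_ofReal hα.1
  have cH := dzbar_ofReal hH.1
  -- α is real, hence so is ∂̄∂α. This makes the Gauss expression real, as the separation requires.
  have cα₁₂ : (starRingEnd ℂ) (dzbar (dz fun w => (confExp f w : ℂ)) z)
      = dzbar (dz fun w => (confExp f w : ℂ)) z := by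
    have e : dzbar (fun w => (confExp f w : ℂ)) =ᶠ[𝓝 z]
        fun w => (starRingEnd ℂ) (dz (fun w => (confExp f w : ℂ)) w) :=
      (hD.eventually_mem hz).mono fun w hw => dzbar_ofReal
        (contDiffAt_ofReal (contDiffAt_confExp hD hf hw)).differentiableAt_infty
    rw [dzbar_dz sα]
    nth_rw 2 [(hα₁.conj.congr_of_eventuallyEq e).2.1]
    rw [dzbar_dz sα]
  have hW := h.weingarten hD hf
  have hDir := (diracEquation_iff _).1 (h.dirac hD hf)
  have ep : dz (fun w => ψ w 0) =ᶠ[𝓝 z] fun w => dz (fun w => (confExp f w : ℂ)) w * ψ w 0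
      + hopf f w * Complex.exp (-(confExp f w : ℂ)) * ψ w 1
      + 5 * Complex.I / 4 * (ψ w 0 ^ 2 * (starRingEnd ℂ) (ψ w 1)) :=
    (hD.eventually_mem hz).mono fun w hw => by
      rw [(hW w hw).1]; push_cast; ring
  have es : dzbar (fun w => ψ w 1) =ᶠ[𝓝 z] fun w =>
      -((starRingEnd ℂ) (hopf f w) * Complex.exp (-(confExp f w : ℂ)) * ψ w 0)
      + dzbar (fun w => (confExp f w : ℂ)) w * ψ w 1
      + 5 * Complex.I / 4 * ((starRingEnd ℂ) (ψ w 0) * ψ w 1 ^ 2) :=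
    (hD.eventually_mem hz).mono fun w hw => by
      rw [(hW w hw).2]; push_cast; ring
  have eq : dzbar (fun w => ψ w 0) =ᶠ[𝓝 z] fun w => (1 / 2 * ((meanCurvature f w : ℂ)
        * (ψ w 0 * (starRingEnd ℂ) (ψ w 0) + ψ w 1 * (starRingEnd ℂ) (ψ w 1)))
        + Complex.I * (3 / 4 * (ψ w 0 * (starRingEnd ℂ) (ψ w 0))
          - 1 / 2 * (ψ w 1 * (starRingEnd ℂ) (ψ w 1)))) * ψ w 1 :=
    (hD.eventually_mem hz).mono fun w hw => by rw [(hDir w hw).1]; ring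
  have er : dz (fun w => ψ w 1) =ᶠ[𝓝 z] fun w => -((1 / 2 * ((meanCurvature f w : ℂ)
        * (ψ w 0 * (starRingEnd ℂ) (ψ w 0) + ψ w 1 * (starRingEnd ℂ) (ψ w 1)))
        + Complex.I * (1 / 2 * (ψ w 0 * (starRingEnd ℂ) (ψ w 0))
          - 3 / 4 * (ψ w 1 * (starRingEnd ℂ) (ψ w 1)))) * ψ w 0) :=
    (hD.eventually_mem hz).mono fun w hw => by rw [(hDir w hw).2]; ring
  have hρ := (ha.mul ha.conj).add (hb.mul hb.conj)
  have haa := ha.mul ha.conj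
  have hbb := hb.mul hb.conj
  have Dp := ((((hα₁.mul ha).add ((hA.mul hE).mul hb)).add
    ((ha.pow_two.mul hb.conj).const_mul (5 * Complex.I / 4))).congr_of_eventuallyEq ep).2.2
  have Ds := ((((((hA.conj).mul hE).mul ha).neg.add (hα₂.mul hb)).add
    ((ha.conj.mul hb.pow_two).const_mul (5 * Complex.I / 4))).congr_of_eventuallyEq es).2.1
  have Dq := ((((((hH.mul hρ).const_mul (1 / 2)).add (((haa.const_mul (3 / 4)).sub
    (hbb.const_mul (1 / 2))).const_mul Complex.I)).mul hb)).congr_of_eventuallyEq eq).2.1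
  have Dr := ((((((hH.mul hρ).const_mul (1 / 2)).add (((haa.const_mul (1 / 2)).sub
    (hbb.const_mul (3 / 4))).const_mul Complex.I)).mul ha).neg).congr_of_eventuallyEq er).2.2
  have E1 := Dp.symm.trans ((dzbar_dz sa).trans Dq)
  have E2 := Ds.symm.trans ((dzbar_dz sb).symm.trans Dr)
  rw [← dzbar_dz sα] at E2
  have hp := (hW z hz).1
  have hs := (hW z hz).2
  have hq := (hDir z hz).1
  have hr := (hDir z hz).2
  have hEe : (Real.exp (-confExp f z) : ℂ) = Complex.exp (-(confExp f z : ℂ)) := by push_cast; rfl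
  have cE : (starRingEnd ℂ) (Complex.exp (-(confExp f z : ℂ))) = Complex.exp (-(confExp f z : ℂ)) := by
    rw [← Complex.exp_conj]; simp
  rw [hEe] at hp hs
  have h0 := normSq_add_ne_zero (h.ne_zero hf hz)
  clear Dp Ds Dq Dr ep es eq er hρ haa hbb hEe hE ha hb hα hα₁ hα₂ hH hA hW hDir sa sb sα sH
  rw [cα] at E1 E2 hs
  rw [cH] at E2
  generalize dzbar (dz fun w => (confExp f w : ℂ)) z = α₁₂ at *
  generalize dz (fun w => (confExp f w : ℂ)) z = α₁ at *
  generalize dz (fun w => (meanCurvature f w : ℂ)) z = H₁ at *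
  generalize dzbar (hopf f) z = A₂ at *
  generalize Complex.exp (-(confExp f z : ℂ)) = E at *
  generalize hopf f z = A at *
  generalize dz (fun w => ψ w 0) z = p at *
  generalize dzbar (fun w => ψ w 0) z = q at *
  generalize dz (fun w => ψ w 1) z = r at *
  generalize dzbar (fun w => ψ w 1) z = s at *
  have hp' := congrArg (starRingEnd ℂ) hp
  have hq' := congrArg (starRingEnd ℂ) hq
  have hr' := congrArg (starRingEnd ℂ) hr
  have hs' := congrArg (starRingEnd ℂ) hs
  simp only [map_add, map_sub, map_mul, map_neg, map_div₀, map_pow, map_one, map_ofNat,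
    Complex.conj_conj, Complex.conj_I, Complex.conj_ofReal, cE] at hp' hq' hr' hs'
  obtain ⟨G1, G2⟩ := gauss_codazzi_algebra (H := meanCurvature f z) (H₁ := H₁)
    (H₁' := (starRingEnd ℂ) H₁) (α₁₂ := α₁₂) (A₂ := A₂) (A₂' := (starRingEnd ℂ) A₂)
    hp (hp'.trans (by ring)) hs (hs'.trans (by ring)) hq (hq'.trans (by ring)) hr
    (hr'.trans (by ring)) (by linear_combination E1) (by linear_combination E2)
  refine eq_zero_of_quaternionic G1 G2 h0 ?_ ?_
  · simp only [map_add, map_sub, map_mul, map_div₀, map_pow, map_ofNat, Complex.conj_conj,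
      Complex.conj_ofReal, cE, cα₁₂]
    ring
  · simp only [map_add, map_sub, map_mul, map_div₀, map_ofNat, Complex.conj_conj, cE]
    ring

/-- The Dirac equation gives ∂̄Z₃ = (1/2)(H - i) e^α (|ψ₂|² - |ψ₁|²). Dividing by H - i turns the
term (5/2) Z₃ (|ψ₂|² - |ψ₁|²) of the raw Codazzi equation into part of a ∂̄-derivative, which
explains the correction of A. -/
lemma IsGeneratingSpinor.codazzi (hD : IsOpen D) (hf : IsConformalImmersion D f)
    (h : IsGeneratingSpinor D f ψ) : CodazziEquations D (confExp f) (meanCurvature f) (hopf f)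
      (fun z => ψ z 0 * (starRingEnd ℂ) (ψ z 1)) := by
  intro z hz
  obtain ⟨G, C⟩ := h.gauss_codazzi hD hf hz
  have h0 := normSq_add_ne_zero (h.ne_zero hf hz)
  have hE := h.cexp_confExp hf hz
  have e1 : (Real.exp (-2 * confExp f z) : ℂ) = Complex.exp (-(confExp f z : ℂ)) ^ 2 := by
    rw [← Complex.exp_nat_mul]; push_cast; ring_nf
  have e2 : (Real.exp (2 * confExp f z) : ℂ) = Complex.exp (confExp f z : ℂ) ^ 2 := by
    rw [← Complex.exp_nat_mul]; push_cast; ring_nf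
  have e3 : Complex.exp (-(confExp f z : ℂ)) * Complex.exp (confExp f z : ℂ) = 1 := by
    rw [← Complex.exp_add]; simp
  rw [e1, e2, hE]
  rw [hE] at e3
  simp only [← Complex.mul_conj', map_mul, Complex.conj_conj]
  refine ⟨by linear_combination G, ?_⟩
  have ha := (h.contDiffAt hD hz 0).differentiableAt_infty.hasDz
  have hb := (h.contDiffAt hD hz 1).differentiableAt_infty.hasDz
  have hA := (contDiffAt_hopf hD hf hz).differentiableAt_infty.hasDz
  have hH := (contDiffAt_ofReal (contDiffAt_meanCurvature hD hf hz)).differentiableAt_infty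
  -- H is real, so the denominator H - i never vanishes.
  have hI : ∀ x : ℝ, (x : ℂ) - Complex.I ≠ 0 := fun x e => by
    simpa using congrArg Complex.im e
  have hK : DifferentiableAt ℝ (fun w => 5 / (2 * ((meanCurvature f w : ℂ) - Complex.I))) z :=
    ((((hH.hasDz.sub (hasDz_const Complex.I z)).inv (hI _)).const_mul (5 / 2)).congr_of_eventuallyEq
      (.of_forall fun w => by have := hI (meanCurvature f w); field_simp)).1
  have key := hA.add (hK.hasDz.mul (ha.mul hb.conj).pow_two)
  have key' := (key.congr_of_eventuallyEq (g := fun w => hopf f w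
    + 5 * (ψ w 0 * (starRingEnd ℂ) (ψ w 1)) ^ 2 / (2 * ((meanCurvature f w : ℂ) - Complex.I)))
    (.of_forall fun w => by ring)).2.2
  rw [key']
  obtain ⟨d0, d1⟩ := (diracEquation_iff _).1 (h.dirac hD hf) z hz
  rw [d0, d1]
  have hI' := hI (meanCurvature f z)
  simp only [map_add, map_sub, map_mul, map_neg, map_div₀, map_one, map_ofNat,
    Complex.conj_conj, Complex.conj_I, Complex.conj_ofReal]
  have hKe : 5 / (2 * ((meanCurvature f z : ℂ) - Complex.I)) * ((meanCurvature f z : ℂ) - Complex.I)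
    = 5 / 2 := by field_simp
  linear_combination (ψ z 0 * (starRingEnd ℂ) (ψ z 0) + ψ z 1 * (starRingEnd ℂ) (ψ z 1)) * C
    - dzbar (hopf f) z * e3
    + (ψ z 0 * (starRingEnd ℂ) (ψ z 1)) * (ψ z 0 * (starRingEnd ℂ) (ψ z 0)
      + ψ z 1 * (starRingEnd ℂ) (ψ z 1)) * (ψ z 1 * (starRingEnd ℂ) (ψ z 1)
      - ψ z 0 * (starRingEnd ℂ) (ψ z 0)) * hKe

end

/-! ### Gluing, and the generating spinor of a surface -/

lemma eq_of_locally_constant {Y : Type*} {D : Set ℂ} (hD : IsPreconnected D) {g : ℂ → Y}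
    (hg : ∀ z ∈ D, ∀ᶠ w in 𝓝 z, g w = g z) {z w : ℂ} (hz : z ∈ D) (hw : w ∈ D) : g z = g w := by
  let _ : TopologicalSpace Y := ⊥
  have : DiscreteTopology Y := ⟨rfl⟩
  exact hD.constant (fun x hx => (tendsto_nhds_of_eventually_eq (hg x hx)).mono_left
    nhdsWithin_le_nhds) hz hw

/-- Local sections that differ by locally constant elements of a group glue to a global section
over a simply connected domain. -/
theorem exists_global_section {D : Set ℂ} (hD : IsOpen D) (hsc : IsSimplyConnected D)
    {Γ Y ι : Type*} [Group Γ] [MulAction Γ Y] (W : ι → Set ℂ) (hW : ∀ i, IsOpen (W i))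
    (hcov : ∀ z ∈ D, ∃ i, z ∈ W i) (s : ι → ℂ → Y) (c : ι → ι → ℂ → Γ)
    (hs : ∀ i j, ∀ z ∈ D, z ∈ W i → z ∈ W j → c i j z • s j z = s i z)
    (hfree : ∀ i, ∀ z ∈ D, z ∈ W i → ∀ γ γ' : Γ, γ • s i z = γ' • s i z → γ = γ')
    (hc : ∀ i j, ∀ z ∈ D, z ∈ W i → z ∈ W j → ∀ᶠ w in 𝓝 z, c i j w = c i j z) :
    ∃ F : ℂ → Y, ∀ z ∈ D, ∃ i, ∃ γ : Γ, z ∈ W i ∧ ∀ᶠ w in 𝓝 z, F w = γ • s i w := by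
  classical
  have := hsc.simplyConnectedSpace
  have := hD.locallyPathConnectedSpace
  obtain ⟨h, hh, hcob⟩ := exists_coboundary_of_cocycle (X := D) (Γ := Γ)
    (fun i => {x : D | (x : ℂ) ∈ W i})
    (fun i => (hW i).preimage continuous_subtype_val) (fun x => hcov x x.2)
    (fun i j x => c i j x)
    (fun i j x hx => continuous_subtype_val.continuousAt.eventually (hc i j x x.2 hx.1 hx.2))
    -- Both sides of the cocycle identity carry `s k x` to `s i x`; freeness makes them equal.
    (fun i j k x hi hj hk => hfree k x x.2 hk _ _ (by
      rw [mul_smul, hs j k x x.2 hj hk, hs i j x x.2 hi hj, hs i k x x.2 hi hk]))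
  have : Nonempty ι := ⟨(hcov _ hsc.nonempty.some_mem).choose⟩
  choose! ind hind using hcov
  have hglue : ∀ i j (x : D), (x : ℂ) ∈ W i → (x : ℂ) ∈ W j →
      h i x • s i x = h j x • s j x := fun i j x hi hj => by
    rw [← hcob i j x hi hj, mul_smul, hs i j x x.2 hi hj]
  -- Corrected by the coboundary, the local sections agree on overlaps, so the chart chosen at each
  -- point does not matter. Outside D the value is arbitrary.
  refine ⟨fun z => if hz : z ∈ D then h (ind z) ⟨z, hz⟩ • s (ind z) z else s (ind z) z,
    fun z hz => ⟨ind z, h (ind z) ⟨z, hz⟩, hind z hz, ?_⟩⟩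
  have h1 := hh (ind z) ⟨z, hz⟩ (hind z hz)
  rw [nhds_subtype_eq_comap, eventually_comap] at h1
  filter_upwards [h1, hD.eventually_mem hz, (hW (ind z)).eventually_mem (hind z hz)] with w hw hwD hwW
  rw [dif_pos hwD, hglue (ind w) (ind z) ⟨w, hwD⟩ (hind w hwD) hwW, hw ⟨w, hwD⟩ rfl]

lemma contDiffAt_div {a b : ℂ → ℂ} {z : ℂ} (ha : ContDiffAt ℝ ∞ a z) (hb : ContDiffAt ℝ ∞ b z)
    (h0 : b z ≠ 0) : ContDiffAt ℝ ∞ (fun w => a w / b w) z := by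
  simp only [div_eq_mul_inv]
  exact ha.mul (hb.inv h0)

/-- Dividing by P z moves the values near z close to 1, away from the branch cut of the logarithm; a
fixed root c of P z restores the factor. -/
lemma exists_smooth_sqrt {P : ℂ → ℂ} {z : ℂ} (hP : ∀ᶠ w in 𝓝 z, ContDiffAt ℝ ∞ P w)
    (h0 : P z ≠ 0) :
    ∃ a : ℂ → ℂ, ∀ᶠ w in 𝓝 z, ContDiffAt ℝ ∞ a w ∧ a w ^ 2 = P w ∧ a w ≠ 0 := by
  obtain ⟨c, hc⟩ : ∃ c, P z = c ^ 2 :=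
    ⟨P z ^ (((2 : ℕ) : ℂ)⁻¹), (Complex.cpow_nat_inv_pow (P z) two_ne_zero).symm⟩
  have hc0 : c ≠ 0 := fun h => h0 (by rw [hc, h]; simp)
  refine ⟨fun w => c * Complex.exp (Complex.log (P w / P z) / 2), ?_⟩
  have hcont : ContinuousAt (fun w => P w / P z) z :=
    hP.self_of_nhds.continuousAt.div_const _
  have hslit : ∀ᶠ w in 𝓝 z, P w / P z ∈ Complex.slitPlane := by
    refine hcont.eventually_mem (Complex.isOpen_slitPlane.mem_nhds ?_)
    rw [div_self h0]
    exact Complex.one_mem_slitPlane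
  filter_upwards [hP, hslit] with w hw hs
  refine ⟨?_, ?_, by simp [hc0]⟩
  · have h1 : ContDiffAt ℝ ∞ (fun w => Complex.log (P w / P z)) w :=
      ContDiffAt.comp (g := Complex.log) w ((Complex.contDiffAt_log hs).restrict_scalars ℝ)
        (hw.div_const _)
    exact contDiffAt_const.mul (h1.div_const 2).cexp
  · rw [mul_pow, ← Complex.exp_nat_mul]
    have e : ((2 : ℕ) : ℂ) * (Complex.log (P w / P z) / 2) = Complex.log (P w / P z) := by
      push_cast; ring
    rw [e, Complex.exp_log (Complex.slitPlane_ne_zero hs), ← hc]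
    field_simp

/-- Up to constant factors, the real and imaginary parts of Σ Z_k² are |f_x|² - |f_y|² and ⟨f_x,
f_y⟩. -/
lemma IsConformalImmersion.null {D : Set ℂ} {f : ℂ → SL2Tilde} (h : IsConformalImmersion D f)
    {z : ℂ} (hz : z ∈ D) :
    zComp f z 0 ^ 2 + zComp f z 1 ^ 2 + zComp f z 2 ^ 2 = 0 ∧ zComp f z ≠ 0 := by
  obtain ⟨h1, h2, h3⟩ := h.2 z hz
  constructor
  · simp only [firstForm, dotProduct, Fin.sum_univ_three, leftForm_one, leftForm_I] at h2 h3
    apply Complex.ext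
    · simp [pow_two]; linarith
    · simp [pow_two]; linarith
  · intro h0
    simp [firstForm, dotProduct, leftForm_one, h0] at h1

lemma spinorRel_of_sq {Z : Fin 3 → ℂ} {a b : ℂ} (ha : a ^ 2 = -Complex.I * Z 0 - Z 1)
    (hb : (starRingEnd ℂ) b ^ 2 = -Complex.I * Z 0 + Z 1) (hab : a * (starRingEnd ℂ) b = Z 2) :
    SpinorRel Z a b := by
  refine ⟨?_, ?_, hab.symm⟩
  · linear_combination (-Complex.I / 2) * ha - Complex.I / 2 * hb + Z 0 * Complex.I_sq
  · linear_combination (1 / 2) * ha - 1 / 2 * hb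

lemma SpinorRel.sq {Z : Fin 3 → ℂ} {a b : ℂ} (h : SpinorRel Z a b) :
    a ^ 2 = -Complex.I * Z 0 - Z 1 ∧ (starRingEnd ℂ) b ^ 2 = -Complex.I * Z 0 + Z 1 := by
  obtain ⟨h0, h1, -⟩ := h
  rw [h0, h1]
  constructor <;> linear_combination
    ((starRingEnd ℂ) b ^ 2 + a ^ 2) / 2 * Complex.I_sq

/-- One of -iZ₁ ∓ Z₂ is nonzero at z, since nullity would otherwise force Z = 0. Its smooth root is
one component, and dividing Z₃ by it gives the other (up to conjugation); the square of the quotient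
is right because the two expressions have product Z₃². -/
lemma exists_local_spinor {D : Set ℂ} (hD : IsOpen D) {f : ℂ → SL2Tilde}
    (hf : IsConformalImmersion D f) {z : ℂ} (hz : z ∈ D) :
    ∃ ψ : ℂ → Fin 2 → ℂ, ∀ᶠ w in 𝓝 z, ContDiffAt ℝ ∞ ψ w ∧
      SpinorRel (zComp f w) (ψ w 0) (ψ w 1) := by
  have hsm : ∀ᶠ w in 𝓝 z, ∀ k, ContDiffAt ℝ ∞ (fun w => zComp f w k) w :=
    (hD.eventually_mem hz).mono fun w hw => (hf.smoothAt hD hw).contDiffAt_zComp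
  have hnull : ∀ᶠ w in 𝓝 z, zComp f w 0 ^ 2 + zComp f w 1 ^ 2 + zComp f w 2 ^ 2 = 0 :=
    (hD.eventually_mem hz).mono fun w hw => (hf.null hw).1
  by_cases hP : -Complex.I * zComp f z 0 - zComp f z 1 = 0
  · have hQ : -Complex.I * zComp f z 0 + zComp f z 1 ≠ 0 := by
      intro hQ
      obtain ⟨h1, h2⟩ := hf.null hz
      have e1 : zComp f z 1 = 0 := by linear_combination (hQ - hP) / 2
      have e0 : zComp f z 0 = 0 := by
        have : Complex.I * zComp f z 0 = 0 := by linear_combination -(hQ + hP) / 2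
        simpa using this
      rw [e0, e1] at h1
      have e2 : zComp f z 2 = 0 := by simpa using h1
      apply h2
      funext k
      fin_cases k
      exacts [e0, e1, e2]
    obtain ⟨b, hb⟩ := exists_smooth_sqrt (hsm.mono fun w hw =>
      (contDiffAt_const.mul (hw 0)).add (hw 1)) hQ
    refine ⟨fun w => ![zComp f w 2 / b w, (starRingEnd ℂ) (b w)], ?_⟩
    filter_upwards [hb, hsm, hnull] with w hw hs hn
    refine ⟨contDiffAt_pi.2 (Fin.forall_fin_two.2 ⟨contDiffAt_div (hs 2) hw.1 hw.2.2, contDiffAt_conj hw.1⟩),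
      spinorRel_of_sq ?_ ?_ ?_⟩
    · simp only [Matrix.cons_val_zero, div_pow]
      rw [div_eq_iff (pow_ne_zero 2 hw.2.2), hw.2.1]
      linear_combination hn - zComp f w 0 ^ 2 * Complex.I_sq
    · simpa using hw.2.1
    · simp [hw.2.2]
  · obtain ⟨a, ha⟩ := exists_smooth_sqrt (hsm.mono fun w hw =>
      (contDiffAt_const.mul (hw 0)).sub (hw 1)) hP
    refine ⟨fun w => ![a w, (starRingEnd ℂ) (zComp f w 2 / a w)], ?_⟩
    filter_upwards [ha, hsm, hnull] with w hw hs hn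
    refine ⟨contDiffAt_pi.2 (Fin.forall_fin_two.2
      ⟨hw.1, contDiffAt_conj (contDiffAt_div (hs 2) hw.1 hw.2.2)⟩), spinorRel_of_sq ?_ ?_ ?_⟩
    · simpa using hw.2.1
    · simp only [Matrix.cons_val_one, Matrix.cons_val_fin_one, Complex.conj_conj, div_pow]
      rw [div_eq_iff (pow_ne_zero 2 hw.2.2), hw.2.1]
      linear_combination hn - zComp f w 0 ^ 2 * Complex.I_sq
    · have := hw.2.2
      simp only [Matrix.cons_val_zero, Matrix.cons_val_one, Matrix.cons_val_fin_one,
        Complex.conj_conj]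
      field_simp

/-- Z determines the squares of both components, leaving one sign for each. The product Z₃ ties the
signs together, and if a component vanishes its sign is immaterial. -/
lemma SpinorRel.eq_or_eq_neg {Z : Fin 3 → ℂ} {v v' : Fin 2 → ℂ} (h : SpinorRel Z (v 0) (v 1))
    (h' : SpinorRel Z (v' 0) (v' 1)) : v = v' ∨ v = -v' := by
  have e1 := h.sq.1.trans h'.sq.1.symm
  have e2 := h.sq.2.trans h'.sq.2.symm
  have e3 := h.2.2.symm.trans h'.2.2
  rw [← map_pow, ← map_pow] at e2
  have e2 := (starRingEnd ℂ).injective e2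
  rcases sq_eq_sq_iff_eq_or_eq_neg.1 e1 with a | a
  · rcases eq_or_ne (v' 0) 0 with z | z
    · rcases sq_eq_sq_iff_eq_or_eq_neg.1 e2 with b | b
      · exact .inl (funext (Fin.forall_fin_two.2 ⟨a, b⟩))
      · exact .inr (funext (Fin.forall_fin_two.2 ⟨by simp [a, z], b⟩))
    · rw [a] at e3
      exact .inl (funext (Fin.forall_fin_two.2
        ⟨a, (starRingEnd ℂ).injective (mul_left_cancel₀ z e3)⟩))
  · rcases eq_or_ne (v' 0) 0 with z | z
    · rcases sq_eq_sq_iff_eq_or_eq_neg.1 e2 with b | b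
      · exact .inl (funext (Fin.forall_fin_two.2 ⟨by simp [a, z], b⟩))
      · exact .inr (funext (Fin.forall_fin_two.2 ⟨a, b⟩))
    · rw [a, neg_mul, ← mul_neg, ← map_neg] at e3
      refine .inr (funext (Fin.forall_fin_two.2 ⟨a, ?_⟩))
      have := (starRingEnd ℂ).injective (mul_left_cancel₀ z e3)
      rw [Pi.neg_apply, ← this, neg_neg]

open Classical in
/-- The sign by which two vectors that agree up to sign differ. -/
def relSign (v v' : Fin 2 → ℂ) : ℤˣ := if v = v' then 1 else -1

lemma relSign_smul {v v' : Fin 2 → ℂ} (h : v = v' ∨ v = -v') : relSign v v' • v' = v := by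
  rw [relSign]
  split_ifs with e
  · rw [one_smul, e]
  · rw [h.resolve_left e, Units.smul_def]; simp

/-- Both signs are open conditions: where ψ = ψ' the sum is nonzero, which excludes ψ = -ψ' nearby,
and ψ ≠ ψ' is open by continuity. -/
lemma relSign_eventually {ψ ψ' : ℂ → Fin 2 → ℂ} {z : ℂ} (h : ContinuousAt ψ z)
    (h' : ContinuousAt ψ' z) (h0 : ψ z ≠ 0) (e : ∀ᶠ w in 𝓝 z, ψ w = ψ' w ∨ ψ w = -ψ' w) :
    ∀ᶠ w in 𝓝 z, relSign (ψ w) (ψ' w) = relSign (ψ z) (ψ' z) := by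
  by_cases hz : ψ z = ψ' z
  · have hne : ψ z + ψ' z ≠ 0 := by
      rw [← hz, ← two_smul ℂ]
      exact smul_ne_zero two_ne_zero h0
    filter_upwards [(h.add h').eventually_ne hne, e] with w hw he
    have : ψ w = ψ' w := he.resolve_right fun hn => hw (by simp [hn])
    rw [relSign, relSign, if_pos this, if_pos hz]
  · filter_upwards [(h.sub h').eventually_ne (sub_ne_zero.2 hz)] with w hw
    have : ψ w ≠ ψ' w := sub_ne_zero.1 hw
    rw [relSign, relSign, if_neg this, if_neg hz]

lemma SpinorRel.ne_zero {Z : Fin 3 → ℂ} (hZ : Z ≠ 0) {v : Fin 2 → ℂ}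
    (h : SpinorRel Z (v 0) (v 1)) : v ≠ 0 := by
  rintro rfl
  obtain ⟨h0, h1, h2⟩ := h
  apply hZ
  funext k
  fin_cases k
  · simpa using h0
  · simpa using h1
  · simpa using h2

/-- The gluing theorem with Γ = {±1}. It acts freely on the values of the local spinors because they
do not vanish. -/
theorem exists_isGeneratingSpinor {D : Set ℂ} (hD : IsOpen D) (hsc : IsSimplyConnected D)
    {f : ℂ → SL2Tilde} (hf : IsConformalImmersion D f) :
    ∃ ψ : ℂ → Fin 2 → ℂ, IsGeneratingSpinor D f ψ := by
  have hloc : ∀ i : D, ∃ ψ : ℂ → Fin 2 → ℂ, ∃ W : Set ℂ, IsOpen W ∧ (i : ℂ) ∈ W ∧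
      ∀ w ∈ W, ContDiffAt ℝ ∞ ψ w ∧ SpinorRel (zComp f w) (ψ w 0) (ψ w 1) := fun i => by
    obtain ⟨ψ, hψ⟩ := exists_local_spinor hD hf i.2
    obtain ⟨W, h1, h2, h3⟩ := eventually_nhds_iff.1 hψ
    exact ⟨ψ, W, h2, h3, h1⟩
  choose s W hWo hWm hs using hloc
  obtain ⟨F, hF⟩ := exists_global_section hD hsc W hWo (fun z hz => ⟨⟨z, hz⟩, hWm ⟨z, hz⟩⟩) s
    (fun i j w => relSign (s i w) (s j w))
    (fun i j z _ hi hj => relSign_smul ((hs i z hi).2.eq_or_eq_neg (hs j z hj).2))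
    (fun i z hz hi γ γ' e => by
      have h0 := (hs i z hi).2.ne_zero (hf.null hz).2
      have h2 : s i z ≠ -s i z := fun e => h0 (self_eq_neg.1 e)
      rcases Int.units_eq_one_or γ with rfl | rfl <;> rcases Int.units_eq_one_or γ' with rfl | rfl
      · rfl
      · exact absurd (by simpa [Units.smul_def] using e) h2
      · exact absurd (by simpa [Units.smul_def] using e.symm) h2
      · rfl)
    (fun i j z hz hi hj => relSign_eventually (hs i z hi).1.continuousAt
      (hs j z hj).1.continuousAt ((hs i z hi).2.ne_zero (hf.null hz).2) (by
        filter_upwards [(hWo i).eventually_mem hi, (hWo j).eventually_mem hj] with w hi hj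
        exact (hs i w hi).2.eq_or_eq_neg (hs j w hj).2))
  refine ⟨F, fun z hz => ContDiffAt.contDiffWithinAt ?_, fun z hz => ?_⟩
  · obtain ⟨i, γ, hi, e⟩ := hF z hz
    refine ContDiffAt.congr_of_eventuallyEq ?_ e
    rcases Int.units_eq_one_or γ with rfl | rfl
    · simpa using (hs i z hi).1
    · simpa [Units.smul_def] using! (hs i z hi).1.neg
  · obtain ⟨i, γ, hi, e⟩ := hF z hz
    have := (hs i z hi).2
    rw [e.self_of_nhds]
    rcases Int.units_eq_one_or γ with rfl | rfl
    · simpa [SpinorRel] using this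
    · simpa [Units.smul_def, SpinorRel] using this

theorem IsGeneratingSpinor.eqOn_or_eqOn_neg {D : Set ℂ} (hD : IsOpen D) (hc : IsPreconnected D)
    {f : ℂ → SL2Tilde} (hf : IsConformalImmersion D f) {ψ ψ' : ℂ → Fin 2 → ℂ}
    (h : IsGeneratingSpinor D f ψ) (h' : IsGeneratingSpinor D f ψ') :
    Set.EqOn ψ' ψ D ∨ Set.EqOn ψ' (fun z => -ψ z) D := by
  have hpm : ∀ z ∈ D, ψ' z = ψ z ∨ ψ' z = -ψ z := fun z hz =>
    SpinorRel.eq_or_eq_neg (h'.2 z hz) (h.2 z hz)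
  have hconst := fun z (hz : z ∈ D) w (hw : w ∈ D) =>
    eq_of_locally_constant hc (g := fun w => relSign (ψ' w) (ψ w)) (fun z hz =>
      relSign_eventually (h'.1.contDiffAt (hD.mem_nhds hz)).continuousAt
        (h.1.contDiffAt (hD.mem_nhds hz)).continuousAt (h'.ne_zero hf hz)
        ((hD.eventually_mem hz).mono hpm)) hz hw
  rcases D.eq_empty_or_nonempty with rfl | ⟨p, hp⟩
  · exact .inl fun z hz => hz.elim
  have key : ∀ z ∈ D, ψ' z = relSign (ψ' p) (ψ p) • ψ z := fun z hz => by
    rw [← hconst z hz p hp, relSign_smul (hpm z hz)]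
  rcases Int.units_eq_one_or (relSign (ψ' p) (ψ p)) with e | e
  · exact .inl fun z hz => by rw [key z hz, e, one_smul]
  · exact .inr fun z hz => by rw [key z hz, e, Units.smul_def]; simp

/-! ### Maps with a prescribed logarithmic derivative -/

lemma smoothAt_iff_contMDiffAt {f : ℂ → SL2Tilde} {z : ℂ} :
    SmoothAt f z ↔ ContMDiffAt 𝓘(ℝ, ℂ) 𝓘(ℝ, ℂ × ℝ) ∞ f z := by
  have h1 : ContMDiffAt 𝓘(ℝ, ℂ) 𝓘(ℝ, ℂ × ℝ) ∞ f z ↔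
      ContDiffAt ℝ ∞ (fun w => (((f w).entryB, (f w).angle) : ℂ × ℝ)) z :=
    contMDiffAt_iff_contDiffAt (f := fun w => (((f w).entryB, (f w).angle) : ℂ × ℝ))
  rw [h1]
  exact ⟨fun h => h.1.prodMk h.2, fun h =>
    ⟨contDiff_fst.contDiffAt.comp z h, contDiff_snd.contDiffAt.comp z h⟩⟩

lemma SmoothAt.mul {f g : ℂ → SL2Tilde} {z : ℂ} (hf : SmoothAt f z) (hg : SmoothAt g z) :
    SmoothAt (fun w => f w * g w) z :=
  smoothAt_iff_contMDiffAt.2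
    ((smoothAt_iff_contMDiffAt.1 hf).mul (smoothAt_iff_contMDiffAt.1 hg))

lemma SmoothAt.inv {f : ℂ → SL2Tilde} {z : ℂ} (hf : SmoothAt f z) :
    SmoothAt (fun w => (f w)⁻¹) z :=
  smoothAt_iff_contMDiffAt.2 (smoothAt_iff_contMDiffAt.1 hf).inv

lemma SmoothAt.mul_left (γ : SL2Tilde) {f : ℂ → SL2Tilde} {z : ℂ} (hf : SmoothAt f z) :
    SmoothAt (fun w => γ * f w) z :=
  SmoothAt.mul (f := fun _ => γ) ⟨contDiffAt_const, contDiffAt_const⟩ hf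

lemma SmoothAt.congr_of_eventuallyEq {f g : ℂ → SL2Tilde} {z : ℂ} (hf : SmoothAt f z)
    (e : g =ᶠ[𝓝 z] f) : SmoothAt g z :=
  ⟨hf.1.congr_of_eventuallyEq (e.mono fun _ hw => congrArg SL2Tilde.entryB hw),
    hf.2.congr_of_eventuallyEq (e.mono fun _ hw => congrArg SL2Tilde.angle hw)⟩

lemma RowEquation.congr_of_eventuallyEq {f g : ℂ → SL2Tilde} {Z : Fin 3 → ℂ} {z : ℂ}
    (hf : RowEquation f Z z) (e : g =ᶠ[𝓝 z] f) : RowEquation g Z z := by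
  refine ⟨HasDz.congr_of_eventuallyEq ?_ (e.mono fun _ hw => congrArg SL2Tilde.entryA hw),
    HasDz.congr_of_eventuallyEq ?_ (e.mono fun _ hw => congrArg SL2Tilde.entryB hw)⟩ <;>
    rw [e.self_of_nhds]
  exacts [hf.1, hf.2]

/-- The equation `df = f · Ψ` is left invariant. -/
lemma RowEquation.mul_left (γ : SL2Tilde) {f : ℂ → SL2Tilde} {Z : Fin 3 → ℂ} {z : ℂ}
    (h : RowEquation f Z z) : RowEquation (fun w => γ * f w) Z z := by
  simp only [RowEquation, SL2Tilde.mul_entryA, SL2Tilde.mul_entryB]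
  refine ⟨((h.1.const_mul γ.entryA).add (h.2.conj.const_mul γ.entryB)).congr_val ?_ ?_,
    ((h.2.const_mul γ.entryA).add (h.1.conj.const_mul γ.entryB)).congr_val ?_ ?_⟩ <;>
    simp only [map_add, map_sub, map_mul, map_div₀, map_ofNat, map_neg, Complex.conj_conj,
      Complex.conj_I] <;>
    ring

lemma HasDz.fderiv_apply {h : ℂ → ℂ} {p q z : ℂ} (hh : HasDz h p q z) (v : ℂ) :
    fderiv ℝ h z v = p * v + q * (starRingEnd ℂ) v := by
  have e : v = v.re • (1 : ℂ) + v.im • Complex.I := by simp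
  obtain ⟨-, rfl, rfl⟩ := hh
  conv_lhs => rw [e, map_add, map_smul, map_smul, fderiv_one_eq, fderiv_I_eq]
  apply Complex.ext <;> simp <;> ring

lemma _root_.HasFDerivAt.hasDz {h : ℂ → ℂ} {z p q : ℂ} {L : ℂ →L[ℝ] ℂ} (hL : HasFDerivAt h L z)
    (e : ∀ v, L v = p * v + q * (starRingEnd ℂ) v) : HasDz h p q z := by
  have hI := Complex.I_sq
  refine ⟨hL.differentiableAt, ?_, ?_⟩
  · rw [dz, hL.fderiv, e, e, map_one, Complex.conj_I]
    linear_combination (-p + q) / 2 * hI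
  · rw [dzbar, hL.fderiv, e, e, map_one, Complex.conj_I]
    linear_combination (p - q) / 2 * hI

lemma eventually_eq_of_hasDz_zero {h : ℂ → ℂ} {z : ℂ} (hh : ∀ᶠ w in 𝓝 z, HasDz h 0 0 w) :
    ∀ᶠ w in 𝓝 z, h w = h z := by
  obtain ⟨ε, hε, hb⟩ := Metric.eventually_nhds_iff_ball.1 hh
  filter_upwards [Metric.ball_mem_nhds z hε] with w hw
  refine Metric.isOpen_ball.is_const_of_fderiv_eq_zero (𝕜 := ℝ)
    (convex_ball z ε).isPreconnected (fun x hx => (hb x hx).1.differentiableWithinAt)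
    (fun x hx => ?_) hw (Metric.mem_ball_self hε)
  ext v
  simp [(hb x hx).fderiv_apply]

/-- The matrix entries determine the angle up to a multiple of 2π, and a difference below 1 excludes
all multiples but 0. -/
lemma ext_of_abs_angle_sub_lt {p q : SL2Tilde} (hA : p.entryA = q.entryA)
    (hB : p.entryB = q.entryB) (ht : |p.angle - q.angle| < 1) : p = q := by
  have he : Complex.exp (p.angle * Complex.I) = Complex.exp (q.angle * Complex.I) := by
    rw [SL2Tilde.exp_angle, SL2Tilde.exp_angle, hA]
  obtain ⟨n, hn⟩ := Complex.exp_eq_exp_iff_exists_int.1 he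
  have hn' : p.angle = q.angle + n * (2 * Real.pi) := by
    simpa using congrArg Complex.im hn
  have hpi := Real.pi_gt_three
  rw [hn', add_sub_cancel_left, abs_mul, abs_of_pos (by linarith : 0 < 2 * Real.pi)] at ht
  have h1 : |(n : ℝ)| < 1 := by nlinarith [abs_nonneg (n : ℝ)]
  have h2 : n = 0 := Int.abs_lt_one_iff.1 (by exact_mod_cast h1)
  rw [h2] at hn'
  exact SL2Tilde.ext hB (by simpa using hn')

/-- Two maps with the same logarithmic derivative differ locally by a constant. -/
lemma eventually_mul_inv_eq {f g : ℂ → SL2Tilde} {Z : ℂ → Fin 3 → ℂ} {z : ℂ}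
    (hf : SmoothAt f z) (hg : SmoothAt g z) (hfZ : ∀ᶠ w in 𝓝 z, RowEquation f (Z w) w)
    (hgZ : ∀ᶠ w in 𝓝 z, RowEquation g (Z w) w) :
    ∀ᶠ w in 𝓝 z, f w * (g w)⁻¹ = f z * (g z)⁻¹ := by
  have hA : ∀ᶠ w in 𝓝 z, HasDz (fun w => (f w * (g w)⁻¹).entryA) 0 0 w := by
    filter_upwards [hfZ, hgZ] with w h1 h2
    simp only [SL2Tilde.mul_entryA, SL2Tilde.inv_entryA, SL2Tilde.inv_entryB]
    refine ((h1.1.mul h2.1.conj).add (h1.2.mul h2.2.neg.conj)).congr_val ?_ ?_ <;>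
    simp only [map_add, map_sub, map_mul, map_div₀, map_ofNat, map_neg, Complex.conj_conj,
      Complex.conj_I] <;> ring
  have hB : ∀ᶠ w in 𝓝 z, HasDz (fun w => (f w * (g w)⁻¹).entryB) 0 0 w := by
    filter_upwards [hfZ, hgZ] with w h1 h2
    simp only [SL2Tilde.mul_entryB, SL2Tilde.inv_entryA, SL2Tilde.inv_entryB, Complex.conj_conj]
    refine ((h1.1.mul h2.2.neg).add (h1.2.mul h2.1)).congr_val ?_ ?_ <;> ring
  -- The entries of f g⁻¹ have derivative zero, which fixes only the matrix. Continuity of the angle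
  -- prevents a jump to another sheet of the covering.
  have ht := (hf.mul hg.inv).2.continuousAt
  filter_upwards [eventually_eq_of_hasDz_zero hA, eventually_eq_of_hasDz_zero hB,
    Metric.continuousAt_iff'.1 ht 1 one_pos] with w h1 h2 h3
  exact ext_of_abs_angle_sub_lt h1 h2 h3

section
set_option maxSynthPendingDepth 3

/-- The form `v ↦ (α v + conj (β v)) • L` with values in the endomorphisms, as a real linear
function of `(α, β)`. -/
def formCLM (L : (ℂ × ℂ) →L[ℝ] (ℂ × ℂ)) :
    (ℂ × ℂ) →L[ℝ] ℂ →L[ℝ] (ℂ × ℂ) →L[ℝ] (ℂ × ℂ) :=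
  (ContinuousLinearMap.compL ℝ ℂ ℂ ((ℂ × ℂ) →L[ℝ] (ℂ × ℂ))
    ((ContinuousLinearMap.lsmul ℝ ℂ).flip L)).comp
    ((ContinuousLinearMap.mul ℝ ℂ).comp (ContinuousLinearMap.fst ℝ ℂ ℂ)
      + (ContinuousLinearMap.compL ℝ ℂ ℂ ℂ (Complex.conjCLE : ℂ →L[ℝ] ℂ)).comp
        ((ContinuousLinearMap.mul ℝ ℂ).comp (ContinuousLinearMap.snd ℝ ℂ ℂ)))

lemma formCLM_apply (L : (ℂ × ℂ) →L[ℝ] (ℂ × ℂ)) (c : ℂ × ℂ) (v : ℂ) (y : ℂ × ℂ) :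
    formCLM L c v y = (c.1 * v + (starRingEnd ℂ) (c.2 * v)) • L y := by
  simp [formCLM, add_smul]

/-- The connection form on the first row of the matrix, for the components `T`, `P`, `M` of a one
form with values in `su(1,1)`. -/
def connectionCLM : (ℂ × ℂ × ℂ) →L[ℝ] ℂ →L[ℝ] (ℂ × ℂ) →L[ℝ] (ℂ × ℂ) :=
  let T := ContinuousLinearMap.fst ℝ ℂ (ℂ × ℂ)
  let P := (ContinuousLinearMap.fst ℝ ℂ ℂ).comp (ContinuousLinearMap.snd ℝ ℂ (ℂ × ℂ))
  let M := (ContinuousLinearMap.snd ℝ ℂ ℂ).comp (ContinuousLinearMap.snd ℝ ℂ (ℂ × ℂ))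
  let A := ContinuousLinearMap.fst ℝ ℂ ℂ
  let B := ContinuousLinearMap.snd ℝ ℂ ℂ
  (formCLM (((Complex.I / 4) • A).prod (-(Complex.I / 4) • B))).comp (T.prod T)
    + (formCLM ((((1 : ℂ) / 2) • B).prod 0)).comp (M.prod P)
    + (formCLM ((0 : (ℂ × ℂ) →L[ℝ] ℂ).prod (((1 : ℂ) / 2) • A))).comp (P.prod M)

lemma connectionCLM_apply (c : ℂ × ℂ × ℂ) (v : ℂ) (y : ℂ × ℂ) :
    connectionCLM c v y =
      ((c.1 * v + (starRingEnd ℂ) (c.1 * v)) * (Complex.I / 4 * y.1)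
        + (c.2.2 * v + (starRingEnd ℂ) (c.2.1 * v)) * (1 / 2 * y.2),
       -(c.1 * v + (starRingEnd ℂ) (c.1 * v)) * (Complex.I / 4 * y.2)
        + (c.2.1 * v + (starRingEnd ℂ) (c.2.2 * v)) * (1 / 2 * y.1)) := by
  simp only [connectionCLM, _root_.add_apply, ContinuousLinearMap.comp_apply,
    formCLM_apply]
  ext <;> simp
  all_goals ring

/-- The solution of the linear system is as smooth as its coefficients. -/
lemma contDiffAt_of_hasFDerivAt {E : Type*} [NormedAddCommGroup E] [NormedSpace ℝ E]
    {Ω : ℂ → ℂ →L[ℝ] E →L[ℝ] E} {y : ℂ → E} {z : ℂ}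
    (hΩ : ∀ᶠ w in 𝓝 z, ContDiffAt ℝ ∞ Ω w)
    (hy : ∀ᶠ w in 𝓝 z, HasFDerivAt y ((Ω w).flip (y w)) w) :
    ∀ᶠ w in 𝓝 z, ContDiffAt ℝ ∞ y w := by
  obtain ⟨U, hU, hUo, hz⟩ := eventually_nhds_iff.1 (hΩ.and hy)
  -- Bootstrap: if y is of class Cⁿ, then so is its derivative Ω y, hence y is of class Cⁿ⁺¹.
  have key : ∀ n : ℕ, ContDiffOn ℝ n y U := fun n => by
    induction n with
    | zero =>
      exact contDiffOn_zero.2 fun w hw => (hU w hw).2.continuousAt.continuousWithinAt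
    | succ n ih =>
      refine (contDiffOn_succ_iff_fderiv_of_isOpen hUo).2
        ⟨fun w hw => (hU w hw).2.differentiableAt.differentiableWithinAt, fun h => absurd h (WithTop.natCast_ne_top n), ?_⟩
      have h1 : ContDiffOn ℝ n Ω U := fun w hw =>
        ((hU w hw).1.of_le (by exact_mod_cast le_top)).contDiffWithinAt
      have h2 : ContDiffOn ℝ n (fun w => (Ω w).flip) U :=
        (ContinuousLinearMap.flipₗᵢ ℝ ℂ E E).contDiff.comp_contDiffOn h1
      exact (h2.clm_apply ih).congr fun w hw => (hU w hw).2.fderiv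
  filter_upwards [hUo.mem_nhds hz] with w hw
  exact (contDiffOn_infty.2 key).contDiffAt (hUo.mem_nhds hw)

/-- Lifts a first row (A, B) of SU(1,1) to the universal cover with the principal argument as angle.
The normalization A z = 1 keeps A near z off the branch cut, so the lift is smooth. -/
lemma exists_rowEquation_of_entries {A B : ℂ → ℂ} {Z : ℂ → Fin 3 → ℂ} {z : ℂ}
    (h0 : A z = 1) (hsm : ∀ᶠ w in 𝓝 z, ContDiffAt ℝ ∞ A w ∧ ContDiffAt ℝ ∞ B w)
    (h1 : ∀ᶠ w in 𝓝 z, A w * (starRingEnd ℂ) (A w) - B w * (starRingEnd ℂ) (B w) = 1)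
    (hA : ∀ᶠ w in 𝓝 z, HasDz A
      (Complex.I / 4 * A w * Z w 2 + B w * (Z w 0 - Complex.I * Z w 1) / 2)
      (Complex.I / 4 * A w * (starRingEnd ℂ) (Z w 2)
        + B w * (starRingEnd ℂ) (Z w 0 + Complex.I * Z w 1) / 2) w)
    (hB : ∀ᶠ w in 𝓝 z, HasDz B
      (A w * (Z w 0 + Complex.I * Z w 1) / 2 - Complex.I / 4 * B w * Z w 2)
      (A w * (starRingEnd ℂ) (Z w 0 - Complex.I * Z w 1) / 2
        - Complex.I / 4 * B w * (starRingEnd ℂ) (Z w 2)) w) :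
    ∃ s : ℂ → SL2Tilde, ∀ᶠ w in 𝓝 z, SmoothAt s w ∧ RowEquation s (Z w) w := by
  let s : ℂ → SL2Tilde := fun w => ((B w, Complex.arg (A w)) : ℂ × ℝ)
  have hsA : ∀ᶠ w in 𝓝 z, (s w).entryA = A w := h1.mono fun w hw => by
    have h2 : 1 + Complex.normSq (B w) = ‖A w‖ ^ 2 := by
      rw [Complex.mul_conj, Complex.mul_conj, ← Complex.ofReal_sub] at hw
      rw [← Complex.normSq_eq_norm_sq]
      have := Complex.ofReal_injective (hw.trans Complex.ofReal_one.symm)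
      linarith
    change ((Real.sqrt (1 + Complex.normSq (B w)) : ℝ) : ℂ)
      * Complex.exp ((Complex.arg (A w) : ℂ) * Complex.I) = A w
    rw [h2, Real.sqrt_sq (norm_nonneg _), Complex.norm_mul_exp_arg_mul_I]
  have hslit : ∀ᶠ w in 𝓝 z, A w ∈ Complex.slitPlane :=
    hsm.self_of_nhds.1.continuousAt.eventually_mem
      (Complex.isOpen_slitPlane.mem_nhds (h0 ▸ Complex.one_mem_slitPlane))
  refine ⟨s, ?_⟩
  filter_upwards [hsm, hslit, hsA.eventually_nhds, hA, hB] with w h1 h2 h3 h4 h5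
  refine ⟨⟨h1.2, ?_⟩, ?_, ?_⟩
  · change ContDiffAt ℝ ∞ (fun w => Complex.arg (A w)) w
    simp only [← Complex.log_im]
    exact contDiffAt_im (ContDiffAt.comp (g := Complex.log) w
      ((Complex.contDiffAt_log h2).restrict_scalars ℝ) h1.1)
  · rw [h3.self_of_nhds]
    exact h4.congr_of_eventuallyEq h3
  · rw [h3.self_of_nhds]
    exact h5

/-- A flat `su(1,1)`-valued one form is locally the logarithmic derivative of a map. -/
theorem exists_local_rowEquation {T P M : ℂ → ℂ} {Z : ℂ → Fin 3 → ℂ} {z : ℂ}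
    (hZ : ∀ w, T w = Z w 2 ∧ P w = Z w 0 + Complex.I * Z w 1 ∧ M w = Z w 0 - Complex.I * Z w 1)
    (hsm : ∀ᶠ w in 𝓝 z, ContDiffAt ℝ ∞ T w ∧ ContDiffAt ℝ ∞ P w ∧ ContDiffAt ℝ ∞ M w)
    (hX : ∀ᶠ w in 𝓝 z, Complex.I * (dzbar T w - (starRingEnd ℂ) (dzbar T w))
      + (M w * (starRingEnd ℂ) (M w) - P w * (starRingEnd ℂ) (P w)) = 0)
    (hY : ∀ᶠ w in 𝓝 z, 2 * (dzbar M w - (starRingEnd ℂ) (dzbar P w))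
      + Complex.I * ((starRingEnd ℂ) (P w) * T w - M w * (starRingEnd ℂ) (T w)) = 0) :
    ∃ s : ℂ → SL2Tilde, ∀ᶠ w in 𝓝 z, SmoothAt s w ∧ RowEquation s (Z w) w := by
  let Ω : ℂ → ℂ →L[ℝ] (ℂ × ℂ) →L[ℝ] (ℂ × ℂ) := fun w => connectionCLM (T w, P w, M w)
  have hΩ : ∀ᶠ w in 𝓝 z, ContDiffAt ℝ ∞ Ω w := hsm.mono fun w hw =>
    connectionCLM.contDiff.contDiffAt.comp w (hw.1.prodMk (hw.2.1.prodMk hw.2.2))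
  have hflat : ∀ᶠ w in 𝓝 z, ∀ u v, fderiv ℝ Ω w u v + (Ω w v).comp (Ω w u)
      = fderiv ℝ Ω w v u + (Ω w u).comp (Ω w v) := by
    filter_upwards [hsm, hX, hY] with w hw hX hY u v
    have dT := hw.1.differentiableAt_infty
    have dP := hw.2.1.differentiableAt_infty
    have dM := hw.2.2.differentiableAt_infty
    have hd : HasFDerivAt Ω (connectionCLM.comp
        ((fderiv ℝ T w).prod ((fderiv ℝ P w).prod (fderiv ℝ M w)))) w :=
      connectionCLM.hasFDerivAt.comp w
        (dT.hasFDerivAt.prodMk (dP.hasFDerivAt.prodMk dM.hasFDerivAt))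
    have hYc := congrArg (starRingEnd ℂ) hY
    have hI := Complex.I_sq
    rw [hd.fderiv]
    refine ContinuousLinearMap.ext fun y => ?_
    simp only [_root_.add_apply, ContinuousLinearMap.comp_apply,
      ContinuousLinearMap.prod_apply, connectionCLM_apply, Ω, dT.hasDz.fderiv_apply,
      dP.hasDz.fderiv_apply, dM.hasDz.fderiv_apply, map_add, map_mul, Complex.conj_conj]
    simp only [map_add, map_sub, map_mul, map_ofNat, map_zero, Complex.conj_conj, Complex.conj_I]
      at hYc
    ext1
    -- The flatness defect is alternating in u and v, hence a multiple of ū v - u v̄. Its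
    -- coefficients are the two structure equations and the conjugate of the second.
    · simp only [Prod.fst_add]
      linear_combination ((starRingEnd ℂ) u * v - u * (starRingEnd ℂ) v)
        * (y.1 / 4 * hX + y.2 / 4 * hY)
    · simp only [Prod.snd_add]
      linear_combination ((starRingEnd ℂ) u * v - u * (starRingEnd ℂ) v)
        * (-y.2 / 4 * hX - y.1 / 4 * hYc)
  -- The initial value (1, 0) is the first row of the identity matrix.
  obtain ⟨y, hy0, hy⟩ := exists_hasFDerivAt_of_flat
    (hΩ.self_of_nhds.of_le (WithTop.coe_le_coe.2 (le_top (a := (2 : ℕ∞))))) hflat ((1 : ℂ), (0 : ℂ))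
  have hys := contDiffAt_of_hasFDerivAt hΩ hy
  have hA : ∀ᶠ w in 𝓝 z, HasDz (fun w => (y w).1)
      (Complex.I / 4 * (y w).1 * T w + (y w).2 * M w / 2)
      (Complex.I / 4 * (y w).1 * (starRingEnd ℂ) (T w)
        + (y w).2 * (starRingEnd ℂ) (P w) / 2) w := hy.mono fun w hw => by
    refine HasFDerivAt.hasDz ((ContinuousLinearMap.fst ℝ ℂ ℂ).hasFDerivAt.comp w hw) fun v => ?_
    simp only [ContinuousLinearMap.comp_apply, ContinuousLinearMap.flip_apply, Ω,
      connectionCLM_apply, ContinuousLinearMap.coe_fst', map_mul]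
    ring
  have hB : ∀ᶠ w in 𝓝 z, HasDz (fun w => (y w).2)
      ((y w).1 * P w / 2 - Complex.I / 4 * (y w).2 * T w)
      ((y w).1 * (starRingEnd ℂ) (M w) / 2
        - Complex.I / 4 * (y w).2 * (starRingEnd ℂ) (T w)) w := hy.mono fun w hw => by
    refine HasFDerivAt.hasDz ((ContinuousLinearMap.snd ℝ ℂ ℂ).hasFDerivAt.comp w hw) fun v => ?_
    simp only [ContinuousLinearMap.comp_apply, ContinuousLinearMap.flip_apply, Ω,
      connectionCLM_apply, ContinuousLinearMap.coe_snd', map_mul]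
    ring
  -- Because the form takes values in su(1,1), the function |A|² - |B|² is constant along solutions.
  -- It therefore keeps its initial value 1.
  have hdet : ∀ᶠ w in 𝓝 z, HasDz (fun w => (y w).1 * (starRingEnd ℂ) (y w).1
      - (y w).2 * (starRingEnd ℂ) (y w).2) 0 0 w := by
    filter_upwards [hA, hB] with w hA hB
    refine ((hA.mul hA.conj).sub (hB.mul hB.conj)).congr_val ?_ ?_ <;>
    simp only [map_add, map_sub, map_mul, map_div₀, map_ofNat, Complex.conj_conj,
      Complex.conj_I] <;> ring
  refine exists_rowEquation_of_entries (A := fun w => (y w).1) (B := fun w => (y w).2)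
    (by simp [hy0]) (hys.mono fun w hw =>
      ⟨contDiff_fst.contDiffAt.comp w hw, contDiff_snd.contDiffAt.comp w hw⟩)
    ((eventually_eq_of_hasDz_zero hdet).mono fun w hw => by rw [hw, hy0]; simp)
    (hA.mono fun w hw => ?_) (hB.mono fun w hw => ?_)
  · rwa [(hZ w).1, (hZ w).2.1, (hZ w).2.2] at hw
  · rwa [(hZ w).1, (hZ w).2.1, (hZ w).2.2] at hw

end

/-! ### Surfaces with a prescribed spinor -/

/-- The components of the one form with generating spinor `v`. -/
def spinorForm (v : Fin 2 → ℂ) : Fin 3 → ℂ :=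
  ![Complex.I / 2 * ((starRingEnd ℂ) (v 1) ^ 2 + v 0 ^ 2),
    1 / 2 * ((starRingEnd ℂ) (v 1) ^ 2 - v 0 ^ 2), v 0 * (starRingEnd ℂ) (v 1)]

lemma spinorRel_spinorForm (v : Fin 2 → ℂ) : SpinorRel (spinorForm v) (v 0) (v 1) :=
  ⟨rfl, rfl, rfl⟩

lemma SpinorRel.eq_spinorForm {Z : Fin 3 → ℂ} {v : Fin 2 → ℂ} (h : SpinorRel Z (v 0) (v 1)) :
    Z = spinorForm v := by
  funext k
  fin_cases k
  exacts [h.1, h.2.1, h.2.2]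

/-- Reverses `dirac_of_spinorRel`: inserting the Dirac equation for ∂̄ψ₁ and ∂ψ₂ makes the structure
equations identities, with the terms in H cancelling. -/
lemma exists_local_surface {D : Set ℂ} (hD : IsOpen D) {H : ℂ → ℝ} {ψ : ℂ → Fin 2 → ℂ}
    (hψ : ContDiffOn ℝ ∞ ψ D) (hdirac : DiracEquation D H ψ) {z : ℂ} (hz : z ∈ D) :
    ∃ s : ℂ → SL2Tilde, ∀ᶠ w in 𝓝 z, SmoothAt s w ∧ RowEquation s (spinorForm (ψ w)) w := by
  have hsm : ∀ w ∈ D, ∀ i, ContDiffAt ℝ ∞ (fun w => ψ w i) w := fun w hw =>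
    contDiffAt_pi.1 (hψ.contDiffAt (hD.mem_nhds hw))
  have hI := Complex.I_sq
  have key : ∀ w ∈ D,
      dzbar (fun w => ψ w 0 * (starRingEnd ℂ) (ψ w 1)) w
        = dzbar (fun w => ψ w 0) w * (starRingEnd ℂ) (ψ w 1)
          + ψ w 0 * (starRingEnd ℂ) (dz (fun w => ψ w 1) w) ∧
      dzbar (fun w => Complex.I * (starRingEnd ℂ) (ψ w 1) ^ 2) w
        = Complex.I * (2 * (starRingEnd ℂ) (ψ w 1) * (starRingEnd ℂ) (dz (fun w => ψ w 1) w)) ∧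
      dzbar (fun w => Complex.I * ψ w 0 ^ 2) w
        = Complex.I * (2 * ψ w 0 * dzbar (fun w => ψ w 0) w) := fun w hw => by
    have ha := (hsm w hw 0).differentiableAt_infty.hasDz
    have hb := (hsm w hw 1).differentiableAt_infty.hasDz
    exact ⟨(ha.mul hb.conj).2.2, (hb.conj.pow_two.const_mul _).2.2, (ha.pow_two.const_mul _).2.2⟩
  have hdirac := (diracEquation_iff H).1 hdirac
  refine exists_local_rowEquation (T := fun w => ψ w 0 * (starRingEnd ℂ) (ψ w 1))
    (P := fun w => Complex.I * (starRingEnd ℂ) (ψ w 1) ^ 2) (M := fun w => Complex.I * ψ w 0 ^ 2)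
    (fun w => ⟨rfl, ?_, ?_⟩) ?_ ?_ ?_
  · simp [spinorForm]; ring
  · simp [spinorForm]; ring
  · filter_upwards [hD.mem_nhds hz] with w hw
    have ha := hsm w hw 0
    have hb := contDiffAt_conj (hsm w hw 1)
    exact ⟨ha.mul hb, contDiffAt_const.mul (hb.pow 2), contDiffAt_const.mul (ha.pow 2)⟩
  · filter_upwards [hD.mem_nhds hz] with w hw
    obtain ⟨hq, hr⟩ := hdirac w hw
    rw [(key w hw).1, hq, hr]
    simp only [map_add, map_sub, map_mul, map_neg, map_div₀, map_ofNat, map_one, map_pow,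
      Complex.conj_conj, Complex.conj_I, Complex.conj_ofReal]
    linear_combination (0 : ℂ) * hI
  · filter_upwards [hD.mem_nhds hz] with w hw
    obtain ⟨hq, hr⟩ := hdirac w hw
    rw [(key w hw).2.1, (key w hw).2.2, hq, hr]
    simp only [map_add, map_sub, map_mul, map_neg, map_div₀, map_ofNat, map_one, map_pow,
      Complex.conj_conj, Complex.conj_I, Complex.conj_ofReal]
    linear_combination (0 : ℂ) * hI

lemma mul_inv_smul_eq {Γ : Type*} [Group Γ] (a b : Γ) : (a * b⁻¹) • b = a := by simp

theorem exists_surface {D : Set ℂ} (hD : IsOpen D) (hsc : IsSimplyConnected D) {H : ℂ → ℝ}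
    {ψ : ℂ → Fin 2 → ℂ} (hψ : ContDiffOn ℝ ∞ ψ D) (hdirac : DiracEquation D H ψ) (p : ℂ)
    (g : SL2Tilde) :
    ∃ f : ℂ → SL2Tilde, f p = g ∧
      ∀ z ∈ D, SmoothAt f z ∧ RowEquation f (spinorForm (ψ z)) z := by
  have hloc : ∀ i : D, ∃ s : ℂ → SL2Tilde, ∃ W : Set ℂ, IsOpen W ∧ (i : ℂ) ∈ W ∧
      ∀ w ∈ W, SmoothAt s w ∧ RowEquation s (spinorForm (ψ w)) w := fun i => by
    obtain ⟨s, hs⟩ := exists_local_surface hD hψ hdirac i.2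
    obtain ⟨W, h1, h2, h3⟩ := eventually_nhds_iff.1 hs
    exact ⟨s, W, h2, h3, h1⟩
  choose s W hWo hWm hs using hloc
  obtain ⟨F, hF⟩ := exists_global_section hD hsc (Γ := SL2Tilde) W hWo
    (fun z hz => ⟨⟨z, hz⟩, hWm ⟨z, hz⟩⟩) s (fun i j w => s i w * (s j w)⁻¹)
    (fun i j z _ _ _ => mul_inv_smul_eq _ _)
    (fun i z _ _ γ γ' e => mul_right_cancel e)
    (fun i j z _ hi hj => eventually_mul_inv_eq (hs i z hi).1 (hs j z hj).1
      (((hWo i).eventually_mem hi).mono fun w hw => (hs i w hw).2)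
      (((hWo j).eventually_mem hj).mono fun w hw => (hs j w hw).2))
  have hF' : ∀ z ∈ D, SmoothAt F z ∧ RowEquation F (spinorForm (ψ z)) z := fun z hz => by
    obtain ⟨i, γ, hi, e⟩ := hF z hz
    exact ⟨((hs i z hi).1.mul_left γ).congr_of_eventuallyEq e,
      ((hs i z hi).2.mul_left γ).congr_of_eventuallyEq e⟩
  -- Left translations preserve the equation, so the value at p can be prescribed.
  exact ⟨fun w => g * (F p)⁻¹ * F w, by simp, fun z hz =>
    ⟨(hF' z hz).1.mul_left _, (hF' z hz).2.mul_left _⟩⟩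

/-- A common spinor means a common logarithmic derivative, so f' f⁻¹ is locally constant; on a
connected domain it equals its value 1 at p. -/
theorem IsGeneratingSpinor.eqOn_of_eq {D : Set ℂ} (hD : IsOpen D) (hc : IsPreconnected D)
    {f f' : ℂ → SL2Tilde} {ψ : ℂ → Fin 2 → ℂ} (hf : IsConformalImmersion D f)
    (hf' : IsConformalImmersion D f') (h : IsGeneratingSpinor D f ψ)
    (h' : IsGeneratingSpinor D f' ψ) {p : ℂ} (hp : p ∈ D) (e : f' p = f p) :
    Set.EqOn f' f D := by
  have hrow : ∀ {k : ℂ → SL2Tilde}, IsConformalImmersion D k → IsGeneratingSpinor D k ψ →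
      ∀ z ∈ D, ∀ᶠ w in 𝓝 z, RowEquation k (spinorForm (ψ w)) w := fun hk hψ z hz => by
    filter_upwards [hD.mem_nhds hz] with w hw
    rw [← SpinorRel.eq_spinorForm (hψ.2 w hw)]
    exact (hk.smoothAt hD hw).rowEquation
  intro z hz
  have := eq_of_locally_constant hc (g := fun w => f' w * (f w)⁻¹) (fun z hz =>
    eventually_mul_inv_eq (hf'.smoothAt hD hz) (hf.smoothAt hD hz) (hrow hf' h' z hz)
      (hrow hf h z hz)) hz hp
  simp only [e, mul_inv_cancel] at this
  exact mul_inv_eq_one.1 this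

/-- ψ satisfies the Dirac equation both with H and with the mean curvature. The difference of the
two is linear in the difference of these functions, with a coefficient that vanishes only where ψ
does. -/
theorem IsGeneratingSpinor.meanCurvature_eq {D : Set ℂ} (hD : IsOpen D) {f : ℂ → SL2Tilde}
    {ψ : ℂ → Fin 2 → ℂ} (hf : IsConformalImmersion D f) (h : IsGeneratingSpinor D f ψ)
    {H : ℂ → ℝ} (hdirac : DiracEquation D H ψ) : Set.EqOn (meanCurvature f) H D := by
  intro z hz
  have hρ := normSq_add_ne_zero (h.ne_zero hf hz)
  obtain ⟨e1, e2⟩ := (diracEquation_iff _).1 (h.dirac hD hf) z hz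
  obtain ⟨e3, e4⟩ := (diracEquation_iff _).1 hdirac z hz
  have e5 := e1.symm.trans e3
  have e6 := e2.symm.trans e4
  have key : ((meanCurvature f z : ℂ) - H z)
      * (ψ z 0 * (starRingEnd ℂ) (ψ z 0) + ψ z 1 * (starRingEnd ℂ) (ψ z 1)) ^ 2 = 0 := by
    linear_combination 2 * (starRingEnd ℂ) (ψ z 1) * e5 - 2 * (starRingEnd ℂ) (ψ z 0) * e6
  have := (mul_eq_zero.1 key).resolve_right (pow_ne_zero 2 hρ)
  exact_mod_cast sub_eq_zero.1 this

lemma isConformalImmersion_of_rowEquation {D : Set ℂ} (hD : IsOpen D) {f : ℂ → SL2Tilde}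
    {ψ : ℂ → Fin 2 → ℂ} (h0 : ∀ z ∈ D, ψ z ≠ 0)
    (h : ∀ z ∈ D, SmoothAt f z ∧ RowEquation f (spinorForm (ψ z)) z) :
    IsConformalImmersion D f := by
  refine ⟨(contMDiffOn_iff_smoothAt hD).2 fun z hz => (h z hz).1, fun z hz => ?_⟩
  have hr := spinorRel_spinorForm (ψ z)
  rw [← (h z hz).2.zComp_eq] at hr
  obtain ⟨h1, h2, h3⟩ := firstForm_of_spinorRel hr
  refine ⟨?_, h2.trans h1.symm, h3⟩
  rw [h1]
  have h4 : ‖ψ z 0‖ ^ 2 + ‖ψ z 1‖ ^ 2 ≠ 0 := fun e => by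
    apply normSq_add_ne_zero (h0 z hz)
    rw [Complex.mul_conj, Complex.mul_conj, Complex.normSq_eq_norm_sq, Complex.normSq_eq_norm_sq,
      ← Complex.ofReal_add, e, Complex.ofReal_zero]
  positivity

end
end SLSurface

/-! ### Assembly of the two directions -/

theorem mainTheorem2 :
    (∀ (D : Set ℂ) (f : ℂ → SL2Tilde), IsOpen D → IsConformalImmersion D f →
      (IsSimplyConnected D → ∃ ψ : ℂ → Fin 2 → ℂ, IsGeneratingSpinor D f ψ ∧
        ∀ ψ' : ℂ → Fin 2 → ℂ, IsGeneratingSpinor D f ψ' →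
          Set.EqOn ψ' ψ D ∨ Set.EqOn ψ' (fun z => -ψ z) D) ∧
      ContDiffOn ℝ ∞ (confExp f) D ∧ ContDiffOn ℝ ∞ (meanCurvature f) D ∧
      ContDiffOn ℝ ∞ (hopf f) D ∧
      ∀ ψ : ℂ → Fin 2 → ℂ, IsGeneratingSpinor D f ψ →
        (∀ z ∈ D, ψ z ≠ 0 ∧ Real.exp (confExp f z) = ‖ψ z 0‖ ^ 2 + ‖ψ z 1‖ ^ 2) ∧
        DiracEquation D (meanCurvature f) ψ ∧
        WeingartenEquations D (confExp f) (hopf f) ψ ∧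
        HopfFormula D (hopf f) ψ ∧
        CodazziEquations D (confExp f) (meanCurvature f) (hopf f)
          (fun z => ψ z 0 * (starRingEnd ℂ) (ψ z 1))) ∧
    (∀ (D : Set ℂ) (H : ℂ → ℝ) (ψ : ℂ → Fin 2 → ℂ), IsOpen D → IsSimplyConnected D →
      ContDiffOn ℝ ∞ ψ D → (∀ z ∈ D, ψ z ≠ 0) → DiracEquation D H ψ →
      ∀ p ∈ D, ∀ g : SL2Tilde, ∃ f : ℂ → SL2Tilde,
        f p = g ∧ IsConformalImmersion D f ∧ IsGeneratingSpinor D f ψ ∧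
        Set.EqOn (meanCurvature f) H D ∧
        ∀ f' : ℂ → SL2Tilde, f' p = g → IsConformalImmersion D f' → IsGeneratingSpinor D f' ψ →
          Set.EqOn f' f D) := by
  refine ⟨fun D f hD hf => ⟨fun hsc => ?_,
    fun z hz => (contDiffAt_confExp hD hf hz).contDiffWithinAt,
    fun z hz => (contDiffAt_meanCurvature hD hf hz).contDiffWithinAt,
    fun z hz => (contDiffAt_hopf hD hf hz).contDiffWithinAt,
    fun ψ h => ⟨fun z hz => ⟨h.ne_zero hf hz, h.exp_confExp hf hz⟩, h.dirac hD hf,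
      h.weingarten hD hf, h.hopfFormula hD hf, h.codazzi hD hf⟩⟩,
    fun D H ψ hD hsc hψ h0 hdirac p hp g => ?_⟩
  · obtain ⟨ψ, h⟩ := exists_isGeneratingSpinor hD hsc hf
    exact ⟨ψ, h, fun ψ' h' =>
      h.eqOn_or_eqOn_neg hD hsc.isPathConnected.isConnected.isPreconnected hf h'⟩
  · obtain ⟨f, hfp, hf⟩ := exists_surface hD hsc hψ hdirac p g
    have hconf := isConformalImmersion_of_rowEquation hD h0 hf
    have hgen : IsGeneratingSpinor D f ψ := ⟨hψ, fun z hz => by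
      rw [(hf z hz).2.zComp_eq]
      exact spinorRel_spinorForm (ψ z)⟩
    exact ⟨f, hfp, hconf, hgen, hgen.meanCurvature_eq hD hconf hdirac, fun f' hf'p hf' hgen' =>
      hgen.eqOn_of_eq hD hsc.isPathConnected.isConnected.isPreconnected hconf hf' hgen' hp
        (hf'p.trans hfp.symm)⟩
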